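/- Let $\mathbb{D}=\{z\in\mathbb{C}:|z|<1\}$. Call a bounded domain (non-empty connected open set) $D\subset\mathbb{C}$ an \emph{analytic domain} if it is finitely connected (its boundary has finitely many connected components) and each component of $\partial D$ is an analytic Jordan curve, i.e. the image of the unit circle under a map that is holomorphic and injective in a neighbourhood of the unit circle. A map $B:D\to\mathbb{D}$ is \emph{proper} if it is continuous and $B^{-1}(L)$ is compact for every compact $L\subset\mathbb{D}$. For $n\ge 1$ and $0<\delta,c<1$ put $$\mathcal{B}_{n,\delta,c}(z)=z\prod_{j=0}^{n-1}\frac{e^{2\pi i j/n}z+r}{1+re^{2\pi i j/n}z},\qquad r=1-\frac{\delta(1-c)}{n}.$$ For a set $K$, write $\|g\|_K=\sup_{z\in K}|g(z)|$. Theorem. Let $\varepsilon>0$, let $D\subset\mathbb{C}$ be an analytic domain, $K\subset D$ compact, and $f:D\to\mathbb{D}$ holomorphic. Then there exist $0<M<\infty$ and a sequence $(B_n)_{n\ge 1}$ of proper holomorphic maps $B_n:D\to\mathbb{D}$, each extending analytically to a neighbourhood of $\overline{D}$, such that $$\sup_{n\ge 1}\|B_n-f\|_K<\varepsilon\qquad\text{and}\qquad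 \frac{n}{M}\le |B_n'(z)|\le nM\quad\text{for all } z\in\partial D \text{ and all } n\ge 1.$$ Moreover, the $B_n$ can be chosen of the form $B_n=\mathcal{B}_{n,\delta,c}\circ B$ on $D$, where $B:D\to\mathbb{D}$ is a single proper holomorphic map with $\|B-f\|_K<\varepsilon$ and $\delta,c\in(0,1)$ do not depend on $n$. -/

import Mathlib

open scoped ENNReal

namespace ProperApprox

/-- An analytic Jordan curve in the plane: the image of the unit circle under a map that is
holomorphic and injective in some open neighbourhood of the unit circle. -/
def IsAnalyticJordanCurve (Γ : Set ℂ) : Prop :=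
  ∃ (U : Set ℂ) (φ : ℂ → ℂ), IsOpen U ∧ Metric.sphere (0 : ℂ) 1 ⊆ U ∧
    DifferentiableOn ℂ φ U ∧ Set.InjOn φ U ∧ φ '' Metric.sphere (0 : ℂ) 1 = Γ

/-- An analytic domain: a finitely connected (bounded) domain in the plane all of whose boundary
components are analytic Jordan curves. The degree of connectivity is the number of components
of the boundary (equivalently, of the complement in the Riemann sphere). Boundedness expresses
that the boundary in the Riemann sphere consists of Jordan curves in the plane, so that the
point at infinity is not a boundary point of the domain. -/
structure IsAnalyticDomain (D : Set ℂ) : Prop where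
  isOpen : IsOpen D
  isConnected : IsConnected D
  isBounded : Bornology.IsBounded D
  finite_components : {Γ : Set ℂ | ∃ z ∈ frontier D, Γ = connectedComponentIn (frontier D) z}.Finite
  analytic_components :
    ∀ z ∈ frontier D, IsAnalyticJordanCurve (connectedComponentIn (frontier D) z)

/-- A proper map from `D` to the open unit disc: a map, continuous on `D`, that maps `D` into the
disc and pulls compact subsets of the disc back to compact subsets of `D`. -/
structure IsProperToDisc (D : Set ℂ) (f : ℂ → ℂ) : Prop where
  continuousOn : ContinuousOn f D
  mapsTo : Set.MapsTo f D (Metric.ball 0 1)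
  isCompact_preimage :
    ∀ L : Set ℂ, L ⊆ Metric.ball 0 1 → IsCompact L → IsCompact (D ∩ f ⁻¹' L)

/-- The finite Blaschke product
`z * ∏_{j < n} (e^{2πij/n} z + r) / (1 + r e^{2πij/n} z)`, with `r = 1 - δ (1 - c) / n`. -/
noncomputable def blaschke (n : ℕ) (δ c : ℝ) (z : ℂ) : ℂ :=
  let r : ℂ := ((1 - δ * (1 - c) / n : ℝ) : ℂ)
  z * ∏ j ∈ Finset.range n,
    (Complex.exp (2 * Real.pi * Complex.I * j / n) * z + r) /
      (1 + r * Complex.exp (2 * Real.pi * Complex.I * j / n) * z)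

/-- The supremum norm of `g` on `K`, as an extended nonnegative real. -/
noncomputable def supNorm (K : Set ℂ) (g : ℂ → ℂ) : ℝ≥0∞ := ⨆ z ∈ K, ‖g z‖ₑ

end ProperApprox

/-! ### Cauchy transforms over images of circles -/

namespace ProperApprox

open Complex Metric Set Filter Topology

/-! Take τ < 1 close to 1. Then F = (1 + τf)/(1 − τf) satisfies Re F ≥ m > 0 on D. It is enough to
approximate F on K by a holomorphic G with Re G > 0 which, near each boundary curve, is a finite sum
of simple poles on the curve plus a function holomorphic across it, with Re G = 0 on the curve off
the poles. Then g = (G − 1)/(G + 1) is analytic across ∂D and unimodular there, hence proper, and it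
is close to τf. A Schwarz lemma argument (`not_hasDerivAt_zero_of_mapsTo_ball`) shows that g' has no
zero on ∂D.

To build G, parametrise collars of the boundary curves by injective holomorphic maps φ_k of an
annulus (`exists_collarSystem`). In the k-th collar F ∘ φ_k = W_k + Z_k, where W_k is holomorphic on
the unit disc with Re W_k ≥ m, and Z_k is holomorphic across the unit circle and imaginary on it
(`exists_collar_splitting`). By the Herglotz formula W_k is, on a circle |w| = ρ < 1, a limit of
finite sums H_k of kernels (η + w)/(η − w) with |η| = 1 and positive coefficients.

Replacing W_k by H_k is an additive Cousin problem. Put q_k = Y_k + H_k − (1 + t)W_k with Y_k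
holomorphic past the unit circle and t real. The sum J q of Cauchy transforms over the collar
circles jumps by q_k, so J q + (1 + t)F, taken inside, continues into the collars as H_k + Y_k + J q
+ (1 + t)Z_k. If q is small on |w| = ρ and t is small, this is close to F on K. It is imaginary on
the boundary off the poles once Re Y_k = −Re J q there. With w = (W_k), w' = (H_k), y = (Y_k), this
reads y + M(y + w' − w − t w) = 0, where M is J followed by reflection in the unit circle.

M is a norm limit of finite rank operators, so 1 + M is Fredholm and only finitely many linear
conditions on w' remain. They can be met exactly by positive combinations: a functional that is
non-negative on all kernels and zero on w kills every kernel, because Re W_k ≥ m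
(`apply_nonneg_of_herglotz`). So in the finite-dimensional space of conditions the cone of the
kernels is a linear subspace, and small errors can be corrected within the cone
(`exists_hull_mem_ker`).

For the sequence, the Blaschke product equals z(s − (−z)^n)/(1 − s(−z)^n) with s = r^n, and s stays
in a compact part of (0, 1). On the circle its derivative has modulus 1 + n times a Poisson kernel,
hence is comparable to n. Inside, it differs from z by at most 2(1 − s)/(1 − |z|). -/

/-- The open annulus centred at the origin with radii `a` and `b`. -/
def annulus (a b : ℝ) : Set ℂ := {w | a < ‖w‖ ∧ ‖w‖ < b}

theorem mem_annulus {a b : ℝ} {w : ℂ} : w ∈ annulus a b ↔ a < ‖w‖ ∧ ‖w‖ < b := Iff.rfl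

theorem isOpen_annulus (a b : ℝ) : IsOpen (annulus a b) :=
  (isOpen_lt continuous_const continuous_norm).inter (isOpen_lt continuous_norm continuous_const)

theorem annulus_subset {a b a' b' : ℝ} (ha : a' ≤ a) (hb : b ≤ b') :
    annulus a b ⊆ annulus a' b' := fun _ hw => ⟨ha.trans_lt hw.1, hw.2.trans_le hb⟩

theorem isPreconnected_annulus {a b : ℝ} (ha : 0 ≤ a) : IsPreconnected (annulus a b) := by
  have h : annulus a b = (fun p : ℝ × ℝ => (p.1 : ℂ) * exp (p.2 * I)) '' (Ioo a b ×ˢ univ) := by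
    ext w
    constructor
    · intro hw
      exact ⟨(‖w‖, arg w), ⟨hw, mem_univ _⟩, norm_mul_exp_arg_mul_I w⟩
    · rintro ⟨⟨r, t⟩, ⟨hr, -⟩, rfl⟩
      have : 0 < r := ha.trans_lt hr.1
      simpa [annulus, norm_exp_ofReal_mul_I, abs_of_pos this] using hr
  rw [h]
  refine IsPreconnected.image (isPreconnected_Ioo.prod isPreconnected_univ) _ ?_
  fun_prop

theorem exists_pos_forall_le_norm_sub {X : Type*} [TopologicalSpace X] {S : Set X}
    (hS : IsCompact S) {K : Set ℂ} (hK : IsCompact K) {p : X → ℂ} (hp : ContinuousOn p S)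
    (h : ∀ x ∈ S, p x ∉ K) : ∃ δ > 0, ∀ x ∈ S, ∀ z ∈ K, δ ≤ ‖p x - z‖ := by
  have hd : Disjoint (p '' S) K := by
    rw [Set.disjoint_left]
    rintro _ ⟨x, hx, rfl⟩
    exact h x hx
  obtain ⟨δ, hδ, H⟩ := Metric.exists_pos_forall_lt_edist (hS.image_of_continuousOn hp) hK.isClosed hd
  refine ⟨δ, NNReal.coe_pos.2 hδ, fun x hx z hz => ?_⟩
  have := H (p x) (mem_image_of_mem _ hx) z hz
  rw [edist_nndist, ENNReal.coe_lt_coe] at this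
  rw [← dist_eq_norm]
  exact this.le

/-- Differentiation under the integral sign: for parameters near z the curve stays at distance at
least δ/2, which dominates the differentiated kernel. -/
theorem hasDerivAt_circleIntegral_div_sub {r : ℝ} (hr : 0 ≤ r) {g p : ℂ → ℂ}
    (hg : ContinuousOn g (sphere 0 r)) (hp : ContinuousOn p (sphere 0 r)) {z : ℂ}
    (hz : z ∉ p '' sphere 0 r) :
    HasDerivAt (fun z => ∮ η in C(0, r), g η / (p η - z)) (∮ η in C(0, r), g η / (p η - z) ^ 2)
      z := by
  obtain ⟨δ, hδ, H⟩ := exists_pos_forall_le_norm_sub (isCompact_sphere (0 : ℂ) r)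
    (isCompact_singleton (x := z)) hp (fun x hx h => hz ⟨x, hx, h⟩)
  have hm : ∀ θ : ℝ, circleMap 0 r θ ∈ sphere (0 : ℂ) r := fun θ => circleMap_mem_sphere 0 hr θ
  have hlow : ∀ x ∈ ball z (δ / 2), ∀ θ : ℝ, δ / 2 ≤ ‖p (circleMap 0 r θ) - x‖ := by
    intro x hx θ
    have h1 := H _ (hm θ) z rfl
    have h2 : ‖p (circleMap 0 r θ) - z‖ ≤ ‖p (circleMap 0 r θ) - x‖ + ‖x - z‖ := by
      simpa using norm_add_le (p (circleMap 0 r θ) - x) (x - z)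
    rw [mem_ball, dist_eq_norm] at hx
    linarith
  have hne : ∀ x ∈ ball z (δ / 2), ∀ θ : ℝ, p (circleMap 0 r θ) - x ≠ 0 := fun x hx θ =>
    norm_pos_iff.1 (lt_of_lt_of_le (by positivity) (hlow x hx θ))
  have hgc : Continuous fun θ : ℝ => g (circleMap 0 r θ) :=
    hg.comp_continuous (continuous_circleMap 0 r) hm
  have hpc : Continuous fun θ : ℝ => p (circleMap 0 r θ) :=
    hp.comp_continuous (continuous_circleMap 0 r) hm
  have hdc : Continuous fun θ : ℝ => deriv (circleMap 0 r) θ := by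
    simp only [deriv_circleMap]; fun_prop
  obtain ⟨C, hC⟩ := (isCompact_sphere (0 : ℂ) r).exists_bound_of_continuousOn hg
  have hzb : z ∈ ball z (δ / 2) := mem_ball_self (by positivity)
  refine (intervalIntegral.hasDerivAt_integral_of_dominated_loc_of_deriv_le
    (F := fun x θ => deriv (circleMap 0 r) θ • (g (circleMap 0 r θ) / (p (circleMap 0 r θ) - x)))
    (F' := fun x θ => deriv (circleMap 0 r) θ •
      (g (circleMap 0 r θ) / (p (circleMap 0 r θ) - x) ^ 2))
    (bound := fun _ => r * (C / (δ / 2) ^ 2))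
    (s := ball z (δ / 2)) (ball_mem_nhds _ (by positivity)) ?_ ?_ ?_ ?_ ?_ ?_).2
  · filter_upwards [ball_mem_nhds z (show 0 < δ / 2 by positivity)] with x hx
    exact (hdc.smul (hgc.div (hpc.sub continuous_const) (hne x hx))).aestronglyMeasurable
  · exact (hdc.smul (hgc.div (hpc.sub continuous_const) (hne z hzb))).intervalIntegrable _ _
  · exact (hdc.smul (hgc.div ((hpc.sub continuous_const).pow 2)
      (fun θ => pow_ne_zero 2 (hne z hzb θ)))).aestronglyMeasurable
  · refine Eventually.of_forall fun θ _ x hx => ?_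
    have h0 := hlow x hx θ
    have h1 := hC _ (hm θ)
    rw [norm_smul, deriv_circleMap, norm_div, norm_pow]
    have : ‖circleMap 0 r θ * I‖ = r := by simp [abs_of_nonneg hr]
    rw [this]
    have hC0 : 0 ≤ C := (norm_nonneg _).trans h1
    gcongr
  · simp
  · refine Eventually.of_forall fun θ _ x hx => ?_
    have h0 := hne x hx θ
    have h1 : HasDerivAt (fun x => p (circleMap 0 r θ) - x) (-1) x := by
      simpa using (hasDerivAt_id x).const_sub (p (circleMap 0 r θ))
    have h2 := ((hasDerivAt_const x (g (circleMap 0 r θ))).div h1 h0).const_smul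
      (deriv (circleMap 0 r) θ)
    refine h2.congr_deriv ?_
    simp

/-- A holomorphic injective map on an open set has open image, non-vanishing derivative and a
holomorphic inverse. -/
theorem deriv_ne_zero_and_inverse {U : Set ℂ} (hU : IsOpen U) {φ : ℂ → ℂ}
    (hd : DifferentiableOn ℂ φ U) (hi : InjOn φ U) :
    IsOpen (φ '' U) ∧ (∀ w ∈ U, deriv φ w ≠ 0) ∧
      ∃ ψ : ℂ → ℂ, DifferentiableOn ℂ ψ (φ '' U) ∧ ∀ w ∈ U, ψ (φ w) = w := by
  have hopen : ∀ V ⊆ U, IsOpen V → IsOpen (φ '' V) := by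
    intro V hVU hV
    rw [isOpen_iff_mem_nhds]
    rintro _ ⟨w, hw, rfl⟩
    have ha : AnalyticAt ℂ φ w := hd.analyticAt (hU.mem_nhds (hVU hw))
    -- Open mapping dichotomy; local constancy contradicts injectivity.
    rcases ha.eventually_constant_or_nhds_le_map_nhds_aux with h | h
    · exfalso
      have h2 : ∀ᶠ z in 𝓝[≠] w, φ z = φ w ∧ z ∈ U :=
        ((h.and (hU.mem_nhds (hVU hw))).filter_mono nhdsWithin_le_nhds)
      obtain ⟨z, ⟨hz1, hz2⟩, hz3⟩ := (h2.and self_mem_nhdsWithin).exists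
      exact hz3 (hi hz2 (hVU hw) hz1)
    · exact h (image_mem_map (hV.mem_nhds hw))
  set ψ := Function.invFunOn φ U with hψ
  have hleft : ∀ w ∈ U, ψ (φ w) = w := fun w hw => hi.leftInvOn_invFunOn hw
  have hcont : ∀ w ∈ U, ContinuousAt ψ (φ w) := by
    intro w hw
    rw [ContinuousAt, hleft w hw]
    intro N hN
    obtain ⟨V, hVN, hV, hwV⟩ := _root_.mem_nhds_iff.1 hN
    refine mem_map.2 (mem_of_superset ((hopen (V ∩ U) inter_subset_right
      (hV.inter hU)).mem_nhds ⟨w, ⟨hwV, hw⟩, rfl⟩) ?_)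
    rintro _ ⟨v, hv, rfl⟩
    rw [mem_preimage, hleft v hv.2]
    exact hVN hv.1
  have hright : ∀ w ∈ U, ∀ᶠ y in 𝓝 (φ w), φ (ψ y) = y := by
    intro w hw
    filter_upwards [(hopen U subset_rfl hU).mem_nhds ⟨w, hw, rfl⟩]
    rintro _ ⟨v, hv, rfl⟩
    rw [hleft v hv]
  have hreg : ∀ w ∈ U, deriv φ w ≠ 0 → DifferentiableAt ℂ ψ (φ w) := by
    intro w hw hne
    have h1 : HasDerivAt φ (deriv φ w) (ψ (φ w)) := by
      rw [hleft w hw]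
      exact (hd.differentiableAt (hU.mem_nhds hw)).hasDerivAt
    exact (h1.of_local_left_inverse (hcont w hw) hne (hright w hw)).differentiableAt
  have hdiff : ∀ w ∈ U, DifferentiableAt ℂ ψ (φ w) := by
    intro w hw
    by_cases hw0 : deriv φ w = 0
    swap
    · exact hreg w hw hw0
    have ha : AnalyticAt ℂ (deriv φ) w := (hd.analyticAt (hU.mem_nhds hw)).deriv
    rcases ha.eventually_eq_zero_or_eventually_ne_zero with h | h
    · exfalso
      obtain ⟨ε, hε, hb⟩ := Metric.mem_nhds_iff.1 (h.and (hU.mem_nhds hw))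
      have hx : w + (ε / 2 : ℝ) ∈ ball w ε := by
        simpa [abs_of_pos hε] using half_lt_self hε
      have : φ (w + (ε / 2 : ℝ)) = φ w := by
        refine (convex_ball w ε).is_const_of_fderivWithin_eq_zero (𝕜 := ℂ)
          (hd.mono fun x hx => (hb hx).2) (fun x hx' => ?_) hx (mem_ball_self hε)
        rw [fderivWithin_of_isOpen isOpen_ball hx']
        ext
        simpa using (hb hx').1
      have h2 := hi (hb hx).2 hw this
      simp at h2
      exact hε.ne' h2
    -- Zeros of `deriv φ` are isolated, so ψ is holomorphic on a punctured neighbourhood of φ w and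
    -- continuous at φ w: the singularity is removable. The chain rule for ψ ∘ φ = id below then
    -- excludes the zero.
    · refine (analyticAt_of_differentiable_on_punctured_nhds_of_continuousAt ?_
        (hcont w hw)).differentiableAt
      rw [eventually_nhdsWithin_iff] at h ⊢
      have h3 : ∀ᶠ y in 𝓝 (φ w), ψ y ∈ {z | z ≠ w → deriv φ z ≠ 0} ∩ U := by
        refine (hcont w hw).eventually ?_
        rw [hleft w hw]
        exact h.and (hU.mem_nhds hw)
      filter_upwards [h3, hright w hw] with y hy hy' hyne
      rw [← hy']
      refine hreg _ hy.2 (hy.1 fun h4 => hyne ?_)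
      rw [← hy', h4]
      rfl
  refine ⟨hopen U subset_rfl hU, fun w hw h0 => ?_, ψ, ?_, hleft⟩
  · have h1 : HasDerivAt (ψ ∘ φ) (deriv ψ (φ w) * deriv φ w) w :=
      (hdiff w hw).hasDerivAt.comp w (hd.differentiableAt (hU.mem_nhds hw)).hasDerivAt
    have h2 : HasDerivAt (ψ ∘ φ) 1 w :=
      (hasDerivAt_id w).congr_of_eventuallyEq (by
        filter_upwards [hU.mem_nhds hw] with v hv
        exact hleft v hv)
    have := h1.unique h2
    rw [h0, mul_zero] at this
    exact zero_ne_one this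
  · rintro _ ⟨w, hw, rfl⟩
    exact (hdiff w hw).differentiableWithinAt

/-- The Cauchy transform of `d` over the image under `φ` of the circle of radius `r`. -/
noncomputable def cauchyT (φ : ℂ → ℂ) (r : ℝ) (d : ℂ → ℂ) (z : ℂ) : ℂ :=
  (2 * Real.pi * I)⁻¹ * ∮ η in C(0, r), d η * deriv φ η / (φ η - z)

theorem differentiableAt_cauchyT {φ d : ℂ → ℂ} {r : ℝ} (hr : 0 ≤ r)
    (hφ : ContinuousOn φ (sphere 0 r)) (hφ' : ContinuousOn (deriv φ) (sphere 0 r))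
    (hd : ContinuousOn d (sphere 0 r)) {z : ℂ} (hz : z ∉ φ '' sphere 0 r) :
    DifferentiableAt ℂ (cauchyT φ r d) z :=
  ((hasDerivAt_circleIntegral_div_sub hr (hd.mul hφ') hφ hz).differentiableAt).const_mul _

theorem circleIntegral_eq_of_differentiableOn_annulus {r₁ r₂ : ℝ} (h₁ : 0 < r₁)
    (h₁₂ : r₁ ≤ r₂) {f : ℂ → ℂ}
    (hf : ∀ w, r₁ ≤ ‖w‖ → ‖w‖ ≤ r₂ → DifferentiableAt ℂ f w) :
    (∮ z in C(0, r₂), f z) = ∮ z in C(0, r₁), f z := by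
  refine circleIntegral_eq_of_differentiable_on_annulus_off_countable h₁ h₁₂
    countable_empty ?_ ?_
  · intro z hz
    simp only [Set.mem_sdiff, mem_closedBall, dist_zero_right, mem_ball, not_lt] at hz
    exact (hf z hz.2 hz.1).continuousAt.continuousWithinAt
  · intro z hz
    simp only [Set.mem_sdiff, mem_closedBall, dist_zero_right, mem_ball, not_le] at hz
    exact hf z hz.1.2.le hz.1.1.le

/-- Contour deformation: φ omits z between the two circles, so the integrand is holomorphic there.
-/
theorem cauchyT_eq_of_notMem {φ d : ℂ → ℂ} {a b r₁ r₂ : ℝ} (ha : 0 ≤ a) (h₁ : a < r₁)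
    (h₁₂ : r₁ ≤ r₂) (h₂ : r₂ < b) (hφ : DifferentiableOn ℂ φ (annulus a b))
    (hd : DifferentiableOn ℂ d (annulus a b)) {z : ℂ}
    (hz : ∀ w, r₁ ≤ ‖w‖ → ‖w‖ ≤ r₂ → φ w ≠ z) :
    cauchyT φ r₂ d z = cauchyT φ r₁ d z := by
  rw [cauchyT, cauchyT, circleIntegral_eq_of_differentiableOn_annulus (ha.trans_lt h₁) h₁₂]
  intro w hw₁ hw₂
  have hw : annulus a b ∈ 𝓝 w := (isOpen_annulus a b).mem_nhds ⟨h₁.trans_le hw₁, hw₂.trans_lt h₂⟩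
  exact ((hd.differentiableAt hw).mul (hφ.analyticAt hw).deriv.differentiableAt).div
    ((hφ.differentiableAt hw).sub_const z) (sub_ne_zero.2 (hz w hw₁ hw₂))

theorem circleIntegral_inv_sub_of_norm_lt {r : ℝ} (hr : 0 ≤ r) {w : ℂ} (hw : r < ‖w‖) :
    (∮ η in C(0, r), (η - w)⁻¹) = 0 := by
  refine circleIntegral_eq_zero_of_differentiable_on_off_countable hr countable_empty ?_ ?_
  · intro z hz
    have : z - w ≠ 0 := by
      rintro h
      rw [sub_eq_zero.1 h] at hz
      simp at hz; linarith
    exact ((continuous_id.sub continuous_const).continuousAt.inv₀ this).continuousWithinAt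
  · intro z hz
    have : z - w ≠ 0 := by
      rintro h
      rw [sub_eq_zero.1 h] at hz
      simp at hz; linarith
    exact (differentiableAt_id.sub_const w).inv this

/-- The jump relation for Cauchy transforms. -/
theorem cauchyT_sub_cauchyT {φ d : ℂ → ℂ} {a b r₁ r₂ : ℝ} (ha : 0 ≤ a) (h₁ : a < r₁)
    (h₂ : r₂ < b) (hφ : DifferentiableOn ℂ φ (annulus a b)) (hi : InjOn φ (annulus a b))
    (hd : DifferentiableOn ℂ d (annulus a b)) {w : ℂ} (hw₁ : r₁ < ‖w‖) (hw₂ : ‖w‖ < r₂) :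
    cauchyT φ r₂ d (φ w) - cauchyT φ r₁ d (φ w) = d w := by
  have hwA : w ∈ annulus a b := ⟨h₁.trans hw₁, hw₂.trans h₂⟩
  have hwn := (isOpen_annulus a b).mem_nhds hwA
  obtain ⟨-, hφ', -⟩ := deriv_ne_zero_and_inverse (isOpen_annulus a b) hφ hi
  have hsl : DifferentiableOn ℂ (dslope φ w) (annulus a b) := (differentiableOn_dslope hwn).2 hφ
  have hsl0 : ∀ η ∈ annulus a b, dslope φ w η ≠ 0 := by
    intro η hη
    rcases eq_or_ne η w with rfl | hne
    · rw [dslope_same]; exact hφ' _ hη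
    · rw [dslope_of_ne _ hne, slope_def_field]
      exact div_ne_zero (sub_ne_zero.2 fun h => hne (hi hη hwA h)) (sub_ne_zero.2 hne)
  have hder : DifferentiableOn ℂ (deriv φ) (annulus a b) := hφ.deriv (isOpen_annulus a b)
  -- Writing φ η − φ w = (η − w) · `dslope φ w η`, the integrand becomes A η/(η − w) = `dslope A w
  -- η` + d w/(η − w). The first term is holomorphic and cancels between the two circles; the second
  -- contributes d w from the outer circle only.
  set A : ℂ → ℂ := fun η => d η * deriv φ η / dslope φ w η with hA
  have hAd : DifferentiableOn ℂ A (annulus a b) := (hd.mul hder).div hsl hsl0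
  have hAw : A w = d w := by
    simp only [hA, dslope_same]
    field_simp [hφ' w hwA]
  have hsA : DifferentiableOn ℂ (dslope A w) (annulus a b) := (differentiableOn_dslope hwn).2 hAd
  have key : ∀ r, a < r → r < b → r ≠ ‖w‖ →
      (∮ η in C(0, r), d η * deriv φ η / (φ η - φ w)) =
        (∮ η in C(0, r), dslope A w η) + d w * ∮ η in C(0, r), (η - w)⁻¹ := by
    intro r hr₁ hr₂ hrw
    have hr0 : 0 ≤ r := ha.trans hr₁.le
    have hsub : sphere (0 : ℂ) r ⊆ annulus a b := by
      intro η hη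
      rw [mem_sphere_zero_iff_norm] at hη
      exact ⟨hη ▸ hr₁, hη ▸ hr₂⟩
    have hne : ∀ η ∈ sphere (0 : ℂ) r, η - w ≠ 0 := by
      intro η hη h
      rw [sub_eq_zero.1 h, mem_sphere_zero_iff_norm] at hη
      exact hrw hη.symm
    rw [← smul_eq_mul (d w), ← circleIntegral.integral_smul, ← circleIntegral.integral_add]
    · refine circleIntegral.integral_congr hr0 fun η hη => ?_
      have h0 := hne η hη
      have hs0 := hsl0 η (hsub hη)
      have e1 : φ η - φ w = (η - w) * dslope φ w η := by
        rw [← smul_eq_mul, sub_smul_dslope]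
      have e2 : (η - w) * dslope A w η = A η - A w := by
        rw [← smul_eq_mul, sub_smul_dslope]
      have e3 : dslope A w η = (A η - d w) / (η - w) := by
        rw [← hAw, ← e2]; field_simp
      have e4 : A η * dslope φ w η = d η * deriv φ η := div_mul_cancel₀ _ hs0
      simp only [smul_eq_mul]
      rw [e1, e3, ← e4]
      field_simp
      ring
    · exact (hsA.continuousOn.mono hsub).circleIntegrable hr0
    · refine ContinuousOn.circleIntegrable hr0 ?_
      exact (continuousOn_const (c := d w)).smul ((continuousOn_id.sub continuousOn_const).inv₀ hne)
  rw [cauchyT, cauchyT, key r₂ (h₁.trans (hw₁.trans hw₂)) h₂ hw₂.ne',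
    key r₁ h₁ (hw₁.trans (hw₂.trans h₂)) hw₁.ne,
    circleIntegral_inv_sub_of_norm_lt (ha.trans h₁.le) hw₁,
    circleIntegral.integral_sub_inv_of_mem_ball (by simpa using hw₂),
    circleIntegral_eq_of_differentiableOn_annulus (ha.trans_lt h₁) (hw₁.trans hw₂).le fun η h h' =>
      hsA.differentiableAt ((isOpen_annulus a b).mem_nhds ⟨h₁.trans_le h, h'.trans_lt h₂⟩)]
  have := two_pi_I_ne_zero
  field_simp
  ring

theorem norm_cauchyT_le {φ d : ℂ → ℂ} {r C C' δ : ℝ} (hr : 0 ≤ r) (hδ : 0 < δ)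
    (hd : ∀ η ∈ sphere (0 : ℂ) r, ‖d η‖ ≤ C) (hφ : ∀ η ∈ sphere (0 : ℂ) r, ‖deriv φ η‖ ≤ C')
    {z : ℂ} (hz : ∀ η ∈ sphere (0 : ℂ) r, δ ≤ ‖φ η - z‖) :
    ‖cauchyT φ r d z‖ ≤ r * C' / δ * C := by
  have hmem : (r : ℂ) ∈ sphere (0 : ℂ) r := by simp [abs_of_nonneg hr]
  have hC : 0 ≤ C := (norm_nonneg _).trans (hd r hmem)
  have hC' : 0 ≤ C' := (norm_nonneg _).trans (hφ r hmem)
  have := circleIntegral.norm_two_pi_i_inv_smul_integral_le_of_norm_le_const (c := 0) hr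
    (f := fun η => d η * deriv φ η / (φ η - z)) (C := C * C' / δ) (fun η hη => by
      rw [norm_div, norm_mul]
      have h1 := hd η hη
      have h2 := hφ η hη
      have h3 := hz η hη
      gcongr)
  rw [smul_eq_mul] at this
  calc _ ≤ _ := this
    _ = _ := by ring

end ProperApprox

/-! ### Laurent splitting and reflection in the unit circle -/

namespace ProperApprox

open Complex Metric Set Filter Topology
open scoped ComplexConjugate

/-- The `n`-th Laurent coefficient of `v` computed over the circle of radius `s`. -/
noncomputable def coef (s : ℝ) (v : ℂ → ℂ) (n : ℕ) : ℂ :=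
  (2 * Real.pi * I)⁻¹ * ∮ η in C(0, s), v η / η ^ (n + 1)

theorem cauchyT_id (s : ℝ) (v : ℂ → ℂ) (w : ℂ) :
    cauchyT id s v w = (2 * Real.pi * I)⁻¹ * ∮ η in C(0, s), v η / (η - w) := by
  simp [cauchyT]

theorem hasSum_coef {s : ℝ} (hs : 0 ≤ s) {v : ℂ → ℂ} (hv : ContinuousOn v (sphere 0 s)) {w : ℂ}
    (hw : ‖w‖ < s) : HasSum (fun n => coef s v n * w ^ n) (cauchyT id s v w) := by
  have h := (hasSum_two_pi_I_cauchyPowerSeries_integral (hv.circleIntegrable hs)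
    (c := 0) hw).mul_left (2 * Real.pi * I : ℂ)⁻¹
  rw [cauchyT_id]
  have e1 : (∮ z in C(0, s), (z - (0 + w))⁻¹ • v z) = ∮ η in C(0, s), v η / (η - w) := by
    congr 1
    funext z
    simp only [smul_eq_mul, div_eq_mul_inv, zero_add]
    ring
  rw [e1] at h
  refine (congrArg (HasSum · _) (funext fun n => ?_)).mp h
  symm
  rw [coef, mul_assoc, mul_comm _ (w ^ n), ← smul_eq_mul (w ^ n), ← circleIntegral.integral_smul]
  congr 2
  funext z
  simp only [sub_zero, smul_eq_mul, div_eq_mul_inv, mul_pow, pow_succ, mul_inv, inv_pow]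
  ring

theorem norm_coef_le {s C : ℝ} (hs : 0 < s) {v : ℂ → ℂ}
    (hv : ∀ η ∈ sphere (0 : ℂ) s, ‖v η‖ ≤ C) (n : ℕ) : ‖coef s v n‖ ≤ C * s⁻¹ ^ n := by
  have := circleIntegral.norm_two_pi_i_inv_smul_integral_le_of_norm_le_const (c := 0) hs.le
    (f := fun η => v η / η ^ (n + 1)) (C := C / s ^ (n + 1)) (fun η hη => by
      have h1 := hv η hη
      rw [mem_sphere_zero_iff_norm] at hη
      rw [norm_div, norm_pow, hη]
      gcongr)
  rw [smul_eq_mul] at this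
  refine this.trans_eq ?_
  rw [pow_succ, inv_pow]
  field_simp

theorem circleIntegral_comp_inv {r : ℝ} (hr : 0 < r) (f : ℂ → ℂ) :
    (∮ η in C(0, r), f η) = ∮ ξ in C(0, r⁻¹), f ξ⁻¹ / ξ ^ 2 := by
  have hinv : ∀ θ : ℝ, (circleMap 0 r⁻¹ θ)⁻¹ = circleMap 0 r (-θ) := fun θ => by
    simp [circleMap, Complex.exp_neg, mul_comm]
  have h := intervalIntegral.integral_comp_sub_left (a := 0) (b := 2 * Real.pi)
    (fun θ => deriv (circleMap 0 r) θ • f (circleMap 0 r θ)) (2 * Real.pi)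
  simp only [sub_self, sub_zero] at h
  rw [circleIntegral, circleIntegral, ← h]
  refine intervalIntegral.integral_congr fun θ _ => ?_
  have hper : circleMap 0 r (2 * Real.pi - θ) = circleMap 0 r (-θ) := by
    rw [sub_eq_neg_add]; exact periodic_circleMap 0 r (-θ)
  have hne : circleMap 0 r⁻¹ θ ≠ 0 := circleMap_ne_center (inv_pos.2 hr).ne'
  simp only [deriv_circleMap, hper, smul_eq_mul, ← hinv]
  field_simp

/-- Substitute η = 1/ξ and use 1/(ξ²(1/ξ − w)) = 1/ξ − 1/(ξ − 1/w). For |w| > r this makes the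
Cauchy transform a holomorphic function of 1/w. -/
theorem cauchyT_id_eq_coef_sub {r : ℝ} (hr : 0 < r) {v : ℂ → ℂ}
    (hv : ContinuousOn v (sphere 0 r)) {w : ℂ} (hw : r ≠ ‖w‖) (hw0 : w ≠ 0) :
    cauchyT id r v w =
      coef r⁻¹ (fun ξ => v ξ⁻¹) 0 - cauchyT id r⁻¹ (fun ξ => v ξ⁻¹) w⁻¹ := by
  rw [cauchyT_id, cauchyT_id, coef, circleIntegral_comp_inv hr, ← mul_sub]
  have hr' : (0 : ℝ) ≤ r⁻¹ := (inv_pos.2 hr).le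
  have hξ0 : ∀ ξ ∈ sphere (0 : ℂ) r⁻¹, ξ ≠ 0 := fun ξ hξ =>
    ne_of_mem_sphere hξ (inv_pos.2 hr).ne'
  have hξw : ∀ ξ ∈ sphere (0 : ℂ) r⁻¹, ξ - w⁻¹ ≠ 0 := by
    intro ξ hξ h
    rw [sub_eq_zero.1 h, mem_sphere_zero_iff_norm, norm_inv, inv_inj] at hξ
    exact hw hξ.symm
  have hcv : ContinuousOn (fun ξ => v ξ⁻¹) (sphere (0 : ℂ) r⁻¹) := by
    refine hv.comp (continuousOn_id.inv₀ hξ0) fun ξ hξ => ?_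
    rw [mem_sphere_zero_iff_norm] at hξ ⊢
    simp [hξ]
  rw [← circleIntegral.integral_sub]
  · congr 1
    refine circleIntegral.integral_congr hr' fun ξ hξ => ?_
    have h0 := hξ0 ξ hξ
    have h1 := hξw ξ hξ
    have h2 : ξ⁻¹ - w ≠ 0 := by
      intro h
      rw [← sub_eq_zero.1 h, inv_inv, sub_self] at h1
      exact h1 rfl
    have h3 : 1 - ξ * w ≠ 0 := by
      intro h; apply h2; field_simp; simpa using h
    have h4 : ξ * w - 1 ≠ 0 := by
      intro h; apply h3; linear_combination -h
    simp only [zero_add, pow_one]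
    field_simp
    ring
  · exact (hcv.div (continuousOn_id.pow 1) fun ξ hξ => by simpa using hξ0 ξ hξ).circleIntegrable hr'
  · exact (hcv.div (continuousOn_id.sub continuousOn_const) hξw).circleIntegrable hr'

theorem differentiableOn_cauchyT_id {s : ℝ} (hs : 0 ≤ s) {v : ℂ → ℂ}
    (hv : ContinuousOn v (sphere 0 s)) : DifferentiableOn ℂ (cauchyT id s v) (ball 0 s) := by
  intro w hw
  refine (differentiableAt_cauchyT hs continuousOn_id ?_ hv ?_).differentiableWithinAt
  · rw [deriv_id']
    exact continuousOn_const
  · rintro ⟨x, hx, rfl⟩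
    simp at hx hw
    linarith

theorem sphere_subset_annulus {a b r : ℝ} (h₁ : a < r) (h₂ : r < b) :
    sphere (0 : ℂ) r ⊆ annulus a b := fun η hη => by
  rw [mem_sphere_zero_iff_norm] at hη
  exact ⟨hη ▸ h₁, hη ▸ h₂⟩

theorem continuousOn_comp_inv_sphere {v : ℂ → ℂ} {r : ℝ} (hr : 0 < r)
    (hv : ContinuousOn v (sphere 0 r⁻¹)) : ContinuousOn (fun ξ => v ξ⁻¹) (sphere (0 : ℂ) r) := by
  refine hv.comp (continuousOn_id.inv₀ fun ξ hξ => ne_of_mem_sphere hξ hr.ne') fun ξ hξ => ?_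
  rw [mem_sphere_zero_iff_norm] at hξ ⊢
  simp [hξ]

/-- Laurent splitting of a holomorphic function on an annulus. -/
theorem exists_laurent_splitting {a b r : ℝ} (ha : 0 ≤ a) (har : a < r) (hrb : r < b) {v : ℂ → ℂ}
    (hv : DifferentiableOn ℂ v (annulus a b)) :
    ∃ P Q : ℂ → ℂ, DifferentiableOn ℂ P (ball 0 b) ∧ DifferentiableOn ℂ Q (ball 0 r⁻¹) ∧
      ∀ w ∈ annulus r b, v w = P w + Q w⁻¹ := by
  have hr : 0 < r := ha.trans_lt har
  have hvc : ∀ t, a < t → t < b → ContinuousOn v (sphere 0 t) := fun t h₁ h₂ =>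
    hv.continuousOn.mono (sphere_subset_annulus h₁ h₂)
  -- The contour radius grows with w so that one formula covers the whole disc of radius b; by
  -- contour deformation the value does not depend on it.
  set t : ℂ → ℝ := fun w => (max ‖w‖ r + b) / 2 with ht
  have hind : ∀ t₁ t₂ : ℝ, r ≤ t₁ → t₁ < t₂ → t₂ < b → ∀ w : ℂ, ‖w‖ < t₁ →
      cauchyT id t₂ v w = cauchyT id t₁ v w := by
    intro t₁ t₂ h₁ h₂ h₃ w hw
    exact cauchyT_eq_of_notMem ha (har.trans_le h₁) h₂.le h₃ differentiableOn_id hv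
      fun w' h h' hh => by rw [id] at hh; rw [hh] at h; linarith
  have hlt : ∀ w : ℂ, ‖w‖ < b → r < t w ∧ ‖w‖ < t w ∧ t w < b := by
    intro w hw
    have h1 := le_max_left ‖w‖ r
    have h2 := le_max_right ‖w‖ r
    have h3 := max_lt hw hrb
    simp only [ht]
    refine ⟨by linarith, by linarith, by linarith⟩
  have hPt : ∀ w : ℂ, ∀ t₁, r ≤ t₁ → ‖w‖ < t₁ → t₁ < b →
      cauchyT id (t w) v w = cauchyT id t₁ v w := by
    intro w t₁ h₁ hw h₂
    obtain ⟨h3, h4, h5⟩ := hlt w (hw.trans h₂)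
    rcases lt_trichotomy t₁ (t w) with h | h | h
    · exact hind _ _ h₁ h h5 w hw
    · rw [h]
    · exact (hind _ _ h3.le h h₂ w h4).symm
  refine ⟨fun w => cauchyT id (t w) v w,
    fun ξ => cauchyT id r⁻¹ (fun ξ => v ξ⁻¹) ξ - coef r⁻¹ (fun ξ => v ξ⁻¹) 0, ?_, ?_, ?_⟩
  · intro w hw
    rw [mem_ball_zero_iff] at hw
    obtain ⟨h3, h4, h5⟩ := hlt w hw
    have hd := (differentiableOn_cauchyT_id (hr.trans h3).le (hvc _ (har.trans h3) h5)).differentiableAt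
      (isOpen_ball.mem_nhds (mem_ball_zero_iff.2 h4))
    refine (hd.congr_of_eventuallyEq ?_).differentiableWithinAt
    filter_upwards [isOpen_ball.mem_nhds (mem_ball_zero_iff.2 h4)] with w' hw'
    exact hPt w' _ h3.le (mem_ball_zero_iff.1 hw') h5
  · exact (differentiableOn_cauchyT_id (inv_pos.2 hr).le
      (continuousOn_comp_inv_sphere (inv_pos.2 hr) (by rw [inv_inv]; exact hvc r har hrb))).sub_const _
  · intro w hw
    obtain ⟨h3, h4, h5⟩ := hlt w hw.2
    have hj := cauchyT_sub_cauchyT ha har h5 differentiableOn_id (injOn_id _) hv hw.1 h4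
    rw [id] at hj
    rw [← hj, cauchyT_id_eq_coef_sub hr (hvc r har hrb) hw.1.ne (norm_pos_iff.1 (hr.trans hw.1))]
    ring

/-- A function holomorphic on the disc of radius `s` whose real part on the unit circle is that
of `v`, when `v` is holomorphic on an annulus containing `s⁻¹ ≤ ‖w‖ ≤ s`. -/
noncomputable def reflectPart (s : ℝ) (v : ℂ → ℂ) (w : ℂ) : ℂ :=
  cauchyT id s v w + (conj (cauchyT id s (fun ξ => v ξ⁻¹) (conj w)) -
    conj (coef s (fun ξ => v ξ⁻¹) 0))

/-- The power series coefficients of `reflectPart s v`. -/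
noncomputable def reflectCoef (s : ℝ) (v : ℂ → ℂ) (n : ℕ) : ℂ :=
  coef s v n + if n = 0 then 0 else conj (coef s (fun ξ => v ξ⁻¹) n)

theorem hasSum_reflectCoef {s : ℝ} (hs : 0 < s) {v : ℂ → ℂ} (hv : ContinuousOn v (sphere 0 s))
    (hv' : ContinuousOn v (sphere 0 s⁻¹)) {w : ℂ} (hw : ‖w‖ < s) :
    HasSum (fun n => reflectCoef s v n * w ^ n) (reflectPart s v w) := by
  have h1 := hasSum_coef hs.le hv hw
  have hu := continuousOn_comp_inv_sphere hs hv'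
  have h2 := hasSum_coef hs.le hu (w := conj w) (by simpa using hw)
  have h3 := (Complex.hasSum_conj'.2 h2)
  have h4 := h3.sub (hasSum_ite_eq 0 (conj (coef s (fun ξ => v ξ⁻¹) 0)))
  refine (congrArg (HasSum · _) (funext fun n => ?_)).mp (h1.add h4)
  rw [reflectCoef, map_mul, map_pow, Complex.conj_conj]
  split_ifs with hn
  · subst hn; simp
  · ring

theorem differentiableOn_reflectPart {s : ℝ} (hs : 0 < s) {v : ℂ → ℂ}
    (hv : ContinuousOn v (sphere 0 s)) (hv' : ContinuousOn v (sphere 0 s⁻¹)) :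
    DifferentiableOn ℂ (reflectPart s v) (ball 0 s) := by
  intro w hw
  have hu := continuousOn_comp_inv_sphere hs hv'
  have h1 := (differentiableOn_cauchyT_id hs.le hv).differentiableAt (isOpen_ball.mem_nhds hw)
  have h2 := (differentiableOn_cauchyT_id hs.le hu).differentiableAt
    (isOpen_ball.mem_nhds (x := conj w) (by simpa using hw))
  have h3 := h2.conj_conj
  rw [Complex.conj_conj] at h3
  exact (h1.add (h3.sub_const _)).differentiableWithinAt

/-- The Laurent splitting writes v as a power series in w plus one in w⁻¹. On the unit circle w⁻¹ =
conj w, so conjugating the second series turns it into a power series in w without changing its real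
part. -/
theorem re_reflectPart {a b s : ℝ} (ha : 0 ≤ a) (hs : 1 < s) (has : a < s⁻¹) (hsb : s < b)
    {v : ℂ → ℂ} (hv : DifferentiableOn ℂ v (annulus a b)) {w : ℂ} (hw : ‖w‖ = 1) :
    (reflectPart s v w).re = (v w).re := by
  have hs0 : 0 < s := one_pos.trans hs
  have hs1 : s⁻¹ < 1 := inv_lt_one_of_one_lt₀ hs
  have hj := cauchyT_sub_cauchyT ha has hsb differentiableOn_id (injOn_id _) hv (hw ▸ hs1) (hw ▸ hs)
  rw [id, cauchyT_id_eq_coef_sub (inv_pos.2 hs0) (hv.continuousOn.mono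
    (sphere_subset_annulus has (hs1.trans (hs.trans hsb)))) (hw ▸ hs1.ne)
    (norm_pos_iff.1 (hw ▸ one_pos)), inv_inv] at hj
  have hc : w⁻¹ = conj w := by
    rw [Complex.inv_def, normSq_eq_norm_sq, hw]; simp
  rw [← hj, reflectPart, hc]
  simp
  ring

theorem norm_reflectCoef_le {s C : ℝ} (hs : 0 < s) {v : ℂ → ℂ}
    (hv : ∀ η ∈ sphere (0 : ℂ) s, ‖v η‖ ≤ C) (hv' : ∀ η ∈ sphere (0 : ℂ) s⁻¹, ‖v η‖ ≤ C) (n : ℕ) :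
    ‖reflectCoef s v n‖ ≤ 2 * C * s⁻¹ ^ n := by
  have h1 := norm_coef_le hs hv n
  have h2 : ‖coef s (fun ξ => v ξ⁻¹) n‖ ≤ C * s⁻¹ ^ n := norm_coef_le hs (fun η hη => hv' _ (by
    rw [mem_sphere_zero_iff_norm] at hη ⊢
    simp [hη])) n
  refine (norm_add_le _ _).trans ?_
  have h3 : ‖(if n = 0 then 0 else conj (coef s (fun ξ => v ξ⁻¹) n) : ℂ)‖ ≤ C * s⁻¹ ^ n := by
    split_ifs
    · simpa using (norm_nonneg _).trans h1
    · simpa using h2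
  linarith

theorem coef_add {s : ℝ} (hs : 0 < s) {v v' : ℂ → ℂ} (hv : ContinuousOn v (sphere 0 s))
    (hv' : ContinuousOn v' (sphere 0 s)) (n : ℕ) :
    coef s (fun η => v η + v' η) n = coef s v n + coef s v' n := by
  have hne : ∀ η ∈ sphere (0 : ℂ) s, η ^ (n + 1) ≠ 0 := fun η hη =>
    pow_ne_zero _ (ne_of_mem_sphere hη hs.ne')
  simp only [coef, add_div]
  rw [circleIntegral.integral_add, mul_add]
  · exact (hv.div (continuousOn_id.pow _) hne).circleIntegrable hs.le
  · exact (hv'.div (continuousOn_id.pow _) hne).circleIntegrable hs.le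

theorem coef_smul (s : ℝ) (c : ℂ) (v : ℂ → ℂ) (n : ℕ) :
    coef s (fun η => c * v η) n = c * coef s v n := by
  simp only [coef, mul_div_assoc]
  rw [circleIntegral.integral_const_mul]
  ring

end ProperApprox

/-! ### Fredholm operators and convex cones -/

namespace ProperApprox

open Set Filter Topology
open scoped NNReal

section Fredholm

variable {X : Type*} [NormedAddCommGroup X] [NormedSpace ℝ X] [CompleteSpace X]

-- 1 + M = (1 + (M − S)) + S, where the first summand is invertible by a Neumann series and S has
-- finite rank. The inverse is therefore a quasi-inverse of 1 + M.
open LinearMap.FiniteRangeSetoid in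
theorem isClosed_range_one_add_and_cofg (M S : X →L[ℝ] X)
    (hS : FiniteDimensional ℝ (LinearMap.range (S : X →ₗ[ℝ] X))) (hMS : ‖M - S‖ < 1) :
    IsClosed (LinearMap.range ((1 + M : X →L[ℝ] X) : X →ₗ[ℝ] X) : Set X) ∧
      (LinearMap.range ((1 + M : X →L[ℝ] X) : X →ₗ[ℝ] X)).CoFG := by
  have hunit : IsUnit (1 + (M - S)) := by
    have := isUnit_one_sub_of_norm_lt_one (x := -(M - S)) (by simpa [norm_sub_rev] using hMS)
    rwa [sub_neg_eq_add] at this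
  obtain ⟨A, hA⟩ := hunit
  have hF : ContinuousLinearMap.IsFredholm (1 + M : X →L[ℝ] X) := by
    rw [ContinuousLinearMap.isFredholm_iff_exists_isQuasiInverse]
    refine ⟨(↑A⁻¹ : X →L[ℝ] X), ?_⟩
    have h1 : LinearMap.IsQuasiInverse ((↑A⁻¹ : X →L[ℝ] X) : X →ₗ[ℝ] X)
        ((↑A : X →L[ℝ] X) : X →ₗ[ℝ] X) := by
      have e1 : ((↑A⁻¹ : X →L[ℝ] X) : X →ₗ[ℝ] X) ∘ₗ ((↑A : X →L[ℝ] X) : X →ₗ[ℝ] X) = .id := by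
        ext x
        exact congrArg (fun T : X →L[ℝ] X => T x) A.inv_mul
      have e2 : ((↑A : X →L[ℝ] X) : X →ₗ[ℝ] X) ∘ₗ ((↑A⁻¹ : X →L[ℝ] X) : X →ₗ[ℝ] X) = .id := by
        ext x
        exact congrArg (fun T : X →L[ℝ] X => T x) A.mul_inv
      simp [LinearMap.IsQuasiInverse, LinearMap.IsLeftQuasiInverse,
        LinearMap.IsRightQuasiInverse, e1, e2]
    refine h1.congr (Setoid.refl _) ?_
    rw [LinearMap.FiniteRangeSetoid.equiv_iff_hasNoetherianRange]
    have e : ((1 + M : X →L[ℝ] X) : X →ₗ[ℝ] X) - ((↑A : X →L[ℝ] X) : X →ₗ[ℝ] X) =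
        (S : X →ₗ[ℝ] X) := by
      rw [hA]
      ext x
      simp
    rw [e, LinearMap.HasNoetherianRange]
    infer_instance
  exact ⟨hF.isClosed_range, hF.finite_coker⟩

end Fredholm

/-- E is the preimage of a subspace of the finite-dimensional quotient by E₀. -/
theorem isClosed_of_le_of_cofg {X : Type*} [NormedAddCommGroup X] [NormedSpace ℝ X]
    {E₀ E : Submodule ℝ X} (h : E₀ ≤ E) (hc : IsClosed (E₀ : Set X))
    (hf : E₀.CoFG) : IsClosed (E : Set X) := by
  have : IsClosed (E₀ : Set X) := hc
  have h1 : E = (E.map E₀.mkQ).comap E₀.mkQ := by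
    rw [Submodule.comap_map_mkQ, sup_eq_right.2 h]
  rw [h1]
  have : FiniteDimensional ℝ (X ⧸ E₀) := hf
  exact (Submodule.closed_of_finiteDimensional (E.map E₀.mkQ)).preimage E₀.continuous_mkQ


section Cone

variable {V : Type*} [NormedAddCommGroup V] [NormedSpace ℝ V]

/-- The closure of the convex cone spanned by a family, as a proper cone. -/
theorem mem_closure_hull_of_forall {ι : Type*} (κ : ι → V) (w : V)
    (h : ∀ l : V →L[ℝ] ℝ, (∀ i, 0 ≤ l (κ i)) → 0 ≤ l w) :
    w ∈ closure (Submodule.span ℝ≥0 (range κ) : Set V) := by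
  by_contra hw
  obtain ⟨l, hl, hlw⟩ := ProperCone.hyperplane_separation_point
    (C := (Submodule.span ℝ≥0 (range κ) : Submodule ℝ≥0 V).closure) (x₀ := w) hw
  exact absurd (h l fun i => hl _ (subset_closure (Submodule.subset_span (mem_range_self i))))
    (not_le.2 hlw)

/-- By separation the cone is dense, and since it spans, it has interior points. A convex set with
interior points has the same interior as its closure. -/
theorem hull_eq_univ_of_forall [FiniteDimensional ℝ V] {ι : Type*} (v : ι → V)
    (hv : Submodule.span ℝ (range v) = ⊤)
    (h : ∀ l : V →L[ℝ] ℝ, (∀ i, 0 ≤ l (v i)) → ∀ i, l (v i) = 0) :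
    (Submodule.span ℝ≥0 (range v) : Set V) = univ := by
  set H : Submodule ℝ≥0 V := Submodule.span ℝ≥0 (range v)
  have hconv : Convex ℝ (H : Set V) := PointedCone.convex (R := ℝ) H
  have hcl : closure (H : Set V) = univ := by
    refine eq_univ_of_forall fun y => mem_closure_hull_of_forall v y fun l hl => ?_
    have h0 := h l hl
    have : ∀ y ∈ Submodule.span ℝ (range v), l y = 0 := by
      intro y hy
      induction hy using Submodule.span_induction with
      | mem x hx => obtain ⟨i, rfl⟩ := hx; exact h0 i
      | zero => simp
      | add x y _ _ hx hy => rw [map_add, hx, hy, add_zero]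
      | smul c x _ hx => rw [map_smul, hx, smul_zero]
    exact (this y (hv ▸ Submodule.mem_top)).ge
  have hint : (interior (H : Set V)).Nonempty := by
    rw [hconv.interior_nonempty_iff_affineSpan_eq_top,
      AffineSubspace.affineSpan_eq_top_iff_vectorSpan_eq_top_of_nonempty _ _ _ ⟨(0 : V), H.zero_mem⟩,
      eq_top_iff, ← hv, Submodule.span_le]
    rintro _ ⟨i, rfl⟩
    have := vsub_mem_vectorSpan ℝ (s := (H : Set V))
      (Submodule.subset_span (mem_range_self i)) H.zero_mem
    simpa using this
  have := hconv.interior_closure_eq_interior_of_nonempty_interior hint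
  rw [hcl, interior_univ] at this
  exact eq_univ_of_univ_subset (this.trans_subset interior_subset)

/-- The previous statement inside the span, whose functionals extend to V by Hahn–Banach. -/
theorem span_subset_hull_of_forall {ι : Type*} [FiniteDimensional ℝ V] (v : ι → V)
    (h : ∀ l : V →L[ℝ] ℝ, (∀ i, 0 ≤ l (v i)) → ∀ i, l (v i) = 0) :
    (Submodule.span ℝ (range v) : Set V) ⊆ Submodule.span ℝ≥0 (range v) := by
  set W := Submodule.span ℝ (range v)
  set v' : ι → W := fun i => ⟨v i, Submodule.subset_span (mem_range_self i)⟩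
  have hspan : Submodule.span ℝ (range v') = ⊤ := by
    have := Submodule.span_span_coe_preimage (R := ℝ) (s := range v)
    convert this using 2
    ext ⟨x, hx⟩
    simp [v', Subtype.ext_iff]
  have := hull_eq_univ_of_forall v' hspan fun l hl i => by
    obtain ⟨g, hg, -⟩ := exists_extension_norm_eq W l
    rw [← hg]
    refine h g (fun j => ?_) i
    have := hg (v' j)
    exact this ▸ hl j
  intro y hy
  have hy' : (⟨y, hy⟩ : W) ∈ Submodule.span ℝ≥0 (range v') := by
    rw [← SetLike.mem_coe, this]; trivial
  have h3 := Submodule.mem_map_of_mem (f := (W.subtype.restrictScalars ℝ≥0)) hy'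
  rw [Submodule.map_span, ← range_comp] at h3
  exact h3

end Cone

/-- Exact solvability of finitely many linear constraints by positive combinations. -/
theorem exists_hull_mem_ker {X Q : Type*} [NormedAddCommGroup X] [NormedSpace ℝ X]
    [NormedAddCommGroup Q] [NormedSpace ℝ Q] [FiniteDimensional ℝ Q] {ι : Type*} (κ : ι → X)
    (Ψ : X →L[ℝ] Q) (w : X) (hw : Ψ w = 0)
    (h : ∀ l : X →L[ℝ] ℝ, (∀ i, 0 ≤ l (κ i)) → 0 ≤ l w ∧ (l w = 0 → ∀ i, l (κ i) = 0))
    {ε : ℝ} (hε : 0 < ε) :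
    ∃ w' ∈ Submodule.span ℝ≥0 (range κ), Ψ w' = 0 ∧ ‖w' - w‖ < ε := by
  set v : ι → Q := fun i => Ψ (κ i)
  -- For a functional l on Q, l ∘ Ψ vanishes at w. If it is non-negative on the family, the
  -- hypothesis makes it vanish on the family, so the cone of the v i is its own linear span.
  have hsub := span_subset_hull_of_forall v fun l hl i =>
    (h (l.comp Ψ) hl).2 (by simp [hw]) i
  have hlift : ∀ y ∈ Submodule.span ℝ (range v), ∃ x ∈ Submodule.span ℝ≥0 (range κ), Ψ x = y := by
    intro y hy
    have h1 := hsub hy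
    have h2 : range v = (Ψ.toLinearMap.restrictScalars ℝ≥0) '' range κ := by
      rw [← range_comp]; rfl
    rw [h2, ← Submodule.map_span] at h1
    exact h1
  set W := Submodule.span ℝ (range v)
  set b := Module.finBasis ℝ W
  choose p hp hpΨ using fun i => hlift (b i) (b i).2
  choose n hn hnΨ using fun i => hlift (-(b i : Q)) (W.neg_mem (b i).2)
  -- A continuous right inverse of Ψ over W with values in the cone, obtained by lifting positive
  -- and negative parts of coordinates separately. As g 0 = 0, small errors have small corrections.
  set g : W → X := fun e => ∑ i, ((max (b.repr e i) 0) • p i + (max (-(b.repr e i)) 0) • n i)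
  have hgΨ : ∀ e, Ψ (g e) = e := by
    intro e
    have h1 : (e : Q) = ∑ i, (b.repr e i) • (b i : Q) := by
      have := congrArg (Subtype.val) (b.sum_repr e)
      rw [← this, AddSubmonoidClass.coe_finsetSum]
      rfl
    rw [h1, map_sum]
    refine Finset.sum_congr rfl fun i _ => ?_
    rw [map_add, map_smul, map_smul, hpΨ, hnΨ, smul_neg, ← sub_eq_add_neg, ← sub_smul]
    congr 1
    rcases le_total (b.repr e i) 0 with h | h
    · rw [max_eq_right h, max_eq_left (by linarith)]; ring
    · rw [max_eq_left h, max_eq_right (by linarith)]; ring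
  have hgmem : ∀ e, g e ∈ Submodule.span ℝ≥0 (range κ) := by
    intro e
    refine Submodule.sum_mem _ fun i _ => Submodule.add_mem _ ?_ ?_
    · exact Submodule.smul_mem _ (⟨_, le_max_right _ _⟩ : ℝ≥0) (hp i)
    · exact Submodule.smul_mem _ (⟨_, le_max_right _ _⟩ : ℝ≥0) (hn i)
  have hgc : Continuous g := by
    refine continuous_finsetSum _ fun i _ => ?_
    have : Continuous fun e : W => b.repr e i :=
      (b.coord i).continuous_of_finiteDimensional
    exact ((this.max continuous_const).smul continuous_const).add
      ((this.neg.max continuous_const).smul continuous_const)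
  have hg0 : g 0 = 0 := by simp [g]
  obtain ⟨δ, hδ, hδg⟩ := Metric.continuous_iff.1 hgc 0 (ε / 2) (by positivity)
  have hcl := mem_closure_hull_of_forall κ w fun l hl => (h l hl).1
  have hev : ∀ᶠ x in 𝓝 w, ‖Ψ x‖ < δ ∧ ‖x - w‖ < ε / 2 := by
    refine ((Ψ.continuous.norm.continuousAt (x := w)).eventually_lt continuousAt_const
      (by simpa [hw] using hδ)).and ?_
    filter_upwards [Metric.ball_mem_nhds w (show 0 < ε / 2 by positivity)] with x hx
    rwa [← dist_eq_norm]
  obtain ⟨x, ⟨hx1, hx2⟩, hx3⟩ := mem_closure_iff_nhds.1 hcl _ hev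
  have hΨx : Ψ x ∈ W := by
    have : ∀ x ∈ Submodule.span ℝ≥0 (range κ), Ψ x ∈ W := by
      intro x hx
      induction hx using Submodule.span_induction with
      | mem x hx => obtain ⟨i, rfl⟩ := hx; exact Submodule.subset_span (mem_range_self i)
      | zero => simp
      | add x y _ _ hx hy => rw [map_add]; exact W.add_mem hx hy
      | smul c x _ hx =>
        have : Ψ (c • x) = (c : ℝ) • Ψ x := map_smul Ψ (c : ℝ) x
        rw [this]; exact W.smul_mem _ hx
    exact this x hx3
  -- x lies in the cone close to w, so Ψ x is small; adding a lift of −Ψ x makes the constraint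
  -- exact.
  refine ⟨x + g (-⟨Ψ x, hΨx⟩), Submodule.add_mem _ hx3 (hgmem _), ?_, ?_⟩
  · rw [map_add, hgΨ]
    simp
  · have h1 := hδg (-⟨Ψ x, hΨx⟩) (by simpa [dist_eq_norm] using hx1)
    rw [hg0, dist_zero_right] at h1
    calc ‖x + g (-⟨Ψ x, hΨx⟩) - w‖ = ‖(x - w) + g (-⟨Ψ x, hΨx⟩)‖ := by congr 1; abel
      _ ≤ ‖x - w‖ + ‖g (-⟨Ψ x, hΨx⟩)‖ := norm_add_le _ _
      _ < ε := by linarith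

/-- Positive combinations `w'` of a family, close to `w`, for which the compact perturbation
problem `y + M (y + w' - w - t • w) = 0` has a small solution. -/
theorem exists_hull_solution {X : Type*} [NormedAddCommGroup X] [NormedSpace ℝ X]
    [CompleteSpace X] {ι : Type*} (κ : ι → X) (M : X →L[ℝ] X)
    (hMc : IsClosed (LinearMap.range ((1 + M : X →L[ℝ] X) : X →ₗ[ℝ] X) : Set X))
    (hMf : (LinearMap.range ((1 + M : X →L[ℝ] X) : X →ₗ[ℝ] X)).CoFG) (w : X)
    (h : ∀ l : X →L[ℝ] ℝ, (∀ i, 0 ≤ l (κ i)) → 0 ≤ l w ∧ (l w = 0 → ∀ i, l (κ i) = 0))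
    {ε : ℝ} (hε : 0 < ε) :
    ∃ w' ∈ Submodule.span ℝ≥0 (range κ), ∃ (y : X) (t : ℝ),
      y + M (y + w' - w - t • w) = 0 ∧ ‖w' - w‖ < ε ∧ ‖y‖ < ε ∧ |t| < ε := by
  -- The equation to be solved is T (y, t) = −M (w' − w). The unknown t puts M w into the range of
  -- T, so that w itself satisfies the constraints Ψ imposed below.
  set T : X × ℝ →L[ℝ] X := (1 + M).comp (ContinuousLinearMap.fst ℝ X ℝ) -
    (ContinuousLinearMap.snd ℝ X ℝ).smulRight (M w) with hT
  have hTapp : ∀ y t, T (y, t) = y + M y - t • M w := fun y t => by simp [hT]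
  set E : Submodule ℝ X := LinearMap.range (T : X × ℝ →ₗ[ℝ] X) with hE
  have hle : LinearMap.range ((1 + M : X →L[ℝ] X) : X →ₗ[ℝ] X) ≤ E := by
    rintro _ ⟨y, rfl⟩
    exact ⟨(y, 0), by simp [hTapp]⟩
  have hEc : IsClosed (E : Set X) := isClosed_of_le_of_cofg hle hMc hMf
  have hEf : E.CoFG := Submodule.CoFG.of_le hle hMf
  have : CompleteSpace E := hEc.completeSpace_coe
  have : FiniteDimensional ℝ (X ⧸ E) := hEf
  set T' : X × ℝ →L[ℝ] E := T.codRestrict E fun x => ⟨x, rfl⟩ with hT'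
  -- The open mapping theorem bounds (y, t) by C times the right-hand side, so closeness of w' to w
  -- makes both small.
  obtain ⟨C, hC, hpre⟩ := T'.exists_preimage_norm_le (by
    rintro ⟨_, x, rfl⟩
    exact ⟨x, rfl⟩)
  set Ψ : X →L[ℝ] X ⧸ E := E.mkQL.comp M
  have hwE : M w ∈ E := ⟨(0, -1), by simp [hTapp]⟩
  set η := min ε (ε / (C * (‖M‖ + 1))) with hη
  have hpos : 0 < C * (‖M‖ + 1) := by positivity
  obtain ⟨w', hw', hΨ, hn⟩ := exists_hull_mem_ker κ Ψ w
    ((Submodule.Quotient.mk_eq_zero E).2 hwE) h (ε := η) (by positivity)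
  have hw'E : M w' ∈ E := (Submodule.Quotient.mk_eq_zero E).1 hΨ
  have hmem : -M (w' - w) ∈ E := by
    rw [map_sub]; exact E.neg_mem (E.sub_mem hw'E hwE)
  obtain ⟨⟨y, t⟩, hyt, hnorm⟩ := hpre ⟨-M (w' - w), hmem⟩
  have hyt' : y + M y - t • M w = -M (w' - w) := by
    rw [← hTapp]; exact congrArg Subtype.val hyt
  have hsmall : ‖(y, t)‖ < ε := by
    refine hnorm.trans_lt ?_
    have h1 : ‖(⟨-M (w' - w), hmem⟩ : E)‖ ≤ ‖M‖ * ‖w' - w‖ := by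
      rw [Submodule.coe_norm, norm_neg]
      exact M.le_opNorm (w' - w)
    have h2 : ‖w' - w‖ < ε / (C * (‖M‖ + 1)) := hn.trans_le (min_le_right _ _)
    rw [lt_div_iff₀ hpos] at h2
    calc C * ‖(⟨-M (w' - w), hmem⟩ : E)‖ ≤ C * (‖M‖ * ‖w' - w‖) := by gcongr
      _ ≤ ‖w' - w‖ * (C * (‖M‖ + 1)) := by nlinarith [norm_nonneg (w' - w), norm_nonneg M]
      _ < ε := h2
  refine ⟨w', hw', y, t, ?_, hn.trans_le (min_le_left _ _), (norm_fst_le (y, t)).trans_lt hsmall,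
    (norm_snd_le (y, t)).trans_lt hsmall⟩
  have e : y + w' - w - t • w = y + (w' - w) - t • w := by abel
  rw [e, map_sub, map_add, map_smul, ← add_sub_assoc, ← add_assoc, add_sub_right_comm, hyt',
    neg_add_cancel]

end ProperApprox

/-! ### Boundary point lemma and the Blaschke products on the circle -/

namespace ProperApprox

open Complex Metric Set Filter Topology
open scoped ComplexConjugate

theorem sq_norm_one_sub_conj_mul (a u : ℂ) :
    ‖1 - conj a * u‖ ^ 2 - ‖u - a‖ ^ 2 = (1 - ‖a‖ ^ 2) * (1 - ‖u‖ ^ 2) := by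
  simp only [← normSq_eq_norm_sq, normSq_apply, sub_re, sub_im, mul_re, mul_im, one_re, one_im,
    conj_re, conj_im]
  ring

/-- Boundary point lemma: a holomorphic self-map of the disc has non-zero derivative at any
boundary point that it maps to the boundary. -/
theorem not_hasDerivAt_zero_of_mapsTo_ball {h : ℂ → ℂ} (hd : DifferentiableOn ℂ h (ball 0 1))
    (hm : MapsTo h (ball 0 1) (ball 0 1)) (h1 : ‖h 1‖ = 1) : ¬ HasDerivAt h 0 1 := by
  intro hder
  set a := h 0
  have ha : ‖a‖ < 1 := mem_ball_zero_iff.1 (hm (mem_ball_self one_pos))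
  have hlow : ∀ u : ℂ, ‖u‖ ≤ 1 → 1 - ‖a‖ ≤ ‖1 - conj a * u‖ := by
    intro u hu
    have h2 := norm_sub_norm_le (1 : ℂ) (conj a * u)
    rw [norm_one, norm_mul, norm_conj] at h2
    nlinarith [norm_nonneg a]
  have hne : ∀ u : ℂ, ‖u‖ ≤ 1 → 1 - conj a * u ≠ 0 := fun u hu =>
    norm_pos_iff.1 ((sub_pos.2 ha).trans_le (hlow u hu))
  have hhm : ∀ x ∈ ball (0 : ℂ) 1, ‖h x‖ < 1 := fun x hx => mem_ball_zero_iff.1 (hm hx)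
  -- Schwarz lemma for h followed by the disc automorphism that sends a = h 0 to 0.
  have hschwarz : ∀ x : ℂ, ‖x‖ < 1 → ‖(h x - a) / (1 - conj a * h x)‖ ≤ ‖x‖ := by
    intro x hx
    refine norm_le_norm_of_mapsTo_ball (f := fun x => (h x - a) / (1 - conj a * h x)) (R := 1)
      ((hd.sub_const a).div ((hd.const_mul _).const_sub 1) fun x hx => hne _ (hhm x hx).le)
      (fun x hx => ?_) (by simp [a]) hx
    rw [mem_closedBall_zero_iff, norm_div]
    refine div_le_one_of_le₀ ?_ (norm_nonneg _)
    have h2 := sq_norm_one_sub_conj_mul a (h x)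
    have h3 := hhm x hx
    have h4 : 0 ≤ (1 - ‖a‖ ^ 2) * (1 - ‖h x‖ ^ 2) :=
      mul_nonneg (by nlinarith [norm_nonneg a]) (by nlinarith [norm_nonneg (h x)])
    exact le_of_sq_le_sq (by linarith) (norm_nonneg _)
  -- Along the radius towards 1 the distance of h x from h 1 is at least a fixed multiple of 1 − x.
  -- A zero derivative would make it o(1 − x).
  have hmain : ∀ x : ℝ, 0 ≤ x → x < 1 → (1 - ‖a‖) ^ 2 * (1 - x) ≤ 2 * ‖h x - h 1‖ := by
    intro x hx0 hx1
    have hxb : ‖(x : ℂ)‖ < 1 := by simpa [abs_of_nonneg hx0] using hx1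
    have hu := hhm x (mem_ball_zero_iff.2 hxb)
    have h2 := hschwarz x hxb
    rw [norm_div, div_le_iff₀ (norm_pos_iff.2 (hne _ hu.le)), norm_real, Real.norm_eq_abs,
      abs_of_nonneg hx0] at h2
    have h3 := sq_norm_one_sub_conj_mul a (h x)
    have h4 := hlow _ hu.le
    have h5 : ‖h x - a‖ ^ 2 ≤ x ^ 2 * ‖1 - conj a * h x‖ ^ 2 := by
      rw [← mul_pow]; gcongr
    have h6 : (1 - ‖a‖) ^ 2 ≤ ‖1 - conj a * h x‖ ^ 2 := by
      have := sub_pos.2 ha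
      gcongr
    have h7 : (1 - x ^ 2) * (1 - ‖a‖) ^ 2 ≤ (1 - x ^ 2) * ‖1 - conj a * h x‖ ^ 2 :=
      mul_le_mul_of_nonneg_left h6 (by nlinarith)
    have h8 : (1 - ‖a‖ ^ 2) * (1 - ‖h x‖ ^ 2) ≤ 1 - ‖h x‖ ^ 2 :=
      mul_le_of_le_one_left (by nlinarith [norm_nonneg (h x)]) (by nlinarith [norm_nonneg a])
    have h9 : 1 - ‖h x‖ ≤ ‖h x - h 1‖ := by
      have := norm_sub_norm_le (h 1) (h x)
      rwa [h1, norm_sub_rev] at this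
    have h10 : (1 - x) * (1 - ‖a‖) ^ 2 ≤ (1 - x ^ 2) * (1 - ‖a‖) ^ 2 :=
      mul_le_mul_of_nonneg_right (by nlinarith) (by positivity)
    nlinarith [norm_nonneg (h x)]
  have hA : 0 < (1 - ‖a‖) ^ 2 / 4 := by have := sub_pos.2 ha; positivity
  have hlit := (hasDerivAt_iff_isLittleO.1 hder).def hA
  have htend : Tendsto (fun x : ℝ => (x : ℂ)) (𝓝[<] 1) (𝓝 1) :=
    (continuous_ofReal.tendsto' 1 1 ofReal_one).mono_left nhdsWithin_le_nhds
  have hev : ∀ᶠ x : ℝ in 𝓝[<] 1, 0 ≤ x :=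
    (eventually_ge_nhds one_pos).filter_mono nhdsWithin_le_nhds
  obtain ⟨x, ⟨hx1, hx2⟩, hx3⟩ := ((htend.eventually hlit).and hev |>.and self_mem_nhdsWithin).exists
  have h2 := hmain x hx2 hx3
  have h3 : ‖((x : ℂ) - 1)‖ = 1 - x := by
    rw [← ofReal_one, ← ofReal_sub, norm_real, Real.norm_eq_abs, abs_sub_comm,
      abs_of_pos (sub_pos.2 hx3)]
  simp only [smul_zero, sub_zero] at hx1
  rw [h3] at hx1
  have : 0 < (1 - ‖a‖) ^ 2 / 4 * (1 - x) := mul_pos hA (sub_pos.2 hx3)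
  linarith

/-- Closed form of `blaschke`, with `s = r ^ n`. -/
noncomputable def blaschkeForm (n : ℕ) (s : ℝ) (z : ℂ) : ℂ :=
  z * ((s - (-z) ^ n) / (1 - s * (-z) ^ n))

/-- Factorisation of x^n − y^n over the n-th roots of unity, at y = −z. -/
theorem prod_range_add_exp_mul {n : ℕ} (hn : 1 ≤ n) (x z : ℂ) :
    ∏ j ∈ Finset.range n, (x + Complex.exp (2 * Real.pi * I * j / n) * z) = x ^ n - (-z) ^ n := by
  have hn0 : n ≠ 0 := by lia
  have hω := Complex.isPrimitiveRoot_exp n hn0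
  set ω := Complex.exp (2 * Real.pi * I / n)
  rw [hω.pow_sub_pow_eq_prod_sub_mul x (-z) (by lia)]
  have hp : ∀ j : ℕ, Complex.exp (2 * Real.pi * I * j / n) = ω ^ j := fun j => by
    rw [← Complex.exp_nat_mul]; congr 1; ring
  refine Finset.prod_nbij (fun j => ω ^ j) (fun j _ => ?_) (fun i hi j hj h => ?_) (fun y hy => ?_)
    (fun j _ => ?_)
  · rw [Polynomial.mem_nthRootsFinset (by lia), ← pow_mul, mul_comm, pow_mul, hω.pow_eq_one, one_pow]
  · exact hω.pow_inj (Finset.mem_range.1 hi) (Finset.mem_range.1 hj) h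
  · rw [Finset.mem_coe, Polynomial.mem_nthRootsFinset (by lia)] at hy
    have : NeZero n := ⟨hn0⟩
    obtain ⟨i, hi, rfl⟩ := hω.eq_pow_of_pow_eq_one hy
    exact ⟨i, by simpa using hi, rfl⟩
  · rw [hp]; ring

theorem blaschke_eq_blaschkeForm {n : ℕ} (hn : 1 ≤ n) (δ c : ℝ) :
    blaschke n δ c = blaschkeForm n ((1 - δ * (1 - c) / n) ^ n) := by
  funext z
  simp only [blaschke, blaschkeForm]
  set r : ℝ := 1 - δ * (1 - c) / n
  rw [Finset.prod_div_distrib]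
  have h1 := prod_range_add_exp_mul hn (r : ℂ) z
  have h2 := prod_range_add_exp_mul hn 1 (r * z)
  rw [← ofReal_pow] at *
  congr 2
  · rw [← h1]
    exact Finset.prod_congr rfl fun j _ => add_comm _ _
  · rw [ofReal_pow, ← mul_pow, mul_neg, ← one_pow n, ← h2]
    exact Finset.prod_congr rfl fun j _ => by ring

theorem one_sub_le_norm_one_sub_mul {s : ℝ} (hs0 : 0 < s) {y : ℂ} (hy : ‖y‖ ≤ 1) :
    1 - s ≤ ‖1 - s * y‖ := by
  have h := norm_sub_norm_le (1 : ℂ) (s * y)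
  rw [norm_one, norm_mul, norm_real, Real.norm_eq_abs, abs_of_pos hs0] at h
  nlinarith

theorem one_sub_mul_ne_zero {s : ℝ} (hs0 : 0 < s) (hs1 : s < 1) {y : ℂ} (hy : ‖y‖ ≤ 1) :
    1 - s * y ≠ 0 :=
  norm_pos_iff.1 ((sub_pos.2 hs1).trans_le (one_sub_le_norm_one_sub_mul hs0 hy))

theorem norm_neg_pow_le_one (n : ℕ) {z : ℂ} (hz : ‖z‖ ≤ 1) : ‖(-z) ^ n‖ ≤ 1 := by
  rw [norm_pow, norm_neg]; exact pow_le_one₀ (norm_nonneg _) hz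

theorem hasDerivAt_blaschkeForm {n : ℕ} (hn : 1 ≤ n) {s : ℝ} (hs0 : 0 < s) (hs1 : s < 1) {z : ℂ}
    (hz : ‖z‖ ≤ 1) :
    HasDerivAt (blaschkeForm n s) ((s - (-z) ^ n) / (1 - s * (-z) ^ n) -
      n * (-z) ^ n * (1 - s ^ 2) / (1 - s * (-z) ^ n) ^ 2) z := by
  have hne := one_sub_mul_ne_zero hs0 hs1 (norm_neg_pow_le_one n hz)
  have hy : HasDerivAt (fun z : ℂ => (-z) ^ n) (n * (-z) ^ (n - 1) * -1) z :=
    (hasDerivAt_neg z).pow n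
  have h := (hasDerivAt_id z).mul ((hy.const_sub (s : ℂ)).div ((hy.const_mul (s : ℂ)).const_sub 1) hne)
  refine h.congr_deriv ?_
  have e : (-z) ^ n = (-z) ^ (n - 1) * (-z) := by rw [← pow_succ]; congr 1; lia
  simp only [id, Pi.div_apply]
  set p := (-z) ^ (n - 1)
  rw [e] at hne ⊢
  field_simp
  ring

theorem analyticAt_blaschkeForm (n : ℕ) {s : ℝ} (hs0 : 0 < s) (hs1 : s < 1) {z : ℂ}
    (hz : ‖z‖ ≤ 1) : AnalyticAt ℂ (blaschkeForm n s) z := by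
  have hne := one_sub_mul_ne_zero hs0 hs1 (norm_neg_pow_le_one n hz)
  unfold blaschkeForm
  fun_prop (disch := exact hne)

theorem sq_norm_one_sub_ofReal_mul (s : ℝ) (y : ℂ) :
    ‖1 - s * y‖ ^ 2 - ‖s - y‖ ^ 2 = (1 - s ^ 2) * (1 - ‖y‖ ^ 2) := by
  have := sq_norm_one_sub_conj_mul s y
  rwa [conj_ofReal, norm_sub_rev y, norm_real, Real.norm_eq_abs, sq_abs] at this

theorem norm_blaschkeForm_lt_one (n : ℕ) {s : ℝ} (hs0 : 0 < s) (hs1 : s < 1) {z : ℂ}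
    (hz : ‖z‖ < 1) : ‖blaschkeForm n s z‖ < 1 := by
  have hy := norm_neg_pow_le_one n hz.le
  have h := sq_norm_one_sub_ofReal_mul s ((-z) ^ n)
  have h4 : 0 ≤ (1 - s ^ 2) * (1 - ‖(-z) ^ n‖ ^ 2) :=
    mul_nonneg (by nlinarith) (by nlinarith [norm_nonneg ((-z) ^ n)])
  rw [blaschkeForm, norm_mul, norm_div]
  refine (mul_le_of_le_one_right (norm_nonneg z) (div_le_one_of_le₀ ?_ (norm_nonneg _))).trans_lt hz
  exact le_of_sq_le_sq (by linarith) (norm_nonneg _)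

theorem norm_ofReal_sub_eq {s : ℝ} {y : ℂ} (hy : ‖y‖ = 1) : ‖s - y‖ = ‖1 - s * y‖ := by
  have h := sq_norm_one_sub_ofReal_mul s y
  rw [hy] at h
  rw [← sq_eq_sq₀ (norm_nonneg _) (norm_nonneg _)]
  linarith

theorem norm_blaschkeForm_eq_one (n : ℕ) {s : ℝ} (hs0 : 0 < s) (hs1 : s < 1) {z : ℂ}
    (hz : ‖z‖ = 1) : ‖blaschkeForm n s z‖ = 1 := by
  have hne := one_sub_mul_ne_zero hs0 hs1 (norm_neg_pow_le_one n hz.le)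
  rw [blaschkeForm, norm_mul, norm_div, norm_ofReal_sub_eq (by simp [hz]), hz, one_mul,
    div_self (norm_ne_zero_iff.2 hne)]

/-- The difference is z(1 + (−z)^n)(s − 1)/(1 − s(−z)^n). Since n ≥ 1 gives |(−z)^n| ≤ |z|, the
denominator is bounded below independently of n. -/
theorem norm_blaschkeForm_sub_le {n : ℕ} (hn : 1 ≤ n) {s : ℝ} (hs0 : 0 < s) (hs1 : s < 1) {z : ℂ}
    (hz : ‖z‖ < 1) : ‖blaschkeForm n s z - z‖ ≤ 2 * (1 - s) / (1 - ‖z‖) := by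
  have hy := norm_neg_pow_le_one n hz.le
  have hne := one_sub_mul_ne_zero hs0 hs1 hy
  have hyz : ‖(-z) ^ n‖ ≤ ‖z‖ := by
    rw [norm_pow, norm_neg]; exact pow_le_of_le_one (norm_nonneg _) hz.le (by lia)
  have e : blaschkeForm n s z - z = z * ((1 + (-z) ^ n) * (s - 1)) / (1 - s * (-z) ^ n) := by
    rw [blaschkeForm]; field_simp; ring
  have h1 : 1 - ‖z‖ ≤ ‖1 - s * (-z) ^ n‖ := by
    have h := norm_sub_norm_le (1 : ℂ) (s * (-z) ^ n)
    rw [norm_one, norm_mul, norm_real, Real.norm_eq_abs, abs_of_pos hs0] at h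
    nlinarith [norm_nonneg ((-z) ^ n)]
  have h2 : ‖(1 : ℂ) + (-z) ^ n‖ ≤ 2 := by
    refine (norm_add_le _ _).trans ?_
    rw [norm_one]; linarith
  have h3 : ‖(s : ℂ) - 1‖ = 1 - s := by
    rw [← ofReal_one, ← ofReal_sub, norm_real, Real.norm_eq_abs, abs_sub_comm, abs_of_pos (by linarith)]
  rw [e, norm_div, norm_mul, norm_mul, h3]
  have h4 := sub_pos.2 hs1
  have h5 := sub_pos.2 hz
  calc ‖z‖ * (‖1 + (-z) ^ n‖ * (1 - s)) / ‖1 - s * (-z) ^ n‖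
      ≤ 1 * (2 * (1 - s)) / (1 - ‖z‖) := by gcongr
    _ = _ := by rw [one_mul]

/-- With y = (−z)^n on the unit circle, s − y = −y(1 − s·conj y). Hence the unimodular factor (s −
y)/(1 − sy) splits off from the derivative and leaves a positive real number, 1 plus n times a
Poisson kernel. -/
theorem norm_deriv_blaschkeForm {n : ℕ} (hn : 1 ≤ n) {s : ℝ} (hs0 : 0 < s) (hs1 : s < 1) {z : ℂ}
    (hz : ‖z‖ = 1) :
    ‖deriv (blaschkeForm n s) z‖ = 1 + n * ((1 - s ^ 2) / ‖1 - s * (-z) ^ n‖ ^ 2) := by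
  rw [(hasDerivAt_blaschkeForm hn hs0 hs1 hz.le).deriv]
  set y := (-z) ^ n with hy
  have hy1 : ‖y‖ = 1 := by simp [hy, hz]
  have hne : 1 - s * y ≠ 0 := one_sub_mul_ne_zero hs0 hs1 hy1.le
  have hyy : y * conj y = 1 := by rw [mul_conj, normSq_eq_norm_sq, hy1]; simp
  have hsy : (s : ℂ) - y ≠ 0 := by
    rw [← norm_pos_iff, norm_ofReal_sub_eq hy1]; exact norm_pos_iff.2 hne
  have hconj : (1 - s * y) * (1 - s * conj y) = ((‖1 - s * y‖ ^ 2 : ℝ) : ℂ) := by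
    rw [← normSq_eq_norm_sq, ← mul_conj]; simp
  have hne2 : 1 - s * conj y ≠ 0 := by
    intro h0
    have : (1 - s * y) * (1 - s * conj y) = 0 := by rw [h0, mul_zero]
    rw [hconj] at this
    have h3 := norm_pos_iff.2 hne
    norm_cast at this
    nlinarith
  have e : (s - y) / (1 - s * y) - n * y * (1 - s ^ 2) / (1 - s * y) ^ 2 =
      (s - y) / (1 - s * y) * ((1 + n * ((1 - s ^ 2) / ‖1 - s * y‖ ^ 2) : ℝ) : ℂ) := by
    push_cast
    rw [show ((‖1 - s * y‖ : ℝ) : ℂ) ^ 2 = (1 - s * y) * (1 - s * conj y) by rw [hconj]; simp]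
    have e2 : (s - y) = - y * (1 - s * conj y) := by
      linear_combination -(s : ℂ) * hyy
    generalize 1 - s * conj y = C at *
    generalize 1 - s * y = A at *
    rw [e2]
    field_simp
    ring
  rw [e, norm_mul, norm_div, norm_ofReal_sub_eq hy1, div_self (norm_ne_zero_iff.2 hne), one_mul,
    norm_real, Real.norm_eq_abs, abs_of_nonneg]
  have : 0 ≤ 1 - s ^ 2 := by nlinarith
  positivity

/-- From 1 − s ≤ |1 − s(−z)^n| ≤ 1 + s. The constants involve only σ, so they serve for a family of
s bounded away from 1. -/
theorem norm_deriv_blaschkeForm_bounds {n : ℕ} (hn : 1 ≤ n) {s σ : ℝ} (hs0 : 0 < s) (hsσ : s ≤ σ)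
    (hσ : σ < 1) {z : ℂ} (hz : ‖z‖ = 1) :
    n * ((1 - σ) / 2) ≤ ‖deriv (blaschkeForm n s) z‖ ∧
      ‖deriv (blaschkeForm n s) z‖ ≤ n * (1 + 2 / (1 - σ)) := by
  have hs1 := hsσ.trans_lt hσ
  rw [norm_deriv_blaschkeForm hn hs0 hs1 hz]
  have hn' : (1 : ℝ) ≤ n := by exact_mod_cast hn
  have hy := norm_neg_pow_le_one n hz.le
  have h1 : 1 - s ≤ ‖1 - s * (-z) ^ n‖ := one_sub_le_norm_one_sub_mul hs0 hy
  have h2 : ‖1 - s * (-z) ^ n‖ ≤ 1 + s := by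
    refine (norm_sub_le _ _).trans ?_
    rw [norm_one, norm_mul, norm_real, Real.norm_eq_abs, abs_of_pos hs0]
    nlinarith
  set N := ‖1 - s * (-z) ^ n‖
  have hN : 0 < N := (sub_pos.2 hs1).trans_le h1
  have h3 : (1 - σ) / 2 ≤ (1 - s ^ 2) / N ^ 2 := by
    rw [div_le_div_iff₀ two_pos (by positivity)]
    have : N ^ 2 ≤ (1 + s) ^ 2 := by gcongr
    have h5 : (1 - σ) * N ^ 2 ≤ (1 - s) * (1 + s) ^ 2 :=
      mul_le_mul (by linarith) this (sq_nonneg _) (by linarith)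
    have h6 : (1 - s) * (1 + s) * (1 + s) ≤ (1 - s) * (1 + s) * 2 :=
      mul_le_mul_of_nonneg_left (by linarith) (mul_nonneg (by linarith) (by linarith))
    linarith
  have h4 : (1 - s ^ 2) / N ^ 2 ≤ 2 / (1 - σ) := by
    rw [div_le_div_iff₀ (by positivity) (sub_pos.2 hσ)]
    have : (1 - s) ^ 2 ≤ N ^ 2 := by have := sub_pos.2 hs1; gcongr
    have h5 : (1 - s ^ 2) * (1 - σ) ≤ (1 - s ^ 2) * (1 - s) :=
      mul_le_mul_of_nonneg_left (by linarith) (by nlinarith)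
    nlinarith
  constructor
  · have := mul_le_mul_of_nonneg_left h3 (by linarith : (0 : ℝ) ≤ n)
    linarith
  · have := mul_le_mul_of_nonneg_left h4 (by linarith : (0 : ℝ) ≤ n)
    linarith

end ProperApprox

/-! ### From one proper map to the whole sequence -/

namespace ProperApprox

open Complex Metric Set Filter Topology

/-- Points of the frontier have unimodular values, so the preimage of L can be taken in the compact
closure of D, where it is closed. -/
theorem isProperToDisc_of_norm_frontier_eq_one {D : Set ℂ} (hDo : IsOpen D)
    (hDb : Bornology.IsBounded D) {g : ℂ → ℂ} (hg : ContinuousOn g (closure D))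
    (hgD : ∀ z ∈ D, ‖g z‖ < 1) (hg1 : ∀ z ∈ frontier D, ‖g z‖ = 1) : IsProperToDisc D g where
  continuousOn := hg.mono subset_closure
  mapsTo := fun z hz => mem_ball_zero_iff.2 (hgD z hz)
  isCompact_preimage := by
    intro L hL hLc
    have e : D ∩ g ⁻¹' L = closure D ∩ g ⁻¹' L := by
      refine Subset.antisymm (inter_subset_inter_left _ subset_closure) fun z hz => ⟨?_, hz.2⟩
      by_contra hzD
      have h1 := hg1 z ⟨hz.1, by rwa [hDo.interior_eq]⟩
      have h2 := mem_ball_zero_iff.1 (hL hz.2)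
      exact h2.ne h1
    rw [e]
    exact hDb.isCompact_closure.of_isClosed_subset
      (hg.preimage_isClosed_of_isClosed isClosed_closure hLc.isClosed) inter_subset_left

theorem supNorm_le {K : Set ℂ} {g : ℂ → ℂ} {C : ℝ} (h : ∀ z ∈ K, ‖g z‖ ≤ C) :
    supNorm K g ≤ ENNReal.ofReal C := by
  refine iSup₂_le fun z hz => ?_
  rw [← ofReal_norm]
  exact ENNReal.ofReal_le_ofReal (h z hz)

/-- From one proper approximant with non-vanishing boundary derivative to the whole sequence. -/
theorem exists_sequence_of_proper {D : Set ℂ} (hDo : IsOpen D) (hDb : Bornology.IsBounded D)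
    {K : Set ℂ} (hKD : K ⊆ D) (hK : IsCompact K) {f g : ℂ → ℂ}
    (hg : AnalyticOnNhd ℂ g (closure D)) (hgD : ∀ z ∈ D, ‖g z‖ < 1)
    (hg1 : ∀ z ∈ frontier D, ‖g z‖ = 1) (hg' : ∀ z ∈ frontier D, deriv g z ≠ 0)
    {ε : ℝ} (hε : 0 < ε) (hgf : ∀ z ∈ K, ‖g z - f z‖ ≤ ε / 4) :
    ∃ (M : ℝ) (B : ℕ → ℂ → ℂ), 0 < M ∧
      (∀ n : ℕ, 1 ≤ n → AnalyticOnNhd ℂ (B n) (closure D) ∧ IsProperToDisc D (B n)) ∧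
      (⨆ (n : ℕ) (_ : 1 ≤ n), supNorm K (fun z => B n z - f z)) < ENNReal.ofReal ε ∧
      (∀ n : ℕ, 1 ≤ n → ∀ z ∈ frontier D,
        (n : ℝ) / M ≤ ‖deriv (B n) z‖ ∧ ‖deriv (B n) z‖ ≤ (n : ℝ) * M) ∧
      (∃ (g : ℂ → ℂ) (δ c : ℝ), DifferentiableOn ℂ g D ∧ IsProperToDisc D g ∧
        supNorm K (fun z => g z - f z) < ENNReal.ofReal ε ∧
        0 < δ ∧ δ < 1 ∧ 0 < c ∧ c < 1 ∧
        ∀ n : ℕ, 1 ≤ n → ∀ z ∈ D, B n z = blaschke n δ c (g z)) := by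
  have hgc : ContinuousOn g (closure D) := hg.continuousOn
  have hgle : ∀ z ∈ closure D, ‖g z‖ ≤ 1 := by
    intro z hz
    by_cases hzD : z ∈ D
    · exact (hgD z hzD).le
    · exact (hg1 z ⟨hz, by rwa [hDo.interior_eq]⟩).le
  obtain ⟨ρ, hρ, hρK⟩ : ∃ ρ < 1, ∀ z ∈ K, ‖g z‖ ≤ ρ := by
    rcases K.eq_empty_or_nonempty with rfl | hne
    · exact ⟨0, one_pos, by simp⟩
    · obtain ⟨z₀, hz₀, hmax⟩ := hK.exists_isMaxOn hne
        ((hgc.mono (hKD.trans subset_closure)).norm)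
      exact ⟨‖g z₀‖, hgD _ (hKD hz₀), fun z hz => hmax hz⟩
  have hfr : IsCompact (frontier D) :=
    hDb.isCompact_closure.of_isClosed_subset isClosed_frontier frontier_subset_closure
  have hdc : ContinuousOn (deriv g) (frontier D) :=
    (hg.deriv.continuousOn).mono frontier_subset_closure
  obtain ⟨C₁, hC₁⟩ := hfr.exists_bound_of_continuousOn hdc
  obtain ⟨C₂, hC₂⟩ := hfr.exists_bound_of_continuousOn (hdc.inv₀ hg')
  -- Chosen so that 2(1 − s)/(1 − ρ) ≤ δ/(1 − ρ) ≤ ε/4 on K for every n; the parameter c will be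
  -- 1/2.
  set δ : ℝ := min (1 / 2) (ε * (1 - ρ) / 4) with hδ
  have hρ' : 0 < 1 - ρ := sub_pos.2 hρ
  have hδ0 : 0 < δ := by positivity
  have hδ1 : δ ≤ 1 / 2 := min_le_left _ _
  have hδε : δ / (1 - ρ) ≤ ε / 4 := by
    rw [div_le_iff₀ hρ']
    exact (min_le_right _ _).trans_eq (by ring)
  -- This is r^n for c = 1/2. Bernoulli's inequality and 1 − x ≤ exp(−x) confine it to [1 − δ/2,
  -- exp(−δ/2)], uniformly in n.
  set s : ℕ → ℝ := fun n => (1 - δ * (1 - 1 / 2) / n) ^ n with hs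
  set σ : ℝ := Real.exp (-(δ / 2)) with hσ
  have hσ1 : σ < 1 := by rw [hσ, Real.exp_lt_one_iff]; linarith
  have hs_low : ∀ n : ℕ, 1 ≤ n → 1 - δ / 2 ≤ s n := by
    intro n hn
    have hn' : (1 : ℝ) ≤ n := by exact_mod_cast hn
    have h1 : δ * (1 - 1 / 2) / n ≤ 1 := by
      rw [div_le_one (by linarith)]; linarith
    have := one_add_mul_le_pow (a := -(δ * (1 - 1 / 2) / n)) (by linarith) n
    have e : (n : ℝ) * -(δ * (1 - 1 / 2) / n) = -(δ / 2) := by field_simp; ring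
    rw [e] at this
    simpa only [hs, sub_eq_add_neg] using this
  have hs_up : ∀ n : ℕ, 1 ≤ n → s n ≤ σ := by
    intro n hn
    have hn' : (1 : ℝ) ≤ n := by exact_mod_cast hn
    have := Real.one_sub_div_pow_le_exp_neg (n := n) (t := δ / 2) (by linarith)
    refine le_of_eq_of_le ?_ this
    simp only [hs]; congr 3; ring
  have hs0 : ∀ n : ℕ, 1 ≤ n → 0 < s n := fun n hn => by linarith [hs_low n hn]
  have hs1 : ∀ n : ℕ, 1 ≤ n → s n < 1 := fun n hn => (hs_up n hn).trans_lt hσ1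
  have hBapp : ∀ n : ℕ, 1 ≤ n → ∀ z, blaschke n δ (1 / 2) (g z) = blaschkeForm n (s n) (g z) :=
    fun n hn z => by rw [blaschke_eq_blaschkeForm hn]
  have han : ∀ n : ℕ, 1 ≤ n →
      AnalyticOnNhd ℂ (fun z => blaschkeForm n (s n) (g z)) (closure D) := fun n hn z hz =>
    (analyticAt_blaschkeForm n (hs0 n hn) (hs1 n hn) (hgle z hz)).comp (hg z hz)
  have hsup : ∀ n : ℕ, 1 ≤ n → ∀ z ∈ K, ‖blaschkeForm n (s n) (g z) - f z‖ ≤ ε / 2 := by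
    intro n hn z hz
    have h1 := norm_blaschkeForm_sub_le hn (hs0 n hn) (hs1 n hn) (hgD z (hKD hz))
    have h2 : 2 * (1 - s n) / (1 - ‖g z‖) ≤ δ / (1 - ρ) := by
      have := hs_low n hn
      have h3 := hρK z hz
      gcongr
      linarith
    have h3 := norm_sub_le_norm_sub_add_norm_sub (blaschkeForm n (s n) (g z)) (g z) (f z)
    have h4 := hgf z hz
    linarith
  set A : ℝ := (1 - σ) / 2
  set A' : ℝ := 1 + 2 / (1 - σ)
  have hσ' := sub_pos.2 hσ1
  have hA : 0 < A := by positivity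
  have hA' : 0 < A' := by positivity
  -- One summand for each bound: the first uses the maximum of 1/|g'| on the frontier, the second
  -- the maximum of |g'|.
  set M : ℝ := (|C₂| + 1) / A + A' * (|C₁| + 1) with hM
  have hM0 : 0 < M := by positivity
  refine ⟨M, fun n z => blaschke n δ (1 / 2) (g z), hM0, fun n hn => ?_, ?_, fun n hn z hz => ?_,
    g, δ, 1 / 2, (hg.differentiableOn).mono subset_closure,
    isProperToDisc_of_norm_frontier_eq_one hDo hDb hgc hgD hg1, ?_, hδ0, by linarith, by norm_num,
    by norm_num, fun n hn z hz => rfl⟩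
  · simp only [hBapp n hn]
    refine ⟨han n hn, isProperToDisc_of_norm_frontier_eq_one hDo hDb (han n hn).continuousOn
      (fun z hz => norm_blaschkeForm_lt_one n (hs0 n hn) (hs1 n hn) (hgD z hz))
      fun z hz => norm_blaschkeForm_eq_one n (hs0 n hn) (hs1 n hn) (hg1 z hz)⟩
  · refine lt_of_le_of_lt (iSup₂_le fun n hn => ?_)
      ((ENNReal.ofReal_lt_ofReal_iff hε).2 (half_lt_self hε))
    refine supNorm_le fun z hz => ?_
    show ‖blaschke n δ (1 / 2) (g z) - f z‖ ≤ ε / 2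
    rw [hBapp n hn]
    exact hsup n hn z hz
  · simp only [hBapp n hn]
    have hzc := frontier_subset_closure hz
    have hd : deriv (fun z => blaschkeForm n (s n) (g z)) z =
        deriv (blaschkeForm n (s n)) (g z) * deriv g z :=
      deriv_comp z (analyticAt_blaschkeForm n (hs0 n hn) (hs1 n hn) (hgle z hzc)).differentiableAt
        (hg z hzc).differentiableAt
    obtain ⟨h1, h2⟩ := norm_deriv_blaschkeForm_bounds hn (hs0 n hn) (hs_up n hn) hσ1 (hg1 z hz)
    have h3 : ‖deriv g z‖ ≤ |C₁| + 1 := by linarith [hC₁ z hz, le_abs_self C₁]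
    have h4 := hC₂ z hz
    have h5 : 0 < ‖deriv g z‖ := norm_pos_iff.2 (hg' z hz)
    have hn' : (0 : ℝ) < n := by exact_mod_cast hn
    rw [hd, norm_mul]
    constructor
    · rw [Pi.inv_apply, norm_inv] at h4
      have h6 : ‖deriv g z‖⁻¹ ≤ |C₂| + 1 := by linarith [le_abs_self C₂]
      have h7 : (|C₂| + 1) / A ≤ M := by
        have : 0 < A' * (|C₁| + 1) := by positivity
        linarith
      calc (n : ℝ) / M ≤ n / ((|C₂| + 1) / A) := by gcongr
        _ = n * A * (|C₂| + 1)⁻¹ := by field_simp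
        _ ≤ n * A * ‖deriv g z‖ := by
          gcongr
          exact inv_le_of_inv_le₀ h5 h6
        _ ≤ _ := by gcongr
    · calc _ ≤ (n * A') * (|C₁| + 1) := by gcongr
        _ = n * (A' * (|C₁| + 1)) := by ring
        _ ≤ n * M := by
          have : 0 < (|C₂| + 1) / A := by positivity
          gcongr
          linarith
  · exact (supNorm_le hgf).trans_lt ((ENNReal.ofReal_lt_ofReal_iff hε).2 (by linarith))

end ProperApprox

/-! ### Collars of the boundary curves -/

namespace ProperApprox

open Complex Metric Set Filter Topology

theorem subset_or_disjoint_of_disjoint_frontier {D S : Set ℂ} (hDo : IsOpen D)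
    (hS : IsPreconnected S) (h : Disjoint S (frontier D)) : S ⊆ D ∨ Disjoint S D := by
  have hcov : S ⊆ D ∪ (closure D)ᶜ := by
    intro z hz
    by_cases hzc : z ∈ closure D
    · left
      by_contra hzD
      exact Set.disjoint_left.1 h hz ⟨hzc, by rwa [hDo.interior_eq]⟩
    · exact Or.inr hzc
  have hd : Disjoint D (closure D)ᶜ := disjoint_compl_right_iff_subset.2 subset_closure
  rcases isPreconnected_iff_subset_of_disjoint.1 hS D (closure D)ᶜ hDo
    isClosed_closure.isOpen_compl hcov (by rw [hd.inter_eq, inter_empty]) with h1 | h1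
  · exact Or.inl h1
  · exact Or.inr (hd.symm.mono_left h1)

theorem isPreconnected_image_annulus {a b : ℝ} (ha : 0 ≤ a) {φ : ℂ → ℂ}
    (hφ : ContinuousOn φ (annulus a b)) : IsPreconnected (φ '' annulus a b) :=
  (isPreconnected_annulus ha).image φ hφ

/-- This Cauchy transform is the winding number of the curve. It is locally constant off the curve
because φ'/(φ − z)² has the primitive −1/(φ − z). -/
theorem cauchyT_one_eq {φ : ℂ → ℂ} {r : ℝ} (hr : 0 ≤ r)
    {U : Set ℂ} (hU : IsOpen U) (hrU : sphere 0 r ⊆ U) (hφ : DifferentiableOn ℂ φ U)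
    {S : Set ℂ} (hSo : IsOpen S) (hS : IsPreconnected S) (hd : Disjoint S (φ '' sphere 0 r))
    {x y : ℂ} (hx : x ∈ S) (hy : y ∈ S) :
    cauchyT φ r (fun _ => 1) x = cauchyT φ r (fun _ => 1) y := by
  have hφ' : ContinuousOn (deriv φ) (sphere 0 r) := (hφ.deriv hU).continuousOn.mono hrU
  have hφc : ContinuousOn φ (sphere 0 r) := hφ.continuousOn.mono hrU
  refine hSo.is_const_of_deriv_eq_zero hS (fun z hz => (differentiableAt_cauchyT hr hφc hφ'
    continuousOn_const (Set.disjoint_left.1 hd hz)).differentiableWithinAt) (fun z hz => ?_) hx hy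
  have hz' := Set.disjoint_left.1 hd hz
  have h1 : HasDerivAt (cauchyT φ r fun _ => 1) _ z :=
    (hasDerivAt_circleIntegral_div_sub hr (continuousOn_const (c := (1 : ℂ)) |>.mul hφ') hφc
      hz').const_mul _
  rw [h1.deriv]
  have h2 : (∮ η in C(0, r), 1 * deriv φ η / (φ η - z) ^ 2) = 0 := by
    refine circleIntegral.integral_eq_zero_of_hasDerivWithinAt (f := fun η => -(φ η - z)⁻¹) hr
      fun η hη => ?_
    have h0 : φ η - z ≠ 0 := fun h => hz' ⟨η, hη, sub_eq_zero.1 h⟩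
    have h3 := ((hφ.differentiableAt (hU.mem_nhds (hrU hη))).hasDerivAt.sub_const z).inv h0
    have h4 := h3.neg.hasDerivWithinAt (s := sphere 0 r)
    rw [one_mul]
    rw [neg_div, neg_neg] at h4
    exact h4
  simp only [Pi.mul_apply] at h2 ⊢
  rw [h2, mul_zero]
  rfl

theorem inv_mem_annulus {R : ℝ} (hR : 0 < R) {w : ℂ} (hw : w ∈ annulus R⁻¹ R) :
    w⁻¹ ∈ annulus R⁻¹ R := by
  have h0 : 0 < ‖w‖ := (inv_pos.2 hR).trans hw.1
  refine ⟨?_, ?_⟩ <;> rw [norm_inv]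
  · exact inv_strictAnti₀ h0 hw.2
  · exact inv_lt_of_inv_lt₀ hR hw.1

/-- A substitute for the Jordan curve theorem. If both halves lay in D, the winding number of the
unit curve would agree at φ u and φ v, on its two sides. The winding number of the curve of radius r
< |u| also agrees there, and at φ v the two curves have the same one; yet at φ u they differ by 1.
-/
theorem not_both_sides {D : Set ℂ} (hDo : IsOpen D) (hDc : IsPreconnected D) {R : ℝ} (hR : 1 < R)
    {φ : ℂ → ℂ} (hφ : DifferentiableOn ℂ φ (annulus R⁻¹ R)) (hi : InjOn φ (annulus R⁻¹ R))
    (hΓ : Disjoint D (φ '' sphere 0 1))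
    (h₁ : φ '' annulus R⁻¹ 1 ⊆ D) (h₂ : φ '' annulus 1 R ⊆ D) : False := by
  have hR0 : 0 < R := one_pos.trans hR
  have hRi : 0 < R⁻¹ := inv_pos.2 hR0
  have hR1 : R⁻¹ < 1 := inv_lt_one_of_one_lt₀ hR
  obtain ⟨r, hr₁, hr₂⟩ := exists_between hR1
  obtain ⟨u, hu₁, hu₂⟩ := exists_between hr₂
  obtain ⟨v, hv₁, hv₂⟩ := exists_between hR
  obtain ⟨v', hv₁', hv₂'⟩ := exists_between hv₂
  have hu0 : 0 < u := hRi.trans (hr₁.trans hu₁)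
  have hv0 : 0 < v := one_pos.trans hv₁
  have nu : ‖(u : ℂ)‖ = u := by simp [abs_of_pos hu0]
  have nv : ‖(v : ℂ)‖ = v := by simp [abs_of_pos hv0]
  have huD : φ u ∈ D := h₁ ⟨u, by rw [mem_annulus, nu]; exact ⟨hr₁.trans hu₁, hu₂⟩, rfl⟩
  have hvD : φ v ∈ D := h₂ ⟨v, by rw [mem_annulus, nv]; exact ⟨hv₁, hv₂⟩, rfl⟩
  have hs : ∀ t, R⁻¹ < t → t < R → sphere (0 : ℂ) t ⊆ annulus R⁻¹ R := fun t => sphere_subset_annulus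
  have e1 := cauchyT_one_eq zero_le_one (isOpen_annulus _ _) (hs 1 hR1 hR) hφ hDo hDc hΓ huD hvD
  have hsub : annulus r R ⊆ annulus R⁻¹ R := annulus_subset hr₁.le le_rfl
  have e2 := cauchyT_one_eq (hRi.trans hr₁).le (isOpen_annulus _ _) (hs r hr₁ (hr₂.trans hR)) hφ
    (deriv_ne_zero_and_inverse (isOpen_annulus r R) (hφ.mono hsub) (hi.mono hsub)).1
    (isPreconnected_image_annulus (hRi.trans hr₁).le (hφ.continuousOn.mono hsub)) (by
      rw [Set.disjoint_left]
      rintro _ ⟨w, hw, rfl⟩ ⟨w', hw', h⟩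
      have := hi (hs r hr₁ (hr₂.trans hR) hw') (hsub hw) h
      rw [mem_sphere_zero_iff_norm] at hw'
      have h3 := hw.1
      rw [← this, hw'] at h3
      exact lt_irrefl _ h3)
    (mem_image_of_mem φ (show (u : ℂ) ∈ annulus r R by
      rw [mem_annulus, nu]; exact ⟨hu₁, hu₂.trans hR⟩))
    (mem_image_of_mem φ (show (v : ℂ) ∈ annulus r R by
      rw [mem_annulus, nv]; exact ⟨hr₂.trans hv₁, hv₂⟩))
  have e3 := cauchyT_sub_cauchyT (d := fun _ => 1) hRi.le hr₁ hR hφ hi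
    (differentiableOn_const _) (w := u) (by rwa [nu]) (by rwa [nu])
  have e4 := cauchyT_eq_of_notMem (d := fun _ => 1) hRi.le hr₁ hr₂.le hR hφ
    (differentiableOn_const _) (z := φ v) (fun w hw₁ hw₂ h => by
      have := hi ⟨hr₁.trans_le hw₁, hw₂.trans_lt hR⟩
        (show (v : ℂ) ∈ annulus R⁻¹ R by rw [mem_annulus, nv]; exact ⟨hR1.trans hv₁, hv₂⟩) h
      rw [this, nv] at hw₂
      linarith)
  rw [e1, e4, e2, sub_self] at e3
  exact zero_ne_one e3

/-- A finite family of holomorphic collars, jointly injective, that parametrises the boundary of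
`D`; the inner half of each collar lies in `D` and the outer half outside. -/
structure CollarSystem (D : Set ℂ) (ι : Type) (R : ℝ) where
  φ : ι → ℂ → ℂ
  one_lt : 1 < R
  diff : ∀ k, DifferentiableOn ℂ (φ k) (annulus R⁻¹ R)
  inj : ∀ k l, ∀ w ∈ annulus R⁻¹ R, ∀ w' ∈ annulus R⁻¹ R, φ k w = φ l w' → k = l ∧ w = w'
  mem_iff : ∀ k, ∀ w ∈ annulus R⁻¹ R, φ k w ∈ D ↔ ‖w‖ < 1
  frontier_eq : frontier D = ⋃ k, φ k '' sphere 0 1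

theorem eventually_annulus_subset {V : Set ℂ} (hV : IsOpen V) (h : sphere 0 1 ⊆ V) :
    ∀ᶠ R in 𝓝[>] (1 : ℝ), annulus R⁻¹ R ⊆ V := by
  obtain ⟨η, hη, hηV⟩ := (isCompact_sphere (0 : ℂ) 1).exists_thickening_subset_open hV h
  have : Ioo (1 : ℝ) (1 + η) ∈ 𝓝[>] (1 : ℝ) := Ioo_mem_nhdsGT (by linarith)
  filter_upwards [this] with R hR w hw
  have hR0 : 0 < R := one_pos.trans hR.1
  have h0 : 0 < ‖w‖ := (inv_pos.2 hR0).trans hw.1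
  refine hηV (mem_thickening_iff.2 ⟨w / ‖w‖, ?_, ?_⟩)
  · rw [mem_sphere_zero_iff_norm, norm_div, norm_real, norm_norm, div_self h0.ne']
  · have hc : (‖w‖ : ℂ) ≠ 0 := by exact_mod_cast h0.ne'
    have e : w - w / ‖w‖ = (w / ‖w‖) * ((‖w‖ - 1 : ℝ) : ℂ) := by
      push_cast; field_simp
    have h1 : 1 - R⁻¹ ≤ R - 1 := by
      have : R + R⁻¹ - 2 = (R - 1) ^ 2 / R := by field_simp; ring
      have h2 : 0 ≤ (R - 1) ^ 2 / R := by positivity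
      linarith
    rw [dist_eq_norm, e, norm_mul, norm_div, norm_real, norm_norm, div_self h0.ne', one_mul,
      norm_real, Real.norm_eq_abs, abs_lt]
    constructor <;> linarith [hw.1, hw.2, hR.2]

/-- The boundary components are finitely many disjoint compact curves, so thin collars around them
are disjoint and meet the frontier only in the middle circle. Each half collar then lies in D or
misses D. Not both lie in D by `not_both_sides`, and not both miss it because boundary points are
limits of D. -/
theorem IsAnalyticDomain.exists_collarSystem {D : Set ℂ} (hD : IsAnalyticDomain D) :
    ∃ (ι : Type) (_ : Fintype ι) (R : ℝ), Nonempty (CollarSystem D ι R) := by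
  set S : Set (Set ℂ) := {Γ | ∃ z ∈ frontier D, Γ = connectedComponentIn (frontier D) z} with hS
  have : Finite S := hD.finite_components
  have := Fintype.ofFinite S
  have hcurve : ∀ Γ : S, IsAnalyticJordanCurve (Γ : Set ℂ) := by
    rintro ⟨_, z, hz, rfl⟩
    exact hD.analytic_components z hz
  choose U φ hUo hsU hφd hφi hφΓ using hcurve
  have hcpt : ∀ Γ : S, IsCompact (Γ : Set ℂ) := fun Γ => by
    rw [← hφΓ Γ]
    exact (isCompact_sphere _ _).image_of_continuousOn ((hφd Γ).continuousOn.mono (hsU Γ))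
  have hΓsub : ∀ Γ : S, (Γ : Set ℂ) ⊆ frontier D := by
    rintro ⟨_, z, hz, rfl⟩
    exact connectedComponentIn_subset _ _
  have hdisj : ∀ Γ Γ' : S, Γ ≠ Γ' → Disjoint (Γ : Set ℂ) Γ' := by
    rintro ⟨_, z, hz, rfl⟩ ⟨_, z', hz', rfl⟩ hne
    rw [Set.disjoint_left]
    intro x hx hx'
    apply hne
    rw [Subtype.mk.injEq, connectedComponentIn_eq hx, connectedComponentIn_eq hx']
  have hfr : frontier D = ⋃ Γ : S, (Γ : Set ℂ) := by
    refine Subset.antisymm (fun z hz => mem_iUnion.2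
      ⟨⟨_, z, hz, rfl⟩, mem_connectedComponentIn hz⟩) (iUnion_subset hΓsub)
  have hth : ∀ᶠ δ in 𝓝[>] (0 : ℝ), ∀ Γ Γ' : S, Γ ≠ Γ' →
      Disjoint (thickening δ (Γ : Set ℂ)) (thickening δ (Γ' : Set ℂ)) := by
    refine eventually_all.2 fun Γ => eventually_all.2 fun Γ' => ?_
    by_cases hne : Γ = Γ'
    · exact Eventually.of_forall fun δ h => absurd hne h
    · obtain ⟨δ, hδ, h⟩ := (hdisj Γ Γ' hne).exists_thickenings (hcpt Γ) (hcpt Γ').isClosed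
      filter_upwards [Ioo_mem_nhdsGT hδ] with δ' hδ' _
      exact h.mono (thickening_mono hδ'.2.le _) (thickening_mono hδ'.2.le _)
  obtain ⟨δ, hδdisj, hδ⟩ := (hth.and self_mem_nhdsWithin).exists
  have hVo : ∀ Γ : S, IsOpen (U Γ ∩ φ Γ ⁻¹' thickening δ (Γ : Set ℂ)) := fun Γ =>
    (hφd Γ).continuousOn.isOpen_inter_preimage (hUo Γ) isOpen_thickening
  have hVs : ∀ Γ : S, sphere 0 1 ⊆ U Γ ∩ φ Γ ⁻¹' thickening δ (Γ : Set ℂ) := fun Γ w hw =>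
    ⟨hsU Γ hw, self_subset_thickening hδ _ (by
      have h := mem_image_of_mem (φ Γ) hw
      rwa [hφΓ] at h)⟩
  obtain ⟨R, hRA, hR⟩ := ((eventually_all.2 fun Γ =>
    eventually_annulus_subset (hVo Γ) (hVs Γ)).and self_mem_nhdsWithin).exists
  have hR : 1 < R := hR
  have hR0 : 0 < R := one_pos.trans hR
  have hRi : 0 < R⁻¹ := inv_pos.2 hR0
  have hR1 : R⁻¹ < 1 := inv_lt_one_of_one_lt₀ hR
  have hs1 : sphere (0 : ℂ) 1 ⊆ annulus R⁻¹ R := sphere_subset_annulus hR1 hR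
  have hdiff : ∀ Γ : S, DifferentiableOn ℂ (φ Γ) (annulus R⁻¹ R) := fun Γ =>
    (hφd Γ).mono fun w hw => (hRA Γ hw).1
  have hinj : ∀ Γ : S, InjOn (φ Γ) (annulus R⁻¹ R) := fun Γ =>
    (hφi Γ).mono fun w hw => (hRA Γ hw).1
  have hin : ∀ Γ : S, ∀ w ∈ annulus R⁻¹ R, φ Γ w ∈ thickening δ (Γ : Set ℂ) := fun Γ w hw =>
    (hRA Γ hw).2
  have hnf : ∀ Γ : S, ∀ w ∈ annulus R⁻¹ R, ‖w‖ ≠ 1 → φ Γ w ∉ frontier D := by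
    intro Γ w hw hw1 h
    rw [hfr] at h
    obtain ⟨Γ', hΓ'⟩ := mem_iUnion.1 h
    rcases eq_or_ne Γ Γ' with rfl | hne
    · rw [← hφΓ] at hΓ'
      obtain ⟨w', hw', e⟩ := hΓ'
      have := hinj Γ (hs1 hw') hw e
      rw [← this] at hw1
      exact hw1 (mem_sphere_zero_iff_norm.1 hw')
    · exact Set.disjoint_left.1 (hδdisj Γ Γ' hne) (hin Γ w hw)
        (self_subset_thickening hδ _ hΓ')
  have hDfr : Disjoint D (frontier D) := (disjoint_frontier_iff_isOpen.2 hD.isOpen).symm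
  have hsphere : ∀ Γ : S, ∀ w ∈ sphere (0 : ℂ) 1, φ Γ w ∉ D := fun Γ w hw hwD => by
    refine Set.disjoint_left.1 hDfr hwD (hΓsub Γ ?_)
    rw [← hφΓ]
    exact mem_image_of_mem _ hw
  have hsides : ∀ Γ : S, ∃ ψ : ℂ → ℂ, DifferentiableOn ℂ ψ (annulus R⁻¹ R) ∧
      InjOn ψ (annulus R⁻¹ R) ∧ (∀ w ∈ annulus R⁻¹ R, ψ w ∈ thickening δ (Γ : Set ℂ)) ∧
      ψ '' sphere 0 1 = Γ ∧ ∀ w ∈ annulus R⁻¹ R, ψ w ∈ D ↔ ‖w‖ < 1 := by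
    intro Γ
    have hA₁ : annulus R⁻¹ 1 ⊆ annulus R⁻¹ R := annulus_subset le_rfl hR.le
    have hA₂ : annulus 1 R ⊆ annulus R⁻¹ R := annulus_subset hR1.le le_rfl
    have s₁ : φ Γ '' annulus R⁻¹ 1 ⊆ D ∨ Disjoint (φ Γ '' annulus R⁻¹ 1) D := by
      refine subset_or_disjoint_of_disjoint_frontier hD.isOpen
        (isPreconnected_image_annulus hRi.le ((hdiff Γ).continuousOn.mono hA₁)) ?_
      rw [Set.disjoint_left]
      rintro _ ⟨w, hw, rfl⟩
      exact hnf Γ w (hA₁ hw) hw.2.ne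
    have s₂ : φ Γ '' annulus 1 R ⊆ D ∨ Disjoint (φ Γ '' annulus 1 R) D := by
      refine subset_or_disjoint_of_disjoint_frontier hD.isOpen
        (isPreconnected_image_annulus zero_le_one ((hdiff Γ).continuousOn.mono hA₂)) ?_
      rw [Set.disjoint_left]
      rintro _ ⟨w, hw, rfl⟩
      exact hnf Γ w (hA₂ hw) hw.1.ne'
    have hmeet : ∃ w ∈ annulus R⁻¹ R, φ Γ w ∈ D := by
      have h1 : (1 : ℂ) ∈ annulus R⁻¹ R := hs1 (by simp)
      have h2 : φ Γ 1 ∈ closure D := frontier_subset_closure (hΓsub Γ (by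
        rw [← hφΓ]; exact mem_image_of_mem _ (by simp)))
      obtain ⟨_, ⟨w, hw, rfl⟩, hwD⟩ := mem_closure_iff.1 h2 _
        (deriv_ne_zero_and_inverse (isOpen_annulus _ _) (hdiff Γ) (hinj Γ)).1
        (mem_image_of_mem _ h1)
      exact ⟨w, hw, hwD⟩
    have hnb := not_both_sides hD.isOpen hD.isConnected.isPreconnected hR (hdiff Γ) (hinj Γ)
      (by rw [hφΓ]; exact hDfr.mono_right (hΓsub Γ))
    rcases s₁ with s₁ | s₁
    · rcases s₂ with s₂ | s₂
      · exact (hnb s₁ s₂).elim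
      · refine ⟨φ Γ, hdiff Γ, hinj Γ, hin Γ, hφΓ Γ, fun w hw => ⟨fun h => ?_, fun h =>
          s₁ (mem_image_of_mem _ ⟨hw.1, h⟩)⟩⟩
        rcases lt_trichotomy ‖w‖ 1 with h1 | h1 | h1
        · exact h1
        · exact (hsphere Γ w (mem_sphere_zero_iff_norm.2 h1) h).elim
        · exact (Set.disjoint_left.1 s₂ (mem_image_of_mem _ ⟨h1, hw.2⟩) h).elim
    · have s₂ : φ Γ '' annulus 1 R ⊆ D := by
        refine s₂.resolve_right fun s₂ => ?_
        obtain ⟨w, hw, h⟩ := hmeet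
        rcases lt_trichotomy ‖w‖ 1 with h1 | h1 | h1
        · exact (Set.disjoint_left.1 s₁ (mem_image_of_mem _ ⟨hw.1, h1⟩) h).elim
        · exact (hsphere Γ w (mem_sphere_zero_iff_norm.2 h1) h).elim
        · exact (Set.disjoint_left.1 s₂ (mem_image_of_mem _ ⟨h1, hw.2⟩) h).elim
      have hne : ∀ w ∈ annulus R⁻¹ R, w ≠ 0 := fun w hw => by
        rw [← norm_pos_iff]; exact hRi.trans hw.1
      have hinv : MapsTo (fun w : ℂ => w⁻¹) (annulus R⁻¹ R) (annulus R⁻¹ R) := fun w hw =>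
        inv_mem_annulus hR0 hw
      -- The outer half is the one in D, so the parameter is inverted.
      refine ⟨fun w => φ Γ w⁻¹, (hdiff Γ).comp (differentiableOn_inv.mono hne) hinv,
        fun w hw w' hw' h => inv_injective (hinj Γ (hinv hw) (hinv hw') h),
        fun w hw => hin Γ _ (hinv hw), ?_, fun w hw => ⟨fun h => ?_, fun h => ?_⟩⟩
      · rw [← hφΓ Γ]
        ext z
        constructor
        · rintro ⟨w, hw, rfl⟩
          exact mem_image_of_mem _ (by simpa using hw)
        · rintro ⟨w, hw, rfl⟩
          exact ⟨w⁻¹, by simpa using hw, by simp⟩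
      · by_contra h1
        rcases (not_lt.1 h1).lt_or_eq with h1 | h1
        · refine Set.disjoint_left.1 s₁ (mem_image_of_mem _ ⟨(hinv hw).1, ?_⟩) h
          rw [norm_inv]; exact inv_lt_one_of_one_lt₀ h1
        · exact hsphere Γ w⁻¹ (by simp [← h1]) h
      · refine s₂ (mem_image_of_mem _ ⟨?_, (hinv hw).2⟩)
        rw [norm_inv]
        exact (one_lt_inv₀ (hRi.trans hw.1)).2 h
  choose ψ hψd hψi hψt hψΓ hψD using hsides
  refine ⟨S, inferInstance, R, ⟨⟨ψ, hR, hψd, fun Γ Γ' w hw w' hw' h => ?_, hψD, ?_⟩⟩⟩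
  · rcases eq_or_ne Γ Γ' with rfl | hne
    · exact ⟨rfl, hψi Γ hw hw' h⟩
    · exact (Set.disjoint_left.1 (hδdisj Γ Γ' hne) (hψt Γ w hw) (h ▸ hψt Γ' w' hw')).elim
  · simp only [hψΓ]
    exact hfr

namespace CollarSystem

variable {D : Set ℂ} {ι : Type} {R : ℝ} (S : CollarSystem D ι R)

theorem injOn (k : ι) : InjOn (S.φ k) (annulus R⁻¹ R) := fun w hw w' hw' h =>
  (S.inj k k w hw w' hw' h).2

theorem inv_pos {D : Set ℂ} {ι : Type} {R : ℝ} (S : CollarSystem D ι R) : 0 < R⁻¹ := _root_.inv_pos.2 (one_pos.trans S.one_lt)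

theorem inv_lt_one {D : Set ℂ} {ι : Type} {R : ℝ} (S : CollarSystem D ι R) : R⁻¹ < 1 := inv_lt_one_of_one_lt₀ S.one_lt

theorem isOpen_image (k : ι) {V : Set ℂ} (hV : IsOpen V) (hVA : V ⊆ annulus R⁻¹ R) :
    IsOpen (S.φ k '' V) :=
  (deriv_ne_zero_and_inverse hV ((S.diff k).mono hVA) ((S.injOn k).mono hVA)).1

theorem sphere_subset {D : Set ℂ} {ι : Type} {R : ℝ} (S : CollarSystem D ι R) :
    sphere (0 : ℂ) 1 ⊆ annulus R⁻¹ R :=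
  sphere_subset_annulus S.inv_lt_one S.one_lt

/-- The part of `D` outside the inner collars of radius `r`. -/
def core (r : ℝ) : Set ℂ := D \ ⋃ k, S.φ k '' annulus r 1

theorem core_subset (r : ℝ) : S.core r ⊆ D := sdiff_subset

/-- Removing the full open collars from the closure of D gives the same set: they cover the
frontier, and their outer halves do not meet D. -/
theorem isCompact_core [Finite ι] (hDb : Bornology.IsBounded D) {r : ℝ} (hr : R⁻¹ ≤ r) (hr1 : r < 1) :
    IsCompact (S.core r) := by
  have e : S.core r = closure D \ ⋃ k, S.φ k '' annulus r R := by
    ext z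
    constructor
    · rintro ⟨hz, hz'⟩
      refine ⟨subset_closure hz, fun h => hz' ?_⟩
      obtain ⟨k, w, hw, rfl⟩ := mem_iUnion.1 h
      exact mem_iUnion.2 ⟨k, w, ⟨hw.1, (S.mem_iff k w ⟨hr.trans_lt hw.1, hw.2⟩).1 hz⟩, rfl⟩
    · rintro ⟨hz, hz'⟩
      refine ⟨?_, fun h => hz' ?_⟩
      · by_contra hzD
        have hzf : z ∈ frontier D := ⟨hz, fun h => hzD (interior_subset h)⟩
        rw [S.frontier_eq] at hzf
        obtain ⟨k, w, hw, rfl⟩ := mem_iUnion.1 hzf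
        rw [mem_sphere_zero_iff_norm] at hw
        exact hz' (mem_iUnion.2 ⟨k, w, ⟨hw ▸ hr1, hw ▸ S.one_lt⟩, rfl⟩)
      · obtain ⟨k, w, hw, rfl⟩ := mem_iUnion.1 h
        exact mem_iUnion.2 ⟨k, w, ⟨hw.1, hw.2.trans S.one_lt⟩, rfl⟩
  rw [e]
  refine hDb.isCompact_closure.diff (isOpen_iUnion fun k => ?_)
  exact S.isOpen_image k (isOpen_annulus _ _) (annulus_subset hr le_rfl)

theorem exists_subset_core [Finite ι] {K : Set ℂ} (hK : IsCompact K) (hKD : K ⊆ D) :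
    ∃ r, R⁻¹ < r ∧ r < 1 ∧ K ⊆ S.core r := by
  have h : ∀ k, ∀ᶠ R' in 𝓝[>] (1 : ℝ), annulus R'⁻¹ R' ⊆ annulus R⁻¹ R ∩ S.φ k ⁻¹' Kᶜ := by
    intro k
    refine eventually_annulus_subset ((S.diff k).continuousOn.isOpen_inter_preimage
      (isOpen_annulus _ _) hK.isClosed.isOpen_compl) fun w hw => ⟨S.sphere_subset hw, fun h => ?_⟩
    have h1 := (S.mem_iff k w (S.sphere_subset hw)).1 (hKD h)
    rw [mem_sphere_zero_iff_norm] at hw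
    exact h1.ne hw
  obtain ⟨R', hR', hR1⟩ := ((eventually_all.2 h).and (Ioo_mem_nhdsGT S.one_lt)).exists
  have hR0 : 0 < R' := one_pos.trans hR1.1
  refine ⟨R'⁻¹, inv_strictAnti₀ hR0 hR1.2, inv_lt_one_of_one_lt₀ hR1.1, fun z hz =>
    ⟨hKD hz, fun hz' => ?_⟩⟩
  obtain ⟨k, w, hw, rfl⟩ := mem_iUnion.1 hz'
  exact (hR' k ⟨hw.1, hw.2.trans hR1.1⟩).2 hz

end CollarSystem

end ProperApprox

/-! ### Cauchy transforms over the collars, maximum principle, gluing -/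

namespace ProperApprox

open Complex Metric Set Filter Topology

theorem cauchyT_congr {φ d d' : ℂ → ℂ} {r : ℝ} (hr : 0 ≤ r) (h : EqOn d d' (sphere 0 r)) (z : ℂ) :
    cauchyT φ r d z = cauchyT φ r d' z := by
  rw [cauchyT, cauchyT]
  congr 1
  exact circleIntegral.integral_congr hr fun η hη => by simp only [h hη]

theorem cauchyT_add {φ d d' : ℂ → ℂ} {r : ℝ} (hr : 0 ≤ r) (hφ : ContinuousOn φ (sphere 0 r))
    (hφ' : ContinuousOn (deriv φ) (sphere 0 r)) (hd : ContinuousOn d (sphere 0 r))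
    (hd' : ContinuousOn d' (sphere 0 r)) {z : ℂ} (hz : z ∉ φ '' sphere 0 r) :
    cauchyT φ r (fun η => d η + d' η) z = cauchyT φ r d z + cauchyT φ r d' z := by
  have h0 : ∀ η ∈ sphere (0 : ℂ) r, φ η - z ≠ 0 := fun η hη h => hz ⟨η, hη, sub_eq_zero.1 h⟩
  have hi : ∀ e : ℂ → ℂ, ContinuousOn e (sphere 0 r) →
      CircleIntegrable (fun η => e η * deriv φ η / (φ η - z)) 0 r := fun e he =>
    ((he.mul hφ').div (hφ.sub continuousOn_const) h0).circleIntegrable hr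
  rw [cauchyT, cauchyT, cauchyT, ← mul_add, ← circleIntegral.integral_add (hi d hd) (hi d' hd')]
  congr 1
  exact circleIntegral.integral_congr hr fun η hη => by
    ring

theorem cauchyT_const_mul (φ d : ℂ → ℂ) (r : ℝ) (c z : ℂ) :
    cauchyT φ r (fun η => c * d η) z = c * cauchyT φ r d z := by
  rw [cauchyT, cauchyT, mul_left_comm, ← smul_eq_mul c (circleIntegral _ _ _),
    ← circleIntegral.integral_smul]
  congr 2
  ext η
  rw [smul_eq_mul]; ring

namespace CollarSystem

variable {D : Set ℂ} {ι : Type} {R : ℝ} (S : CollarSystem D ι R)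

theorem continuousOn_sphere (k : ι) {r : ℝ} (h₁ : R⁻¹ < r) (h₂ : r < R) :
    ContinuousOn (S.φ k) (sphere 0 r) :=
  (S.diff k).continuousOn.mono (sphere_subset_annulus h₁ h₂)

theorem continuousOn_deriv_sphere (k : ι) {r : ℝ} (h₁ : R⁻¹ < r) (h₂ : r < R) :
    ContinuousOn (deriv (S.φ k)) (sphere 0 r) :=
  ((S.diff k).deriv (isOpen_annulus _ _)).continuousOn.mono (sphere_subset_annulus h₁ h₂)

section

/-- The sum of the Cauchy transforms of the `W k` over the curves `φ k (|w| = r)`. -/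
noncomputable def J [Fintype ι] (r : ℝ) (W : ι → ℂ → ℂ) (z : ℂ) : ℂ :=
  ∑ k, cauchyT (S.φ k) r (W k) z

variable [Fintype ι]

theorem J_congr {r : ℝ} (hr : 0 ≤ r) {W W' : ι → ℂ → ℂ} (h : ∀ k, EqOn (W k) (W' k) (sphere 0 r))
    (z : ℂ) : S.J r W z = S.J r W' z :=
  Finset.sum_congr rfl fun k _ => cauchyT_congr hr (h k) z

theorem J_add {r : ℝ} (h₁ : R⁻¹ < r) (h₂ : r < R) {W W' : ι → ℂ → ℂ}
    (hW : ∀ k, ContinuousOn (W k) (sphere 0 r)) (hW' : ∀ k, ContinuousOn (W' k) (sphere 0 r))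
    {z : ℂ} (hz : ∀ k, z ∉ S.φ k '' sphere 0 r) :
    S.J r (fun k η => W k η + W' k η) z = S.J r W z + S.J r W' z := by
  rw [J, J, J, ← Finset.sum_add_distrib]
  exact Finset.sum_congr rfl fun k _ => cauchyT_add (S.inv_pos.trans h₁).le
    (S.continuousOn_sphere k h₁ h₂) (S.continuousOn_deriv_sphere k h₁ h₂) (hW k) (hW' k) (hz k)

theorem J_const_mul (r : ℝ) (W : ι → ℂ → ℂ) (c z : ℂ) :
    S.J r (fun k η => c * W k η) z = c * S.J r W z := by
  rw [J, J, Finset.mul_sum]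
  exact Finset.sum_congr rfl fun k _ => cauchyT_const_mul _ _ _ _ _

theorem differentiableAt_J {r : ℝ} (h₁ : R⁻¹ < r) (h₂ : r < R) {W : ι → ℂ → ℂ}
    (hW : ∀ k, ContinuousOn (W k) (sphere 0 r)) {z : ℂ} (hz : ∀ k, z ∉ S.φ k '' sphere 0 r) :
    DifferentiableAt ℂ (S.J r W) z := by
  have : S.J r W = fun z => ∑ k, cauchyT (S.φ k) r (W k) z := rfl
  rw [this]
  exact DifferentiableAt.fun_sum fun k _ => differentiableAt_cauchyT (S.inv_pos.trans h₁).le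
    (S.continuousOn_sphere k h₁ h₂) (S.continuousOn_deriv_sphere k h₁ h₂) (hW k) (hz k)

theorem exists_norm_J_le {r : ℝ} (h₁ : R⁻¹ < r) (h₂ : r < R) {K : Set ℂ} (hK : IsCompact K)
    (hKr : ∀ k, ∀ η ∈ sphere (0 : ℂ) r, S.φ k η ∉ K) :
    ∃ C, 0 ≤ C ∧ ∀ (W : ι → ℂ → ℂ) (B : ℝ), (∀ k, ∀ η ∈ sphere (0 : ℂ) r, ‖W k η‖ ≤ B) →
      ∀ z ∈ K, ‖S.J r W z‖ ≤ C * B := by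
  have h : ∀ k, ∃ C, 0 ≤ C ∧ ∀ (d : ℂ → ℂ) (B : ℝ), (∀ η ∈ sphere (0 : ℂ) r, ‖d η‖ ≤ B) →
      ∀ z ∈ K, ‖cauchyT (S.φ k) r d z‖ ≤ C * B := by
    intro k
    obtain ⟨δ, hδ, H⟩ := exists_pos_forall_le_norm_sub (isCompact_sphere (0 : ℂ) r) hK
      (S.continuousOn_sphere k h₁ h₂) (hKr k)
    obtain ⟨C', hC'⟩ := (isCompact_sphere (0 : ℂ) r).exists_bound_of_continuousOn
      (S.continuousOn_deriv_sphere k h₁ h₂)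
    have hr0 : 0 < r := S.inv_pos.trans h₁
    have hC0 : 0 ≤ C' := (norm_nonneg _).trans (hC' (r : ℂ) (by simp [abs_of_pos hr0]))
    exact ⟨r * C' / δ, by positivity, fun d B hd z hz =>
      norm_cauchyT_le hr0.le hδ hd hC' fun η hη => H η hη z hz⟩
  choose C hC0 hC using h
  refine ⟨∑ k, C k, Finset.sum_nonneg fun k _ => hC0 k, fun W B hW z hz => ?_⟩
  rw [Finset.sum_mul]
  exact norm_sum_le_of_le _ fun k _ => hC k (W k) B (hW k) z hz

theorem J_eq_of_notMem {r₁ r₂ : ℝ} (h₁ : R⁻¹ < r₁) (h₁₂ : r₁ ≤ r₂) (h₂ : r₂ < 1) {W : ι → ℂ → ℂ}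
    (hW : ∀ k, DifferentiableOn ℂ (W k) (annulus R⁻¹ 1)) {z : ℂ}
    (hz : ∀ k w, r₁ ≤ ‖w‖ → ‖w‖ ≤ r₂ → S.φ k w ≠ z) : S.J r₂ W z = S.J r₁ W z :=
  Finset.sum_congr rfl fun k _ => cauchyT_eq_of_notMem S.inv_pos.le h₁ h₁₂ h₂
    ((S.diff k).mono (annulus_subset le_rfl S.one_lt.le)) (hW k) (hz k)

/-- Only the k-th term jumps; for the other terms the contour can be moved from r₁ to r₂, since
distinct collars are disjoint. -/
theorem J_sub_J {r₁ r₂ : ℝ} (h₁ : R⁻¹ < r₁) (h₂ : r₂ < 1) {W : ι → ℂ → ℂ}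
    (hW : ∀ k, DifferentiableOn ℂ (W k) (annulus R⁻¹ 1)) {k : ι} {w : ℂ} (hw₁ : r₁ < ‖w‖)
    (hw₂ : ‖w‖ < r₂) : S.J r₂ W (S.φ k w) = S.J r₁ W (S.φ k w) + W k w := by
  classical
  have hsub : annulus R⁻¹ 1 ⊆ annulus R⁻¹ R := annulus_subset le_rfl S.one_lt.le
  have hw : w ∈ annulus R⁻¹ R := ⟨h₁.trans hw₁, hw₂.trans (h₂.trans S.one_lt)⟩
  rw [J, J, ← Finset.add_sum_erase _ _ (Finset.mem_univ k),
    ← Finset.add_sum_erase _ (fun l => cauchyT (S.φ l) r₁ (W l) (S.φ k w)) (Finset.mem_univ k)]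
  have e1 := cauchyT_sub_cauchyT S.inv_pos.le h₁ h₂ ((S.diff k).mono hsub) ((S.injOn k).mono hsub)
    (hW k) hw₁ hw₂
  have e2 : ∑ l ∈ Finset.univ.erase k, cauchyT (S.φ l) r₂ (W l) (S.φ k w) =
      ∑ l ∈ Finset.univ.erase k, cauchyT (S.φ l) r₁ (W l) (S.φ k w) := by
    refine Finset.sum_congr rfl fun l hl => cauchyT_eq_of_notMem S.inv_pos.le h₁
      (hw₁.trans hw₂).le h₂ ((S.diff l).mono hsub) (hW l) fun w' hw₁' hw₂' h => ?_
    exact (Finset.mem_erase.1 hl).1 (S.inj l k w'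
      ⟨h₁.trans_le hw₁', hw₂'.trans_lt (h₂.trans S.one_lt)⟩ w hw h).1
  rw [e2, ← e1]
  ring

end

theorem nonempty_index {D : Set ℂ} {ι : Type} {R : ℝ} (S : CollarSystem D ι R)
    (hDb : Bornology.IsBounded D) (hDne : D.Nonempty) : Nonempty ι := by
  by_contra h
  rw [not_nonempty_iff] at h
  have h1 : frontier D = ∅ := by rw [S.frontier_eq]; simp
  have h2 := frontier_eq_empty_iff.1 h1
  rcases h2 with h2 | h2
  · exact hDne.ne_empty h2
  · rw [h2] at hDb
    exact NormedSpace.unbounded_univ ℝ ℂ hDb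

/-- Maximum principle, with the boundary bound stated in the collars. -/
theorem norm_le_of_collar [Finite ι] (hDo : IsOpen D) (hDc : IsConnected D)
    (hDb : Bornology.IsBounded D) {h : ℂ → ℂ} (hh : DifferentiableOn ℂ h D) {C r : ℝ} (hr : r < 1)
    (H : ∀ k w, R⁻¹ < ‖w‖ → r < ‖w‖ → ‖w‖ < 1 → ‖h (S.φ k w)‖ ≤ C) {z : ℂ} (hz : z ∈ D) :
    ‖h z‖ ≤ C := by
  by_contra! hC
  obtain ⟨k⟩ := S.nonempty_index hDb hDc.nonempty
  set r' := max r R⁻¹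
  have hr' : r' < 1 := max_lt hr S.inv_lt_one
  have Hout : ∀ z ∈ D, z ∉ S.core r' → ‖h z‖ ≤ C := by
    intro z hz hzc
    have : z ∈ ⋃ k, S.φ k '' annulus r' 1 := by
      by_contra h'; exact hzc ⟨hz, h'⟩
    obtain ⟨l, w, hw, rfl⟩ := mem_iUnion.1 this
    exact H l w ((le_max_right _ _).trans_lt hw.1) ((le_max_left _ _).trans_lt hw.1) hw.2
  have hzc : z ∈ S.core r' := by
    by_contra h'
    exact absurd (Hout z hz h') (not_le.2 hC)
  obtain ⟨z₁, hz₁, hmax⟩ := (S.isCompact_core hDb (le_max_right _ _) hr').exists_isMaxOn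
    ⟨z, hzc⟩ ((hh.continuousOn.mono (S.core_subset r')).norm)
  have hz₁C : C < ‖h z₁‖ := hC.trans_le (hmax hzc)
  -- Outside the core the bound C holds, so a value above C in the core is a maximum over all of D.
  -- Then |h| is constant, which contradicts the bound in a collar.
  have hmax' : IsMaxOn (norm ∘ h) D z₁ := by
    intro x hx
    by_cases hxc : x ∈ S.core r'
    · exact hmax hxc
    · exact (Hout x hx hxc).trans hz₁C.le
  obtain ⟨t, ht₁, ht₂⟩ := exists_between hr'
  have ht₀ : R⁻¹ < t := (le_max_right _ _).trans_lt ht₁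
  have nt : ‖(t : ℂ)‖ = t := by simp [abs_of_pos (S.inv_pos.trans ht₀)]
  have htD : S.φ k t ∈ D := (S.mem_iff k t (by
    rw [mem_annulus, nt]; exact ⟨ht₀, ht₂.trans S.one_lt⟩)).2 (by rwa [nt])
  have h1 := Complex.norm_eqOn_of_isPreconnected_of_isMaxOn hDc.isPreconnected hDo hh
    (S.core_subset _ hz₁) hmax' htD
  have h2 := H k t (by rwa [nt]) (by rw [nt]; exact (le_max_left _ _).trans_lt ht₁) (by rwa [nt])
  simp only [Function.comp_apply, Function.const_apply] at h1
  linarith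

/-- Joint injectivity of the collar maps makes h k ∘ (φ k)⁻¹ well defined and holomorphic, and it
agrees with g₀ on the overlap. With b > 1 the result is analytic across the frontier. -/
theorem exists_glue {r₁ r₂ b : ℝ} (h₀ : R⁻¹ < r₁) (h₁₂ : r₁ < r₂) (hb : 1 ≤ b)
    (hbR : b ≤ R) {g₀ : ℂ → ℂ} {O : Set ℂ} (hO : IsOpen O) (hOD : O ⊆ D)
    (hDO : ∀ z ∈ D, z ∉ O → ∃ k, ∃ w, r₂ ≤ ‖w‖ ∧ ‖w‖ < 1 ∧ S.φ k w = z)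
    (hO₂ : ∀ k w, r₂ ≤ ‖w‖ → ‖w‖ < 1 → S.φ k w ∉ O)
    (hg₀ : DifferentiableOn ℂ g₀ O) {h : ι → ℂ → ℂ}
    (hh : ∀ k, DifferentiableOn ℂ (h k) (annulus r₁ b))
    (hgh : ∀ k w, r₁ < ‖w‖ → ‖w‖ < r₂ → g₀ (S.φ k w) = h k w) :
    ∃ g : ℂ → ℂ, EqOn g g₀ O ∧ (∀ k, ∀ w ∈ annulus r₁ b, g (S.φ k w) = h k w) ∧
      DifferentiableOn ℂ g D ∧
      ∀ k, ∀ w ∈ annulus r₁ b, AnalyticAt ℂ g (S.φ k w) := by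
  classical
  set P : ℂ → Prop := fun z => ∃ p : ι × ℂ, p.2 ∈ annulus r₁ b ∧ S.φ p.1 p.2 = z
  set g : ℂ → ℂ := fun z => if hz : P z then h hz.choose.1 hz.choose.2 else g₀ z with hg
  have hsub : annulus r₁ b ⊆ annulus R⁻¹ R := annulus_subset h₀.le hbR
  have hgφ : ∀ k, ∀ w ∈ annulus r₁ b, g (S.φ k w) = h k w := by
    intro k w hw
    have hP : P (S.φ k w) := ⟨(k, w), hw, rfl⟩
    have := hP.choose_spec
    obtain ⟨e1, e2⟩ := S.inj _ _ _ (hsub this.1) _ (hsub hw) this.2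
    simp only [hg, dif_pos hP]
    rw [e1, e2]
  have hgO : EqOn g g₀ O := by
    intro z hz
    by_cases hP : P z
    · obtain ⟨⟨k, w⟩, hw, rfl⟩ := hP
      have hw1 := (S.mem_iff k w (hsub hw)).1 (hOD hz)
      have hw2 : ‖w‖ < r₂ := by
        by_contra h'
        exact hO₂ k w (not_lt.1 h') hw1 hz
      rw [hgφ k w hw, hgh k w hw.1 hw2]
    · simp only [hg, dif_neg hP]
  have han : ∀ k, ∀ w ∈ annulus r₁ b, AnalyticAt ℂ g (S.φ k w) := by
    intro k w hw
    obtain ⟨hop, -, ψ, hψ, hψφ⟩ := deriv_ne_zero_and_inverse (isOpen_annulus r₁ b)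
      ((S.diff k).mono hsub) ((S.injOn k).mono hsub)
    have hmaps : MapsTo ψ (S.φ k '' annulus r₁ b) (annulus r₁ b) := by
      rintro _ ⟨w', hw', rfl⟩
      rw [hψφ w' hw']; exact hw'
    have hd : DifferentiableOn ℂ g (S.φ k '' annulus r₁ b) := by
      refine ((hh k).comp hψ hmaps).congr ?_
      rintro _ ⟨w', hw', rfl⟩
      rw [Function.comp_apply, hψφ w' hw', hgφ k w' hw']
    exact hd.analyticAt (hop.mem_nhds (mem_image_of_mem _ hw))
  refine ⟨g, hgO, hgφ, fun z hz => ?_, han⟩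
  by_cases hzO : z ∈ O
  · exact ((hg₀.congr hgO).differentiableAt (hO.mem_nhds hzO)).differentiableWithinAt
  · obtain ⟨k, w, hw₁, hw₂, rfl⟩ := hDO z hz hzO
    exact (han k w ⟨h₁₂.trans_le hw₁, hw₂.trans_le hb⟩).differentiableAt.differentiableWithinAt

end CollarSystem

end ProperApprox

/-! ### Herglotz representation and positive functionals -/

namespace ProperApprox

open Complex Metric Set Filter Topology
open scoped ComplexConjugate
open Real (circleAverage)

/-- The Herglotz representation of a holomorphic function on the unit disc. -/
theorem circleAverage_herglotz {f : ℂ → ℂ} (hf : DiffContOnCl ℂ f (ball 0 1)) {w : ℂ}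
    (hw : w ∈ ball (0 : ℂ) 1) :
    circleAverage (fun η => (f η).re • ((η + w) / (η - w))) 0 1 = f w - (f 0).im * I := by
  have hw1 : ‖w‖ < 1 := mem_ball_zero_iff.1 hw
  have hf' : DiffContOnCl ℂ f (ball 0 |1|) := by rwa [abs_one]
  have hfc : ContinuousOn f (sphere 0 1) :=
    hf.2.mono (sphere_subset_closedBall.trans_eq (closure_ball 0 one_ne_zero).symm)
  have hne : ∀ η ∈ sphere (0 : ℂ) 1, η - w ≠ 0 := by
    intro η hη h
    rw [sub_eq_zero.1 h, mem_sphere_zero_iff_norm] at hη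
    exact hw1.ne hη
  have hne' : ∀ η ∈ closedBall (0 : ℂ) 1, 1 - conj w * η ≠ 0 := by
    intro η hη h
    have h1 : ‖conj w * η‖ = 1 := by rw [← sub_eq_zero.1 h, norm_one]
    rw [norm_mul, norm_conj] at h1
    rw [mem_closedBall_zero_iff] at hη
    nlinarith [norm_nonneg w, norm_nonneg η]
  have hkc : ContinuousOn (fun η : ℂ => η / (η - w)) (sphere 0 1) :=
    continuousOn_id.div (continuousOn_id.sub continuousOn_const) hne
  have hi : ∀ g : ℂ → ℂ, ContinuousOn g (sphere 0 1) → CircleIntegrable g 0 1 := fun g hg =>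
    hg.circleIntegrable zero_le_one
  have a1 : circleAverage (fun η => (η / (η - w)) * f η) 0 1 = f w := by
    have := hf'.circleAverage_smul_div (w := w) (by rwa [abs_one])
    simpa only [sub_zero, smul_eq_mul] using this
  have a0 : circleAverage f 0 1 = f 0 := hf'.circleAverage
  have hk2 : DiffContOnCl ℂ (fun η => ((1 + conj w * η) / (1 - conj w * η)) * f η) (ball 0 1) := by
    refine DiffContOnCl.smul (𝕜' := ℂ) (DifferentiableOn.diffContOnCl ?_) hf
    rw [closure_ball 0 one_ne_zero]
    exact (by fun_prop : DifferentiableOn ℂ (fun η : ℂ => 1 + conj w * η) _).div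
      (by fun_prop) hne'
  have a2 : circleAverage (fun η => ((1 + conj w * η) / (1 - conj w * η)) * f η) 0 1 = f 0 := by
    have := DiffContOnCl.circleAverage (R := 1) (c := 0) (by rwa [abs_one])
    simpa using this
  -- On the unit circle (η + w)/(η − w) is the conjugate of (1 + w̄η)/(1 − w̄η), so this is the mean
  -- value property for a holomorphic function, conjugated.
  have a3 : circleAverage (fun η => ((η + w) / (η - w)) * conj (f η)) 0 1 = conj (f 0) := by
    have h1 := (conjCLE : ℂ →L[ℝ] ℂ).circleAverage_comp_comm (f := fun η =>
      ((1 + conj w * η) / (1 - conj w * η)) * f η) (hi _ (hk2.2.mono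
        (sphere_subset_closedBall.trans_eq (closure_ball 0 one_ne_zero).symm)))
    rw [a2] at h1
    rw [show conj (f 0) = (conjCLE : ℂ →L[ℝ] ℂ) (f 0) from rfl, ← h1]
    refine Real.circleAverage_congr_sphere fun η hη => ?_
    rw [abs_one] at hη
    have hη1 := mem_sphere_zero_iff_norm.1 hη
    have hη0 : η ≠ 0 := norm_pos_iff.1 (hη1 ▸ one_pos)
    have hc : conj η = η⁻¹ := by rw [Complex.inv_def, normSq_eq_norm_sq, hη1]; simp
    have h2 := hne η hη
    simp only [Function.comp_apply, ContinuousLinearEquiv.coe_coe, conjCLE_apply, map_mul, map_div₀,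
      map_add, map_sub, map_one, conj_conj, hc]
    congr 1
    have h3 : 1 - w * η⁻¹ = (η - w) / η := by field_simp
    have h4 : 1 + w * η⁻¹ = (η + w) / η := by field_simp
    rw [h3, h4]
    field_simp
  -- Uses Re f = (f + conj f)/2 and (η + w)/(η − w) = 2η/(η − w) − 1. The three averages are f w, f
  -- 0/2 and conj (f 0)/2.
  have e : EqOn (fun η => (f η).re • ((η + w) / (η - w)))
      (fun η => ((η / (η - w)) * f η - (1 / 2 : ℝ) • f η) +
        (1 / 2 : ℝ) • (((η + w) / (η - w)) * conj (f η))) (sphere 0 |1|) := by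
    intro η hη
    rw [abs_one] at hη
    have h2 := hne η hη
    have h3 : ((f η).re : ℂ) = (f η + conj (f η)) / 2 := by
      rw [Complex.add_conj]; push_cast; ring
    simp only [real_smul, h3]
    push_cast
    field_simp
    ring
  have c1 : ContinuousOn (fun η => (η / (η - w)) * f η) (sphere 0 1) := hkc.mul hfc
  have c2 : ContinuousOn (fun η => ((η + w) / (η - w)) * conj (f η)) (sphere 0 1) :=
    ((continuousOn_id.add continuousOn_const).div (continuousOn_id.sub continuousOn_const) hne).mul
      (continuous_conj.comp_continuousOn hfc)
  have s1 := Real.circleAverage_fun_add (hi _ (c1.sub (hfc.const_smul (1 / 2 : ℝ))))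
    (hi _ (c2.const_smul (1 / 2 : ℝ)))
  have s2 := Real.circleAverage_fun_sub (hi _ c1) (hi _ (hfc.const_smul (1 / 2 : ℝ)))
  have s3 := Real.circleAverage_fun_smul (a := (1 / 2 : ℝ)) (f := f) (c := 0) (R := 1)
  have s4 := Real.circleAverage_fun_smul (a := (1 / 2 : ℝ))
    (f := fun η => ((η + w) / (η - w)) * conj (f η)) (c := 0) (R := 1)
  refine (Real.circleAverage_congr_sphere e).trans (s1.trans ?_)
  refine (congrArg₂ (· + ·) (s2.trans (congrArg₂ (· - ·) a1 s3)) s4).trans ?_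
  rw [a0, a3]
  apply Complex.ext <;> simp
  · ring

/-- Extension by zero of a function on a circle centred at the origin. -/
noncomputable def sphereExt {E : Type*} [Zero E] {r : ℝ} (Q : sphere (0 : ℂ) r → E) (w : ℂ) : E :=
  open Classical in if h : w ∈ sphere (0 : ℂ) r then Q ⟨w, h⟩ else 0

theorem sphereExt_of_mem {E : Type*} [Zero E] {r : ℝ} (Q : sphere (0 : ℂ) r → E) {w : ℂ}
    (h : w ∈ sphere (0 : ℂ) r) : sphereExt Q w = Q ⟨w, h⟩ := dif_pos h

theorem continuousOn_sphereExt {E : Type*} [Zero E] [TopologicalSpace E] {r : ℝ}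
    {Q : sphere (0 : ℂ) r → E} (hQ : Continuous Q) : ContinuousOn (sphereExt Q) (sphere 0 r) := by
  rw [continuousOn_iff_continuous_domRestrict]
  convert hQ using 1
  ext w
  exact sphereExt_of_mem Q w.2

/-- The restriction to a circle of a function that is continuous there. -/
def sphereRes {r : ℝ} (f : ℂ → ℂ) (hf : ContinuousOn f (sphere 0 r)) : C(sphere (0 : ℂ) r, ℂ) :=
  ⟨fun w => f w, continuousOn_iff_continuous_domRestrict.1 hf⟩

@[simp]
theorem sphereRes_apply {r : ℝ} (f : ℂ → ℂ) (hf : ContinuousOn f (sphere 0 r))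
    (w : sphere (0 : ℂ) r) : sphereRes f hf w = f w := rfl

theorem sub_ne_zero_of_sphere {ρ : ℝ} (hρ1 : ρ < 1) (p : sphere (0 : ℂ) 1 × sphere (0 : ℂ) ρ) :
    (p.1 : ℂ) - p.2 ≠ 0 := by
  intro h
  have h1 := mem_sphere_zero_iff_norm.1 p.1.2
  rw [sub_eq_zero.1 h, mem_sphere_zero_iff_norm.1 p.2.2] at h1
  exact hρ1.ne h1

/-- The Herglotz kernels `(η + w) / (η - w)`, as functions of `w` on the circle of radius `ρ`. -/
noncomputable def herglotzMap {ρ : ℝ} (hρ1 : ρ < 1) : C(sphere (0 : ℂ) 1, C(sphere (0 : ℂ) ρ, ℂ)) :=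
  ContinuousMap.curry ⟨fun p => ((p.1 : ℂ) + p.2) / ((p.1 : ℂ) - p.2), by
    refine Continuous.div (by fun_prop) (by fun_prop) (sub_ne_zero_of_sphere hρ1)⟩

/-- The Herglotz formula is read as an average of vectors of C(sphere) with weights Re f ≥ c. A
continuous functional commutes with the average and is non-negative on the kernels. -/
theorem le_apply_sphereRes_of_diffContOnCl {ρ : ℝ} (hρ1 : ρ < 1) (L : C(sphere (0 : ℂ) ρ, ℂ) →L[ℝ] ℝ)
    (hL : ∀ η, 0 ≤ L (herglotzMap hρ1 η)) {f : ℂ → ℂ} (hf : DiffContOnCl ℂ f (ball 0 1))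
    (hf0 : (f 0).im = 0) {c : ℝ} (hc : ∀ w ∈ sphere (0 : ℂ) 1, c ≤ (f w).re)
    (hfρ : ContinuousOn f (sphere 0 ρ)) :
    c * circleAverage (fun η => L (sphereExt (herglotzMap hρ1) η)) 0 1 ≤ L (sphereRes f hfρ) := by
  have hfc : ContinuousOn f (sphere 0 1) :=
    hf.2.mono (sphere_subset_closedBall.trans_eq (closure_ball 0 one_ne_zero).symm)
  have hE := continuousOn_sphereExt (herglotzMap hρ1).continuous
  have hK : ContinuousOn (fun η => (f η).re • sphereExt (herglotzMap hρ1) η) (sphere 0 1) :=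
    (continuous_re.comp_continuousOn hfc).smul hE
  have hKi := hK.circleIntegrable zero_le_one
  have key : circleAverage (fun η => (f η).re • sphereExt (herglotzMap hρ1) η) 0 1 =
      sphereRes f hfρ := by
    ext w
    have h1 := (ContinuousMap.evalCLM ℝ w).circleAverage_comp_comm hKi
    have hw : (w : ℂ) ∈ ball (0 : ℂ) 1 := by
      rw [mem_ball_zero_iff, mem_sphere_zero_iff_norm.1 w.2]; exact hρ1
    have h2 := circleAverage_herglotz hf hw
    rw [hf0] at h2
    rw [ContinuousMap.evalCLM_apply] at h1
    rw [← h1]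
    have h3 : f w = sphereRes f hfρ w := rfl
    rw [← h3]
    rw [ofReal_zero, zero_mul, sub_zero] at h2
    rw [← h2]
    refine Real.circleAverage_congr_sphere fun η hη => ?_
    rw [abs_one] at hη
    simp only [Function.comp_apply, sphereExt_of_mem _ hη]
    rfl
  rw [← key, ← L.circleAverage_comp_comm hKi, ← smul_eq_mul, ← Real.circleAverage_fun_smul]
  have hLE : ContinuousOn (fun η => L (sphereExt (herglotzMap hρ1) η)) (sphere 0 1) :=
    L.continuous.comp_continuousOn hE
  refine Real.circleAverage_mono ((hLE.const_smul c).circleIntegrable zero_le_one)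
    ((L.continuous.comp_continuousOn hK).circleIntegrable zero_le_one) fun η hη => ?_
  rw [abs_one] at hη
  simp only [Function.comp_apply, map_smul, smul_eq_mul]
  refine mul_le_mul_of_nonneg_right (hc η hη) ?_
  rw [sphereExt_of_mem _ hη]
  exact hL _

/-- Without boundary values for f, apply the previous inequality to the dilations f(τ·) and let τ →
1; on the circle of radius ρ they converge uniformly. -/
theorem le_apply_sphereRes {ρ : ℝ} (hρ0 : 0 < ρ) (hρ1 : ρ < 1)
    (L : C(sphere (0 : ℂ) ρ, ℂ) →L[ℝ] ℝ)
    (hL : ∀ η, 0 ≤ L (herglotzMap hρ1 η)) {f : ℂ → ℂ} (hf : DifferentiableOn ℂ f (ball 0 1))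
    (hf0 : (f 0).im = 0) {c : ℝ} (hc : ∀ w ∈ ball (0 : ℂ) 1, c ≤ (f w).re)
    (hfρ : ContinuousOn f (sphere 0 ρ)) :
    c * circleAverage (fun η => L (sphereExt (herglotzMap hρ1) η)) 0 1 ≤ L (sphereRes f hfρ) := by
  set a := c * circleAverage (fun η => L (sphereExt (herglotzMap hρ1) η)) 0 1 with ha
  have hmem : ∀ p : Icc (0 : ℝ) 1 × sphere (0 : ℂ) ρ, ((p.1 : ℝ) : ℂ) * p.2 ∈ ball (0 : ℂ) 1 := by
    intro p
    rw [mem_ball_zero_iff, norm_mul, norm_real, Real.norm_of_nonneg p.1.2.1,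
      mem_sphere_zero_iff_norm.1 p.2.2]
    nlinarith [p.1.2.1, p.1.2.2]
  let T : C(Icc (0 : ℝ) 1, C(sphere (0 : ℂ) ρ, ℂ)) := ContinuousMap.curry
    ⟨fun p => f (((p.1 : ℝ) : ℂ) * p.2), hf.continuousOn.comp_continuous (by fun_prop) hmem⟩
  have hm : Continuous fun τ : ℝ => L (T (projIcc 0 1 zero_le_one τ)) :=
    L.continuous.comp (T.continuous.comp continuous_projIcc)
  have h1 : L (T (projIcc 0 1 zero_le_one 1)) = L (sphereRes f hfρ) := by
    congr 1
    ext w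
    simp [T, projIcc_right]
  rw [← h1]
  refine ge_of_tendsto (hm.continuousAt.tendsto.mono_left (nhdsWithin_le_nhds (s := Iio 1))) ?_
  filter_upwards [Ioo_mem_nhdsLT (zero_lt_one' ℝ)] with τ hτ
  have hmaps : MapsTo (fun w : ℂ => (τ : ℂ) * w) (closedBall 0 1) (ball 0 1) := by
    intro w hw
    rw [mem_closedBall_zero_iff] at hw
    rw [mem_ball_zero_iff, norm_mul, norm_real, Real.norm_of_nonneg hτ.1.le]
    nlinarith [hτ.1, hτ.2, norm_nonneg w]
  have hd : DifferentiableOn ℂ (fun w : ℂ => f (τ * w)) (closedBall 0 1) :=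
    hf.comp (by fun_prop) hmaps
  have hsub : sphere (0 : ℂ) ρ ⊆ closedBall 0 1 := fun w hw => by
    rw [mem_sphere_zero_iff_norm] at hw
    rw [mem_closedBall_zero_iff, hw]; exact hρ1.le
  have := le_apply_sphereRes_of_diffContOnCl hρ1 L hL (f := fun w => f (τ * w))
    (DifferentiableOn.diffContOnCl (by rwa [closure_ball 0 one_ne_zero])) (by simpa using hf0)
    (fun w hw => hc _ (hmaps (sphere_subset_closedBall hw))) (hd.continuousOn.mono hsub)
  refine this.trans_eq ?_
  congr 1
  ext w
  simp [T, projIcc_of_mem zero_le_one (show τ ∈ Icc 0 1 from ⟨hτ.1.le, hτ.2.le⟩)]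

theorem circleAverage_nonneg_and_eq_zero {g : ℂ → ℝ} (hg : ContinuousOn g (sphere 0 1))
    (h0 : ∀ η ∈ sphere (0 : ℂ) 1, 0 ≤ g η) :
    0 ≤ circleAverage g 0 1 ∧ (circleAverage g 0 1 = 0 → ∀ η ∈ sphere (0 : ℂ) 1, g η = 0) := by
  have hm : ∀ θ, circleMap 0 1 θ ∈ sphere (0 : ℂ) 1 := fun θ => circleMap_mem_sphere 0 zero_le_one θ
  refine ⟨Real.circleAverage_nonneg_of_nonneg (by rwa [abs_one]), fun h η hη => ?_⟩
  by_contra hne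
  have hpos : 0 < g η := lt_of_le_of_ne (h0 η hη) (Ne.symm hne)
  have hcont : Continuous fun θ : ℝ => g (circleMap 0 1 θ) :=
    hg.comp_continuous (continuous_circleMap 0 1) hm
  obtain ⟨θ, hθ, rfl⟩ : ∃ θ ∈ Ioc (0 : ℝ) (2 * Real.pi), circleMap 0 1 θ = η := by
    have := image_circleMap_Ioc 0 (1 : ℝ)
    rw [abs_one] at this
    rw [← this] at hη
    exact hη
  have hint : 0 < ∫ θ in (0 : ℝ)..2 * Real.pi, g (circleMap 0 1 θ) :=
    intervalIntegral.integral_pos Real.two_pi_pos hcont.continuousOn (fun θ _ => h0 _ (hm θ))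
      ⟨θ, ⟨hθ.1.le, hθ.2⟩, hpos⟩
  rw [Real.circleAverage_def, smul_eq_mul] at h
  have : 0 < (2 * Real.pi)⁻¹ := inv_pos.2 Real.two_pi_pos
  exact (mul_pos this hint).ne' h

/-- A functional that is non-negative on the Herglotz kernels is non-negative on families of
functions with positive real part, and vanishes on such a family only if it kills the kernels. -/
theorem apply_nonneg_of_herglotz {ι : Type} [Fintype ι] [DecidableEq ι] {ρ : ℝ} (hρ0 : 0 < ρ)
    (hρ1 : ρ < 1) (l : (ι → C(sphere (0 : ℂ) ρ, ℂ)) →L[ℝ] ℝ)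
    (hl : ∀ p : ι × sphere (0 : ℂ) 1, 0 ≤ l (Pi.single p.1 (herglotzMap hρ1 p.2)))
    {W : ι → ℂ → ℂ} (hW : ∀ k, DifferentiableOn ℂ (W k) (ball 0 1)) (hW0 : ∀ k, (W k 0).im = 0)
    {c : ℝ} (hc0 : 0 < c) (hc : ∀ k, ∀ w ∈ ball (0 : ℂ) 1, c ≤ (W k w).re)
    (hWρ : ∀ k, ContinuousOn (W k) (sphere 0 ρ)) :
    0 ≤ l (fun k => sphereRes (W k) (hWρ k)) ∧
      (l (fun k => sphereRes (W k) (hWρ k)) = 0 →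
        ∀ p : ι × sphere (0 : ℂ) 1, l (Pi.single p.1 (herglotzMap hρ1 p.2)) = 0) := by
  set L : ι → C(sphere (0 : ℂ) ρ, ℂ) →L[ℝ] ℝ := fun k =>
    l.comp (ContinuousLinearMap.single ℝ (fun _ : ι => C(sphere (0 : ℂ) ρ, ℂ)) k) with hL
  have hLa : ∀ k x, L k x = l (Pi.single k x) := fun k x => rfl
  have hsum : l (fun k => sphereRes (W k) (hWρ k)) = ∑ k, L k (sphereRes (W k) (hWρ k)) := by
    simp only [hLa]
    rw [← map_sum, Finset.univ_sum_single]
  set A : ι → ℝ := fun k => circleAverage (fun η => L k (sphereExt (herglotzMap hρ1) η)) 0 1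
  have hA : ∀ k, 0 ≤ A k ∧ (A k = 0 → ∀ η ∈ sphere (0 : ℂ) 1,
      L k (sphereExt (herglotzMap hρ1) η) = 0) := fun k =>
    circleAverage_nonneg_and_eq_zero ((L k).continuous.comp_continuousOn
      (continuousOn_sphereExt (herglotzMap hρ1).continuous)) fun η hη => by
        rw [sphereExt_of_mem _ hη]
        exact hl (k, ⟨η, hη⟩)
  -- This quantitative bound gives the equality case: if the sum vanishes, each average A k of a
  -- non-negative continuous function vanishes, so the function does.
  have hle : ∀ k, c * A k ≤ L k (sphereRes (W k) (hWρ k)) := fun k =>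
    le_apply_sphereRes hρ0 hρ1 (L k) (fun η => hl (k, η)) (hW k) (hW0 k) (hc k) (hWρ k)
  have hnn : ∀ k, 0 ≤ L k (sphereRes (W k) (hWρ k)) := fun k =>
    (mul_nonneg hc0.le (hA k).1).trans (hle k)
  rw [hsum]
  refine ⟨Finset.sum_nonneg fun k _ => hnn k, fun h p => ?_⟩
  have h1 := (Finset.sum_eq_zero_iff_of_nonneg fun k _ => hnn k).1 h p.1 (Finset.mem_univ _)
  have h2 : A p.1 = 0 := by
    have := hle p.1
    rw [h1] at this
    exact le_antisymm (nonpos_of_mul_nonpos_right this hc0) (hA p.1).1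
  have := (hA p.1).2 h2 p.2 p.2.2
  rwa [sphereExt_of_mem _ p.2.2] at this

end ProperApprox

/-! ### The reflection operator -/

namespace ProperApprox

open Complex Metric Set Filter Topology
open scoped ComplexConjugate

theorem coef_congr {s : ℝ} (hs : 0 ≤ s) {v v' : ℂ → ℂ} (h : EqOn v v' (sphere 0 s)) (n : ℕ) :
    coef s v n = coef s v' n := by
  rw [coef, coef]
  congr 1
  exact circleIntegral.integral_congr hs fun η hη => by simp only [h hη]

theorem inv_mem_sphere {s : ℝ} {η : ℂ} (hη : η ∈ sphere (0 : ℂ) s) : η⁻¹ ∈ sphere (0 : ℂ) s⁻¹ := by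
  rw [mem_sphere_zero_iff_norm] at hη ⊢
  rw [norm_inv, hη]

theorem reflectCoef_congr {s : ℝ} (hs : 0 ≤ s) {v v' : ℂ → ℂ} (h : EqOn v v' (sphere 0 s))
    (h' : EqOn v v' (sphere 0 s⁻¹)) (n : ℕ) : reflectCoef s v n = reflectCoef s v' n := by
  rw [reflectCoef, reflectCoef, coef_congr hs h,
    coef_congr hs (v := fun ξ => v ξ⁻¹) (v' := fun ξ => v' ξ⁻¹) fun η hη => h' (inv_mem_sphere hη)]

theorem reflectCoef_add {s : ℝ} (hs : 0 < s) {v v' : ℂ → ℂ} (hv : ContinuousOn v (sphere 0 s))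
    (hv' : ContinuousOn v' (sphere 0 s)) (hvi : ContinuousOn v (sphere 0 s⁻¹))
    (hvi' : ContinuousOn v' (sphere 0 s⁻¹)) (n : ℕ) :
    reflectCoef s (fun η => v η + v' η) n = reflectCoef s v n + reflectCoef s v' n := by
  rw [reflectCoef, reflectCoef, reflectCoef, coef_add hs hv hv',
    coef_add hs (continuousOn_comp_inv_sphere hs hvi) (continuousOn_comp_inv_sphere hs hvi')]
  split_ifs
  · ring
  · rw [map_add]; ring

theorem reflectCoef_real_mul (s c : ℝ) (v : ℂ → ℂ) (n : ℕ) :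
    reflectCoef s (fun η => (c : ℂ) * v η) n = c * reflectCoef s v n := by
  rw [reflectCoef, reflectCoef, coef_smul, coef_smul s c (fun ξ => v ξ⁻¹)]
  split_ifs
  · ring
  · rw [map_mul, conj_ofReal]; ring

/-- Families of continuous functions on the circle of radius `ρ`. -/
abbrev CircleData (ι : Type) (ρ : ℝ) : Type := ι → C(sphere (0 : ℂ) ρ, ℂ)

namespace CollarSystem

variable {D : Set ℂ} {ι : Type} {R : ℝ} (S : CollarSystem D ι R)

theorem notMem_image_sphere {r : ℝ} (h₁ : R⁻¹ < r) (h₂ : r < R) {k : ι} {w : ℂ}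
    (hw : w ∈ annulus R⁻¹ R) (hwr : ‖w‖ ≠ r) (l : ι) : S.φ k w ∉ S.φ l '' sphere 0 r := by
  rintro ⟨w', hw', h⟩
  have := (S.inj l k w' (sphere_subset_annulus h₁ h₂ hw') w hw h).2
  rw [← this] at hwr
  exact hwr (mem_sphere_zero_iff_norm.1 hw')

variable [Fintype ι]

/-- The transform `J` of data on the circles of radius `ρ`, read in the `k`-th collar. -/
noncomputable def pullJ (ρ : ℝ) (q : CircleData ι ρ) (k : ι) (w : ℂ) : ℂ :=
  S.J ρ (fun l => sphereExt (q l)) (S.φ k w)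

theorem differentiableOn_J_comp {r : ℝ} (h₁ : R⁻¹ < r) (h₂ : r < R) {W : ι → ℂ → ℂ}
    (hW : ∀ k, ContinuousOn (W k) (sphere 0 r)) (k : ι) :
    DifferentiableOn ℂ (fun w => S.J r W (S.φ k w)) (annulus r R) := by
  intro w hw
  have hw' : w ∈ annulus R⁻¹ R := ⟨h₁.trans hw.1, hw.2⟩
  have hd := S.differentiableAt_J h₁ h₂ hW (S.notMem_image_sphere (k := k) h₁ h₂ hw' hw.1.ne')
  exact (hd.comp w ((S.diff k).differentiableAt
    ((isOpen_annulus _ _).mem_nhds hw'))).differentiableWithinAt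

theorem differentiableOn_pullJ {ρ : ℝ} (h₁ : R⁻¹ < ρ) (h₂ : ρ < R)
    (q : CircleData ι ρ) (k : ι) :
    DifferentiableOn ℂ (S.pullJ ρ q k) (annulus ρ R) :=
  S.differentiableOn_J_comp h₁ h₂ (fun l => continuousOn_sphereExt (q l).continuous) k

theorem pullJ_add {ρ : ℝ} (h₁ : R⁻¹ < ρ) (h₂ : ρ < R) (q q' : CircleData ι ρ) (k : ι)
    {w : ℂ} (hw : w ∈ annulus ρ R) :
    S.pullJ ρ (q + q') k w = S.pullJ ρ q k w + S.pullJ ρ q' k w := by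
  rw [pullJ, pullJ, pullJ, ← S.J_add h₁ h₂ (fun l => continuousOn_sphereExt (q l).continuous)
    (fun l => continuousOn_sphereExt (q' l).continuous)
    (S.notMem_image_sphere h₁ h₂ ⟨h₁.trans hw.1, hw.2⟩ hw.1.ne')]
  refine S.J_congr (S.inv_pos.trans h₁).le (fun l η hη => ?_) _
  simp only [sphereExt_of_mem _ hη]
  rfl

theorem pullJ_smul {ρ : ℝ} (hρ : 0 ≤ ρ) (c : ℝ) (q : CircleData ι ρ) (k : ι) (w : ℂ) :
    S.pullJ ρ (c • q) k w = c * S.pullJ ρ q k w := by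
  rw [pullJ, pullJ, ← S.J_const_mul]
  refine S.J_congr hρ (fun l η hη => ?_) _
  simp only [sphereExt_of_mem _ hη]
  simp

theorem exists_norm_pullJ_le {ρ s : ℝ} (h₁ : R⁻¹ < ρ) (hρs : ρ < s⁻¹) (hs : 1 < s) (hsR : s < R) :
    ∃ C, 0 ≤ C ∧ ∀ (q : CircleData ι ρ) (k : ι),
      ∀ w ∈ sphere (0 : ℂ) s ∪ sphere 0 s⁻¹, ‖S.pullJ ρ q k w‖ ≤ C * ‖q‖ := by
  have hs1 : s⁻¹ < 1 := inv_lt_one_of_one_lt₀ hs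
  have hρR : ρ < R := hρs.trans (hs1.trans (hs.trans hsR))
  have hA : ∀ w ∈ sphere (0 : ℂ) s ∪ sphere 0 s⁻¹, w ∈ annulus ρ R := by
    rintro w (hw | hw)
    · exact sphere_subset_annulus (hρs.trans (hs1.trans hs)) hsR hw
    · exact sphere_subset_annulus hρs (hs1.trans (hs.trans hsR)) hw
  have hA' : ∀ w ∈ sphere (0 : ℂ) s ∪ sphere 0 s⁻¹, w ∈ annulus R⁻¹ R := fun w hw =>
    annulus_subset h₁.le le_rfl (hA w hw)
  have hK : IsCompact (⋃ k, S.φ k '' (sphere (0 : ℂ) s ∪ sphere 0 s⁻¹)) :=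
    isCompact_iUnion fun k => ((isCompact_sphere _ _).union (isCompact_sphere _ _)).image_of_continuousOn
      ((S.diff k).continuousOn.mono hA')
  obtain ⟨C, hC0, hC⟩ := S.exists_norm_J_le h₁ hρR hK (fun l η hη h => by
    obtain ⟨k, w, hw, e⟩ := mem_iUnion.1 h
    exact S.notMem_image_sphere h₁ hρR (hA' w hw) (hA w hw).1.ne' l ⟨η, hη, e.symm⟩)
  refine ⟨C, hC0, fun q k w hw => hC _ ‖q‖ (fun l η hη => ?_) _
    (mem_iUnion.2 ⟨k, mem_image_of_mem _ hw⟩)⟩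
  rw [sphereExt_of_mem _ hη]
  exact ((q l).norm_coe_le_norm _).trans (norm_le_pi_norm q l)

/-- The operator sending boundary data `q` to the holomorphic functions on the disc whose real parts
on the unit circle are those of `pullJ ρ q`; it is a norm limit of operators of finite rank. -/
theorem exists_reflect_operator {ρ s : ℝ} (h₁ : R⁻¹ < ρ) (hρs : ρ < s⁻¹) (hs : 1 < s) (hsR : s < R) :
    ∃ M : CircleData ι ρ →L[ℝ] CircleData ι ρ,
      (∀ q k (w : sphere (0 : ℂ) ρ), M q k w = reflectPart s (S.pullJ ρ q k) w) ∧
      IsClosed (LinearMap.range ((1 + M : CircleData ι ρ →L[ℝ] CircleData ι ρ) :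
        CircleData ι ρ →ₗ[ℝ] CircleData ι ρ) : Set (CircleData ι ρ)) ∧
      (LinearMap.range ((1 + M : CircleData ι ρ →L[ℝ] CircleData ι ρ) :
        CircleData ι ρ →ₗ[ℝ] CircleData ι ρ)).CoFG := by
  have hs0 : 0 < s := one_pos.trans hs
  have hs1 : s⁻¹ < 1 := inv_lt_one_of_one_lt₀ hs
  have hρ0 : 0 < ρ := S.inv_pos.trans h₁
  have hρ1 : ρ < 1 := hρs.trans hs1
  have hρR : ρ < R := hρ1.trans S.one_lt
  have hsub : sphere (0 : ℂ) s ⊆ annulus ρ R := sphere_subset_annulus (hρ1.trans hs) hsR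
  have hsub' : sphere (0 : ℂ) s⁻¹ ⊆ annulus ρ R := sphere_subset_annulus hρs (hs1.trans S.one_lt)
  have hc : ∀ q k, ContinuousOn (S.pullJ ρ q k) (sphere 0 s) := fun q k =>
    (S.differentiableOn_pullJ h₁ hρR q k).continuousOn.mono hsub
  have hc' : ∀ q k, ContinuousOn (S.pullJ ρ q k) (sphere 0 s⁻¹) := fun q k =>
    (S.differentiableOn_pullJ h₁ hρR q k).continuousOn.mono hsub'
  obtain ⟨C, hC0, hC⟩ := S.exists_norm_pullJ_le h₁ hρs hs hsR
  set pw : ℕ → C(sphere (0 : ℂ) ρ, ℂ) := fun n => sphereRes (fun w => w ^ n) (by fun_prop) with hpw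
  have hpwn : ∀ n, ‖pw n‖ ≤ ρ ^ n := fun n => by
    rw [ContinuousMap.norm_le _ (by positivity)]
    intro w
    rw [hpw, sphereRes_apply, norm_pow, mem_sphere_zero_iff_norm.1 w.2]
  -- Only real-linear, because reflection conjugates coefficients; this is why the functional
  -- analysis is over ℝ.
  let A : ℕ → CircleData ι ρ →ₗ[ℝ] (ι → ℂ) := fun n =>
    { toFun := fun q k => reflectCoef s (S.pullJ ρ q k) n
      map_add' := fun q q' => by
        ext k
        rw [Pi.add_apply, ← reflectCoef_add hs0 (hc q k) (hc q' k) (hc' q k) (hc' q' k)]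
        exact reflectCoef_congr hs0.le (fun w hw => S.pullJ_add h₁ hρR q q' k (hsub hw))
          (fun w hw => S.pullJ_add h₁ hρR q q' k (hsub' hw)) n
      map_smul' := fun c q => by
        ext k
        rw [Pi.smul_apply, real_smul, RingHom.id_apply, ← reflectCoef_real_mul]
        exact reflectCoef_congr hs0.le (fun w _ => S.pullJ_smul hρ0.le c q k w)
          (fun w _ => S.pullJ_smul hρ0.le c q k w) n }
  let Φ : ℕ → (ι → ℂ) →ₗ[ℝ] CircleData ι ρ := fun n =>
    { toFun := fun a k => a k • pw n
      map_add' := fun a a' => by ext k; simp [add_mul]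
      map_smul' := fun c a => by ext k; simp [mul_assoc] }
  have hb : ∀ n q, ‖(Φ n ∘ₗ A n) q‖ ≤ 2 * C * (s⁻¹ * ρ) ^ n * ‖q‖ := by
    intro n q
    rw [pi_norm_le_iff_of_nonneg (by positivity)]
    intro k
    have h2 := norm_reflectCoef_le hs0 (fun η hη => hC q k η (Or.inl hη))
      (fun η hη => hC q k η (Or.inr hη)) n
    calc ‖reflectCoef s (S.pullJ ρ q k) n • pw n‖
        = ‖reflectCoef s (S.pullJ ρ q k) n‖ * ‖pw n‖ := norm_smul _ _
      _ ≤ (2 * (C * ‖q‖) * s⁻¹ ^ n) * ρ ^ n := by gcongr; exact hpwn n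
      _ = _ := by rw [mul_pow]; ring
  let T : ℕ → CircleData ι ρ →L[ℝ] CircleData ι ρ := fun n =>
    (Φ n ∘ₗ A n).mkContinuous _ (hb n)
  have hTn : ∀ n, ‖T n‖ ≤ 2 * C * (s⁻¹ * ρ) ^ n := fun n =>
    LinearMap.mkContinuous_norm_le _ (by positivity) _
  -- Coefficients decay like s⁻ⁿ and wⁿ has size ρⁿ on the circle of radius ρ, so the operators T n
  -- are summable in norm.
  have hlt : s⁻¹ * ρ < 1 := by nlinarith [_root_.inv_pos.2 hs0]
  have hTs : Summable T := Summable.of_norm_bounded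
    ((summable_geometric_of_lt_one (by positivity) hlt).mul_left (2 * C)) hTn
  obtain ⟨M, hM⟩ := hTs
  refine ⟨M, fun q k w => ?_, ?_⟩
  · have h2 := hM.mapL (ContinuousLinearMap.apply ℝ (CircleData ι ρ) q)
    have h3 := h2.mapL (ContinuousLinearMap.proj (R := ℝ) (φ := fun _ : ι => C(sphere (0 : ℂ) ρ, ℂ)) k)
    have h4 := h3.mapL (ContinuousMap.evalCLM ℝ w)
    have h5 := hasSum_reflectCoef hs0 (hc q k) (hc' q k) (w := w) (by
      rw [mem_sphere_zero_iff_norm.1 w.2]; exact hρ1.trans hs)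
    exact h4.unique h5
  · obtain ⟨N, hN⟩ := (Metric.tendsto_atTop.1 hM.tendsto_sum_nat 1 one_pos)
    have hN' := hN N le_rfl
    rw [dist_comm, dist_eq_norm] at hN'
    refine isClosed_range_one_add_and_cofg M (∑ n ∈ Finset.range N, T n) ?_ hN'
    -- A partial sum takes its values in the span of finitely many powers of w in each component,
    -- hence has finite rank.
    have hle : LinearMap.range ((∑ n ∈ Finset.range N, T n :
        CircleData ι ρ →L[ℝ] CircleData ι ρ) :
        CircleData ι ρ →ₗ[ℝ] CircleData ι ρ) ≤
        (Finset.range N).sup fun n => LinearMap.range (Φ n) := by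
      rintro _ ⟨q, rfl⟩
      rw [ContinuousLinearMap.coe_coe, sum_apply]
      exact Submodule.sum_mem _ fun n hn =>
        (Finset.le_sup (f := fun n => LinearMap.range (Φ n)) hn) ⟨A n q, rfl⟩
    exact Submodule.finiteDimensional_of_le hle

end CollarSystem

end ProperApprox

/-! ### Finite Herglotz sums solving the boundary problem -/

namespace ProperApprox

open Complex Metric Set Filter Topology
open scoped NNReal

/-- A finite combination of Herglotz kernels. -/
noncomputable def herglotzSum (T : Finset ℂ) (c : ℂ → ℝ) (w : ℂ) : ℂ :=
  ∑ η ∈ T, (c η : ℂ) * ((η + w) / (η - w))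

theorem differentiableAt_herglotzSum {T : Finset ℂ} {c : ℂ → ℝ} {w : ℂ} (hw : w ∉ T) :
    DifferentiableAt ℂ (herglotzSum T c) w := by
  have : herglotzSum T c = fun w => ∑ η ∈ T, (c η : ℂ) * ((η + w) / (η - w)) := rfl
  rw [this]
  refine DifferentiableAt.fun_sum fun η hη => ?_
  have : η - w ≠ 0 := sub_ne_zero.2 fun h => hw (h ▸ hη)
  exact (DifferentiableAt.div (by fun_prop) (by fun_prop) this).const_mul _

theorem re_herglotz {η w : ℂ} (hη : ‖η‖ = 1) :
    ((η + w) / (η - w)).re = (1 - ‖w‖ ^ 2) / ‖η - w‖ ^ 2 := by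
  have h := congrFun (poissonKernel_eq_re_herglotzRieszKernel (c := 0) (w := w)) η
  simp only [poissonKernel_def, Function.comp_apply, herglotzRieszKernel_def, sub_zero, hη] at h
  rw [← h, one_pow]

theorem re_herglotzSum (T : Finset ℂ) (c : ℂ → ℝ) (w : ℂ) :
    (herglotzSum T c w).re = ∑ η ∈ T, c η * ((η + w) / (η - w)).re := by
  rw [herglotzSum, Complex.re_sum]
  exact Finset.sum_congr rfl fun η _ => by rw [Complex.re_ofReal_mul]

theorem re_herglotzSum_nonneg {T : Finset ℂ} {c : ℂ → ℝ} (h : ∀ η ∈ T, ‖η‖ = 1 ∧ 0 < c η) {w : ℂ}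
    (hw : ‖w‖ ≤ 1) : 0 ≤ (herglotzSum T c w).re := by
  rw [re_herglotzSum]
  refine Finset.sum_nonneg fun η hη => mul_nonneg (h η hη).2.le ?_
  rw [re_herglotz (h η hη).1]
  have : ‖w‖ ^ 2 ≤ 1 := by nlinarith [norm_nonneg w]
  exact div_nonneg (by linarith) (by positivity)

theorem re_herglotzSum_eq_zero {T : Finset ℂ} {c : ℂ → ℝ} (h : ∀ η ∈ T, ‖η‖ = 1 ∧ 0 < c η) {w : ℂ}
    (hw : ‖w‖ = 1) : (herglotzSum T c w).re = 0 := by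
  rw [re_herglotzSum]
  refine Finset.sum_eq_zero fun η hη => ?_
  rw [re_herglotz (h η hη).1, hw]
  simp

theorem exists_herglotzSum_of_mem_span {ι : Type} [DecidableEq ι] {ρ : ℝ} (hρ1 : ρ < 1)
    {u : CircleData ι ρ} (hu : u ∈ Submodule.span ℝ≥0 (range fun p : ι × sphere (0 : ℂ) 1 =>
      (Pi.single p.1 (herglotzMap hρ1 p.2) : CircleData ι ρ))) :
    ∃ (T : ι → Finset ℂ) (c : ι → ℂ → ℝ), (∀ k, ∀ η ∈ T k, ‖η‖ = 1 ∧ 0 < c k η) ∧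
      ∀ k (w : sphere (0 : ℂ) ρ), u k w = herglotzSum (T k) (c k) w := by
  classical
  obtain ⟨a, rfl⟩ := Finsupp.mem_span_range_iff_exists_finsupp.1 hu
  refine ⟨fun k => (a.support.filter fun p => p.1 = k).image fun p => (p.2 : ℂ),
    fun k => sphereExt fun η => (a (k, η) : ℝ), fun k η hη => ?_, fun k w => ?_⟩
  · obtain ⟨⟨l, η⟩, hp, rfl⟩ := Finset.mem_image.1 hη
    obtain ⟨hp', rfl⟩ := Finset.mem_filter.1 hp
    refine ⟨mem_sphere_zero_iff_norm.1 η.2, ?_⟩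
    have e : sphereExt (fun η' => (a (l, η') : ℝ)) (η : ℂ) = a (l, η) := sphereExt_of_mem _ η.2
    show 0 < sphereExt (fun η' => (a (l, η') : ℝ)) (η : ℂ)
    rw [e]
    have := Finsupp.mem_support_iff.1 hp'
    exact NNReal.coe_pos.2 (pos_iff_ne_zero.2 this)
  · rw [herglotzSum, Finset.sum_image, Finset.sum_filter, Finsupp.sum, Finset.sum_apply,
      ContinuousMap.sum_apply]
    · refine Finset.sum_congr rfl fun p _ => ?_
      obtain ⟨l, η⟩ := p
      split_ifs with h
      · simp only at h
        subst h
        have e : sphereExt (fun η' => (a (l, η') : ℝ)) (η : ℂ) = a (l, η) :=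
          sphereExt_of_mem _ η.2
        show (a (l, η) • (Pi.single l (herglotzMap hρ1 η) : CircleData ι ρ)) l w =
          ((sphereExt (fun η' => (a (l, η') : ℝ)) (η : ℂ) : ℝ) : ℂ) * ((η + w) / (η - w))
        rw [e, Pi.smul_apply, Pi.single_eq_same]
        rfl
      · rw [Pi.smul_apply, Pi.single_eq_of_ne (Ne.symm h)]
        simp
    · rintro ⟨l, η⟩ hp ⟨l', η'⟩ hp' h
      obtain ⟨-, rfl⟩ := Finset.mem_filter.1 hp
      obtain ⟨-, h'⟩ := Finset.mem_filter.1 hp'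
      exact Prod.ext h'.symm (Subtype.ext h)

namespace CollarSystem

variable {D : Set ℂ} {ι : Type} {R : ℝ} (S : CollarSystem D ι R) [Fintype ι]

/-- Solves the Fredholm equation by `exists_hull_solution`. The relation for Re Y cancels the real
part of the Cauchy transform on the boundary, and q is only claimed small on |w| = ρ because the
Cauchy transform uses no other values. -/
theorem exists_herglotz_data {ρ s : ℝ} (h₁ : R⁻¹ < ρ) (hρs : ρ < s⁻¹) (hs : 1 < s) (hsR : s < R)
    {W : ι → ℂ → ℂ} (hW : ∀ k, DifferentiableOn ℂ (W k) (ball 0 1)) (hW0 : ∀ k, (W k 0).im = 0)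
    {m : ℝ} (hm0 : 0 < m) (hm : ∀ k, ∀ w ∈ ball (0 : ℂ) 1, m ≤ (W k w).re) {ε : ℝ} (hε : 0 < ε) :
    ∃ (T : ι → Finset ℂ) (c : ι → ℂ → ℝ) (Y q : ι → ℂ → ℂ) (t : ℝ), |t| ≤ ε ∧
      (∀ k, ∀ η ∈ T k, ‖η‖ = 1 ∧ 0 < c k η) ∧ (∀ k, DifferentiableOn ℂ (Y k) (ball 0 s)) ∧
      (∀ k w, q k w = Y k w + herglotzSum (T k) (c k) w - (1 + t) * W k w) ∧
      (∀ k, ∀ w ∈ sphere (0 : ℂ) ρ, ‖q k w‖ ≤ ε) ∧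
      ∀ k w, ‖w‖ = 1 → (Y k w).re = -(S.J ρ q (S.φ k w)).re := by
  classical
  have hs0 : 0 < s := one_pos.trans hs
  have hs1 : s⁻¹ < 1 := inv_lt_one_of_one_lt₀ hs
  have hρ0 : 0 < ρ := S.inv_pos.trans h₁
  have hρ1 : ρ < 1 := hρs.trans hs1
  have hρR : ρ < R := hρ1.trans S.one_lt
  have hsub : sphere (0 : ℂ) s ⊆ annulus ρ R := sphere_subset_annulus (hρ1.trans hs) hsR
  have hsub' : sphere (0 : ℂ) s⁻¹ ⊆ annulus ρ R := sphere_subset_annulus hρs (hs1.trans S.one_lt)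
  have hWρ : ∀ k, ContinuousOn (W k) (sphere 0 ρ) := fun k =>
    (hW k).continuousOn.mono fun w hw => by
      rw [mem_ball_zero_iff, mem_sphere_zero_iff_norm.1 hw]; exact hρ1
  obtain ⟨M, hM, hMc, hMf⟩ := S.exists_reflect_operator h₁ hρs hs hsR
  set w : CircleData ι ρ := fun k => sphereRes (W k) (hWρ k) with hw
  -- Q = y + (w' − w) − t • w has norm at most (2 + ‖w‖) times this number.
  have hε' : 0 < ε / (3 + ‖w‖) := by positivity
  obtain ⟨w', hw', y, t, hy, h1, h2, h3⟩ := exists_hull_solution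
    (fun p : ι × sphere (0 : ℂ) 1 => (Pi.single p.1 (herglotzMap hρ1 p.2) : CircleData ι ρ)) M hMc hMf w
    (fun l hl => apply_nonneg_of_herglotz hρ0 hρ1 l hl hW hW0 hm0 hm hWρ) hε'
  obtain ⟨T, c, hTc, hw'T⟩ := exists_herglotzSum_of_mem_span hρ1 hw'
  set Q : CircleData ι ρ := y + w' - w - t • w with hQ
  set Y : ι → ℂ → ℂ := fun k w => -reflectPart s (S.pullJ ρ Q k) w with hY
  set q : ι → ℂ → ℂ := fun k w => Y k w + herglotzSum (T k) (c k) w - (1 + t) * W k w with hq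
  have hpd := fun k => S.differentiableOn_pullJ h₁ hρR Q k
  have hqQ : ∀ k (w : sphere (0 : ℂ) ρ), q k w = Q k w := by
    intro k w
    -- The equation y + M Q = 0 says that the continuous datum y is the restriction of Y, which is
    -- holomorphic on the larger disc of radius s.
    have e1 : y k w = Y k w := by
      have : (y + M Q) k w = 0 := by rw [hy]; rfl
      rw [Pi.add_apply, ContinuousMap.add_apply, hM] at this
      exact eq_neg_of_add_eq_zero_left this
    simp only [hq, hQ]
    rw [← e1, ← hw'T]
    simp only [Pi.add_apply, Pi.sub_apply, Pi.smul_apply, ContinuousMap.add_apply,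
      ContinuousMap.sub_apply, ContinuousMap.smul_apply, hw, sphereRes_apply, real_smul]
    ring
  have hQn : ‖Q‖ ≤ ε := by
    have e : Q = y + (w' - w) - t • w := by rw [hQ]; abel
    rw [e]
    refine (norm_sub_le _ _).trans ?_
    have h4 := norm_add_le y (w' - w)
    have h5 : ‖t • w‖ ≤ ε / (3 + ‖w‖) * ‖w‖ := by
      rw [norm_smul, Real.norm_eq_abs]; gcongr
    have h6 : ε / (3 + ‖w‖) * (2 + ‖w‖) ≤ ε := by
      rw [div_mul_eq_mul_div, div_le_iff₀ (by positivity)]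
      nlinarith [norm_nonneg w]
    linarith
  refine ⟨T, c, Y, q, t, h3.le.trans ?_, hTc, fun k => ?_, fun k w => rfl, fun k w hw => ?_,
    fun k w hw => ?_⟩
  · rw [div_le_iff₀ (by positivity)]
    nlinarith [norm_nonneg w]
  · exact (differentiableOn_reflectPart hs0 ((hpd k).continuousOn.mono hsub)
      ((hpd k).continuousOn.mono hsub')).neg
  · rw [hqQ k ⟨w, hw⟩]
    exact ((Q k).norm_coe_le_norm _).trans ((norm_le_pi_norm Q k).trans hQn)
  · have e : S.J ρ q (S.φ k w) = S.pullJ ρ Q k w := by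
      refine S.J_congr hρ0.le (fun l η hη => ?_) _
      rw [sphereExt_of_mem _ hη, ← hqQ l ⟨η, hη⟩]
    rw [e]
    simp only [hY, neg_re]
    rw [re_reflectPart hρ0.le hs hρs hsR (hpd k) hw]

end CollarSystem

end ProperApprox

/-! ### Approximation with positive real part -/

namespace ProperApprox

open Complex Metric Set Filter Topology
open scoped ComplexConjugate

/-- If the boundary values of the real part are almost at least `m`, it is at least `m`. -/
theorem le_re_of_eventually {W : ℂ → ℂ} (hW : DifferentiableOn ℂ W (ball 0 1)) {m : ℝ}
    (h : ∀ δ > 0, ∃ r < 1, ∀ w, r < ‖w‖ → ‖w‖ < 1 → m - δ ≤ (W w).re) {w : ℂ}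
    (hw : w ∈ ball (0 : ℂ) 1) : m ≤ (W w).re := by
  refine le_of_forall_pos_sub_le fun δ hδ => ?_
  obtain ⟨r, hr, H⟩ := h δ hδ
  rw [mem_ball_zero_iff] at hw
  obtain ⟨t, ht₁, ht₂⟩ := exists_between (max_lt hr hw)
  have ht0 : 0 < t := (norm_nonneg w).trans_lt ((le_max_right _ _).trans_lt ht₁)
  have hcl : closure (ball (0 : ℂ) t) ⊆ ball 0 1 := by
    rw [closure_ball 0 ht0.ne']
    exact closedBall_subset_ball ht₂
  have hd : DiffContOnCl ℂ (fun w => exp (-W w)) (ball 0 t) :=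
    ((hW.mono hcl).neg.cexp).diffContOnCl
  -- Maximum modulus for exp(−W), whose modulus is exp(−Re W).
  have h1 := norm_le_of_forall_mem_frontier_norm_le (C := Real.exp (-(m - δ))) isBounded_ball hd
    (fun z hz => by
      rw [frontier_ball 0 ht0.ne', mem_sphere_zero_iff_norm] at hz
      rw [norm_exp, Real.exp_le_exp, neg_re, neg_le_neg_iff]
      exact H z (hz ▸ (le_max_left _ _).trans_lt ht₁) (hz ▸ ht₂))
    (subset_closure (mem_ball_zero_iff.2 ((le_max_right _ _).trans_lt ht₁)))
  rwa [norm_exp, Real.exp_le_exp, neg_re, neg_le_neg_iff] at h1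

theorem exists_radius_of_re_eq_zero {a b : ℝ} (ha : a < 1) (hb : 1 < b) {Z : ℂ → ℂ}
    (hZ : ContinuousOn Z (annulus a b)) (hZ0 : ∀ w, ‖w‖ = 1 → (Z w).re = 0) {δ : ℝ} (hδ : 0 < δ) :
    ∃ r < 1, ∀ w, r < ‖w‖ → ‖w‖ < 1 → |(Z w).re| < δ := by
  have hV : IsOpen (annulus a b ∩ (fun w => (Z w).re) ⁻¹' Ioo (-δ) δ) :=
    (continuous_re.comp_continuousOn hZ).isOpen_inter_preimage (isOpen_annulus a b) isOpen_Ioo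
  obtain ⟨R', hR', hR1⟩ := ((eventually_annulus_subset hV fun w hw =>
    ⟨sphere_subset_annulus ha hb hw, by
      simp [hZ0 w (mem_sphere_zero_iff_norm.1 hw), hδ]⟩).and self_mem_nhdsWithin).exists
  have hR1 : 1 < R' := hR1
  exact ⟨R'⁻¹, inv_lt_one_of_one_lt₀ hR1, fun w h1 h2 => abs_lt.2 (hR' ⟨h1, h2.trans hR1⟩).2⟩

/-- A holomorphic function on an inner collar of the unit circle is the sum of a function holomorphic
on the disc and a function that extends through the circle, with imaginary values there. -/
theorem exists_collar_splitting {a r m : ℝ} (ha : 0 ≤ a) (har : a < r) (hr1 : r < 1) {v : ℂ → ℂ}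
    (hv : DifferentiableOn ℂ v (annulus a 1)) (hm : ∀ w ∈ annulus a 1, m ≤ (v w).re) :
    ∃ W Z : ℂ → ℂ, DifferentiableOn ℂ W (ball 0 1) ∧ (W 0).im = 0 ∧
      (∀ w ∈ ball (0 : ℂ) 1, m ≤ (W w).re) ∧ DifferentiableOn ℂ Z (annulus r r⁻¹) ∧
      (∀ w, ‖w‖ = 1 → (Z w).re = 0) ∧ ∀ w ∈ annulus r 1, v w = W w + Z w := by
  have hr0 : 0 < r := ha.trans_lt har
  have hri : 1 < r⁻¹ := (one_lt_inv₀ hr0).2 hr1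
  obtain ⟨P, Q, hP, hQ, hPQ⟩ := exists_laurent_splitting ha har hr1 hv
  -- Q' extends the conjugate of Q(w⁻¹) from the unit circle into the disc. Moving it from the tail
  -- into W leaves Z imaginary on the circle, so Re W has the boundary lower bound of Re v; β makes
  -- W 0 real.
  set Q' : ℂ → ℂ := fun w => conj (Q (conj w)) with hQ'
  have hQ'd : DifferentiableOn ℂ Q' (ball 0 r⁻¹) := by
    intro w hw
    have h1 := (hQ.differentiableAt (isOpen_ball.mem_nhds (x := conj w) (by simpa using hw))).conj_conj
    rw [conj_conj] at h1
    exact h1.differentiableWithinAt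
  set β : ℂ := ((P 0 + Q' 0).im : ℂ) * I with hβ
  have hβre : β.re = 0 := by simp [hβ]
  set W : ℂ → ℂ := fun w => P w + Q' w - β with hW
  set Z : ℂ → ℂ := fun w => Q w⁻¹ - Q' w + β with hZ
  have hne : ∀ w ∈ annulus r r⁻¹, w ≠ 0 := fun w hw => norm_pos_iff.1 (hr0.trans hw.1)
  have hZd : DifferentiableOn ℂ Z (annulus r r⁻¹) := by
    refine ((hQ.comp (differentiableOn_inv.mono hne) fun w hw => ?_).sub
      (hQ'd.mono fun w hw => mem_ball_zero_iff.2 hw.2)).add_const β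
    rw [mem_ball_zero_iff, norm_inv]
    exact inv_strictAnti₀ hr0 hw.1
  have hZ0 : ∀ w, ‖w‖ = 1 → (Z w).re = 0 := by
    intro w hw
    have hc : w⁻¹ = conj w := by rw [Complex.inv_def, normSq_eq_norm_sq, hw]; simp
    simp [hZ, hQ', hc, hβre]
  have hWd : DifferentiableOn ℂ W (ball 0 1) :=
    (hP.add (hQ'd.mono (ball_subset_ball hri.le))).sub_const β
  have hvWZ : ∀ w ∈ annulus r 1, v w = W w + Z w := by
    intro w hw
    rw [hPQ w hw]
    simp only [hW, hZ]; ring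
  refine ⟨W, Z, hWd, by simp [hW, hβ], fun w hw => le_re_of_eventually hWd (fun δ hδ => ?_) hw,
    hZd, hZ0, hvWZ⟩
  obtain ⟨r', hr', H⟩ := exists_radius_of_re_eq_zero hr1 hri hZd.continuousOn hZ0 hδ
  refine ⟨max r r', max_lt hr1 hr', fun w h1 h2 => ?_⟩
  have h3 : r < ‖w‖ := (le_max_left _ _).trans_lt h1
  have h4 := abs_lt.1 (H w ((le_max_right _ _).trans_lt h1) h2)
  have h5 := hm w ⟨har.trans h3, h2⟩
  rw [hvWZ w ⟨h3, h2⟩, add_re] at h5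
  linarith

namespace CollarSystem

variable {D : Set ℂ} {ι : Type} {R : ℝ} (S : CollarSystem D ι R) [Fintype ι]

/-- G is (1 + t)F + J q away from the frontier. Between the circles ρ and r₂ the jump relation adds
q_k = Y_k + H_k − (1 + t)W_k, which cancels the W_k part of F and leaves H_k + Λ_k. So G extends to
the frontier with real part 0 off the poles, and the maximum principle gives Re G > 0. -/
theorem exists_positive_approx (hDo : IsOpen D) (hDc : IsConnected D) (hDb : Bornology.IsBounded D)
    {F : ℂ → ℂ} (hF : DifferentiableOn ℂ F D) {m : ℝ} (hm0 : 0 < m) (hm : ∀ z ∈ D, m ≤ (F z).re)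
    {K : Set ℂ} (hK : IsCompact K) (hKD : K ⊆ D) {ε : ℝ} (hε : 0 < ε) :
    ∃ (G : ℂ → ℂ) (T : ι → Finset ℂ) (c : ι → ℂ → ℝ) (Λ : ι → ℂ → ℂ) (s : ℝ), 1 < s ∧ s < R ∧
      DifferentiableOn ℂ G D ∧ (∀ z ∈ D, 0 < (G z).re) ∧ (∀ z ∈ K, ‖G z - F z‖ ≤ ε) ∧
      (∀ k, ∀ η ∈ T k, ‖η‖ = 1 ∧ 0 < c k η) ∧ (∀ k, DifferentiableOn ℂ (Λ k) (annulus s⁻¹ s)) ∧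
      (∀ k w, ‖w‖ = 1 → (Λ k w).re = 0) ∧
      ∀ k, ∀ w ∈ annulus s⁻¹ 1, G (S.φ k w) = herglotzSum (T k) (c k) w + Λ k w := by
  obtain ⟨z₀, hz₀⟩ := hDc.nonempty
  -- The extra point z₀ guarantees one point with Re G > 0 even if K is empty, as the strict
  -- inequality needs below.
  set K' : Set ℂ := insert z₀ K with hK'
  have hK'c : IsCompact K' := hK.insert z₀
  have hK'D : K' ⊆ D := insert_subset hz₀ hKD
  obtain ⟨r, hRr, hr1, hKr⟩ := S.exists_subset_core hK'c hK'D
  obtain ⟨ρ, hrρ, hρ1⟩ := exists_between hr1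
  have hRρ : R⁻¹ < ρ := hRr.trans hrρ
  obtain ⟨r₀, hRr₀, hr₀ρ⟩ := exists_between hRρ
  obtain ⟨r₂, hρr₂, hr₂1⟩ := exists_between hρ1
  have hr₂0 : 0 < r₂ := S.inv_pos.trans (hRρ.trans hρr₂)
  have hr₀0 : 0 < r₀ := S.inv_pos.trans hRr₀
  have hr₀1 : r₀ < 1 := hr₀ρ.trans hρ1
  set s : ℝ := r₂⁻¹ with hs
  have hsi : s⁻¹ = r₂ := inv_inv r₂
  have hs1 : 1 < s := (one_lt_inv₀ hr₂0).2 hr₂1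
  have hsR : s < R := inv_lt_of_inv_lt₀ (one_pos.trans S.one_lt) (hRρ.trans hρr₂)
  have hρs : ρ < s⁻¹ := by rwa [hsi]
  have hρR : ρ < R := hρ1.trans S.one_lt
  have hA1 : annulus R⁻¹ 1 ⊆ annulus R⁻¹ R := annulus_subset le_rfl S.one_lt.le
  have hsplit : ∀ k, ∃ W Z : ℂ → ℂ, DifferentiableOn ℂ W (ball 0 1) ∧ (W 0).im = 0 ∧
      (∀ w ∈ ball (0 : ℂ) 1, m ≤ (W w).re) ∧ DifferentiableOn ℂ Z (annulus r₀ r₀⁻¹) ∧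
      (∀ w, ‖w‖ = 1 → (Z w).re = 0) ∧ ∀ w ∈ annulus r₀ 1, F (S.φ k w) = W w + Z w := by
    intro k
    have hmaps : MapsTo (S.φ k) (annulus R⁻¹ 1) D := fun w hw => (S.mem_iff k w (hA1 hw)).2 hw.2
    exact exists_collar_splitting S.inv_pos.le hRr₀ hr₀1
      (hF.comp ((S.diff k).mono hA1) hmaps) fun w hw => hm _ (hmaps hw)
  choose W Z hW hW0 hWm hZ hZ0 hFWZ using hsplit
  have hcirc : ∀ k, ∀ η ∈ sphere (0 : ℂ) ρ, S.φ k η ∉ K' := fun k η hη h => by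
    rw [mem_sphere_zero_iff_norm] at hη
    exact (hKr h).2 (mem_iUnion.2 ⟨k, η, ⟨hη ▸ hrρ, hη ▸ hρ1⟩, rfl⟩)
  obtain ⟨C, hC0, hC⟩ := S.exists_norm_J_le hRρ hρR hK'c hcirc
  obtain ⟨B, hB⟩ := hK'c.exists_bound_of_continuousOn (hF.continuousOn.mono hK'D)
  have hB0 : 0 ≤ B := (norm_nonneg _).trans (hB z₀ (mem_insert _ _))
  -- The bound m/2 keeps Re G z₀ ≥ m/2; the divisor C + B + 1 below covers the Cauchy transform (C)
  -- and t F (B).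
  set ε₀ := min ε (m / 2) with hε₀
  have hε₀0 : 0 < ε₀ := by positivity
  have hε₁ : 0 < ε₀ / (C + B + 1) := by positivity
  obtain ⟨T, c, Y, q, t, ht, hTc, hY, hq, hqn, hYre⟩ :=
    S.exists_herglotz_data hRρ hρs hs1 hsR hW hW0 hm0 hWm hε₁
  have hT : ∀ k, ∀ w ∈ ball (0 : ℂ) 1, w ∉ T k := fun k w hw hwT => by
    rw [mem_ball_zero_iff, (hTc k w hwT).1] at hw
    exact lt_irrefl _ hw
  have hH : ∀ k, DifferentiableOn ℂ (herglotzSum (T k) (c k)) (ball 0 1) := fun k w hw =>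
    (differentiableAt_herglotzSum (hT k w hw)).differentiableWithinAt
  have hball : ∀ a, annulus a 1 ⊆ ball 0 1 := fun a w hw => mem_ball_zero_iff.2 hw.2
  have hqd : ∀ k, DifferentiableOn ℂ (q k) (annulus R⁻¹ 1) := by
    intro k
    have e : q k = fun w => Y k w + herglotzSum (T k) (c k) w - (1 + t) * W k w := funext (hq k)
    rw [e]
    exact ((((hY k).mono (ball_subset_ball hs1.le)).add (hH k)).sub
      ((hW k).const_mul _)).mono (hball _)
  have hqc : ∀ r', R⁻¹ < r' → r' < 1 → ∀ k, ContinuousOn (q k) (sphere 0 r') := fun r' h1 h2 k =>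
    (hqd k).continuousOn.mono (sphere_subset_annulus h1 h2)
  set Λ : ι → ℂ → ℂ := fun k w => Y k w + S.J ρ q (S.φ k w) + (1 + t) * Z k w with hΛ
  have hr₀s : s ≤ r₀⁻¹ := inv_anti₀ hr₀0 (hr₀ρ.trans hρr₂).le
  have hΛd : ∀ k, DifferentiableOn ℂ (Λ k) (annulus ρ s) := fun k =>
    (((hY k).mono fun w hw => mem_ball_zero_iff.2 hw.2).add
      ((S.differentiableOn_J_comp hRρ hρR (hqc ρ hRρ hρ1) k).mono
        (annulus_subset le_rfl hsR.le))).add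
      (((hZ k).mono (annulus_subset hr₀ρ.le hr₀s)).const_mul _)
  have hΛ0 : ∀ k w, ‖w‖ = 1 → (Λ k w).re = 0 := by
    intro k w hw
    have e : ((1 + t : ℂ) * Z k w).re = (1 + t) * (Z k w).re := by
      rw [← ofReal_one, ← ofReal_add, re_ofReal_mul]
    simp only [hΛ, add_re] at e ⊢
    rw [hYre k w hw, e, hZ0 k w hw]
    ring
  set A : Set ℂ := closedBall 0 1 \ ball 0 r₂ with hA
  have hAc : IsCompact A := (isCompact_closedBall 0 1).diff isOpen_ball
  have hmemA : ∀ w, w ∈ A ↔ ‖w‖ ≤ 1 ∧ r₂ ≤ ‖w‖ := fun w => by simp [hA]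
  have hAsub : A ⊆ annulus R⁻¹ R := fun w hw =>
    ⟨(hRρ.trans hρr₂).trans_le ((hmemA w).1 hw).2, ((hmemA w).1 hw).1.trans_lt S.one_lt⟩
  set O : Set ℂ := D \ ⋃ k, S.φ k '' A with hO
  have hOo : IsOpen O := hDo.sdiff (isCompact_iUnion fun k =>
    hAc.image_of_continuousOn ((S.diff k).continuousOn.mono hAsub)).isClosed
  have hOnot : ∀ z ∈ O, ∀ k w, r₂ ≤ ‖w‖ → ‖w‖ ≤ 1 → S.φ k w ≠ z := fun z hz k w h1 h2 h =>
    hz.2 (mem_iUnion.2 ⟨k, w, (hmemA w).2 ⟨h2, h1⟩, h⟩)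
  set G₀ : ℂ → ℂ := fun z => S.J r₂ q z + (1 + t) * F z with hG₀
  have hRr₂ : R⁻¹ < r₂ := hRρ.trans hρr₂
  have hG₀d : DifferentiableOn ℂ G₀ O := by
    refine DifferentiableOn.add (fun z hz => ?_) ((hF.mono sdiff_subset).const_mul _)
    refine (S.differentiableAt_J hRr₂ (hr₂1.trans S.one_lt) (hqc r₂ hRr₂ hr₂1)
      fun k => ?_).differentiableWithinAt
    rintro ⟨w, hw, e⟩
    rw [mem_sphere_zero_iff_norm] at hw
    exact hOnot z hz k w hw.ge (hw.le.trans hr₂1.le) e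
  obtain ⟨G, hGO, hGφ, hGd, -⟩ := S.exists_glue hRρ hρr₂ le_rfl S.one_lt.le hOo sdiff_subset
    (fun z hz hzO => by
      have : z ∈ ⋃ k, S.φ k '' A := by
        by_contra h; exact hzO ⟨hz, h⟩
      obtain ⟨k, w, hw, rfl⟩ := mem_iUnion.1 this
      exact ⟨k, w, ((hmemA w).1 hw).2, (S.mem_iff k w (hAsub hw)).1 hz, rfl⟩)
    (fun k w h1 h2 h => hOnot _ h k w h1 h2.le rfl) hG₀d
    (h := fun k w => herglotzSum (T k) (c k) w + Λ k w)
    (fun k => ((hH k).mono (hball _)).add ((hΛd k).mono (annulus_subset le_rfl hs1.le)))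
    (fun k w h1 h2 => by
      simp only [hG₀, hΛ]
      rw [S.J_sub_J hRρ hr₂1 hqd h1 h2, hq, hFWZ k w ⟨hr₀ρ.trans h1, h2.trans hr₂1⟩]
      ring)
  have hGK : ∀ z ∈ K', ‖G z - F z‖ ≤ ε₀ := by
    intro z hz
    have hnot : ∀ k w, ρ ≤ ‖w‖ → ‖w‖ < 1 → S.φ k w ≠ z := fun k w h1 h2 h =>
      (hKr hz).2 (mem_iUnion.2 ⟨k, w, ⟨hrρ.trans_le h1, h2⟩, h⟩)
    have hzO : z ∈ O := by
      refine ⟨hK'D hz, fun h => ?_⟩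
      obtain ⟨k, w, hw, e⟩ := mem_iUnion.1 h
      have h1 := (S.mem_iff k w (hAsub hw)).1 (e ▸ hK'D hz)
      exact hnot k w (hρr₂.le.trans ((hmemA w).1 hw).2) h1 e
    rw [hGO hzO]
    simp only [hG₀]
    -- K' avoids the region between the circles, so the contour moves to radius ρ, where q is known
    -- to be small.
    rw [S.J_eq_of_notMem hRρ hρr₂.le hr₂1 hqd (fun k w h1 h2 => hnot k w h1 (h2.trans_lt hr₂1))]
    have e : S.J ρ q z + (1 + t) * F z - F z = S.J ρ q z + t * F z := by ring
    rw [e]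
    have h1 := hC q _ hqn z hz
    have h2 : ‖(t : ℂ) * F z‖ ≤ ε₀ / (C + B + 1) * B := by
      rw [norm_mul, norm_real, Real.norm_eq_abs]
      have := hB z hz
      gcongr
    have h3 : ε₀ / (C + B + 1) * (C + B) ≤ ε₀ := by
      rw [div_mul_eq_mul_div, div_le_iff₀ (by positivity)]
      nlinarith
    linarith [norm_add_le (S.J ρ q z) (t * F z)]
  have hEd : DifferentiableOn ℂ (fun z => exp (-G z)) D := hGd.neg.cexp
  have hE1 : ∀ z ∈ D, ‖exp (-G z)‖ ≤ 1 := by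
    intro z hz
    -- Near the frontier Re H_k ≥ 0 and |Re Λ_k| < δ, so |exp(−G)| ≤ exp δ there and then on D.
    have hδ : ∀ δ > 0, ‖exp (-G z)‖ ≤ Real.exp δ := by
      intro δ hδ
      have hrad : ∀ k, ∃ r' < 1, ∀ w, r' < ‖w‖ → ‖w‖ < 1 → |(Λ k w).re| < δ := fun k =>
        exists_radius_of_re_eq_zero hρ1 hs1 (hΛd k).continuousOn (hΛ0 k) hδ
      choose r' hr' H using hrad
      have hne : Nonempty ι := S.nonempty_index hDb hDc.nonempty
      have hsup : max ρ (Finset.univ.sup' Finset.univ_nonempty r') < 1 :=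
        max_lt hρ1 ((Finset.sup'_lt_iff _).2 fun k _ => hr' k)
      refine S.norm_le_of_collar hDo hDc hDb hEd hsup (fun k w _ h2 h3 => ?_) hz
      have h4 : ρ < ‖w‖ := (le_max_left _ _).trans_lt h2
      have h5 : r' k < ‖w‖ := ((Finset.le_sup' r' (Finset.mem_univ k)).trans
        (le_max_right _ _)).trans_lt h2
      rw [norm_exp, Real.exp_le_exp, neg_re, hGφ k w ⟨h4, h3⟩, add_re]
      have h6 := abs_lt.1 (H k w h5 h3)
      have h7 := re_herglotzSum_nonneg (hTc k) h3.le
      linarith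
    rw [norm_exp] at hδ ⊢
    rw [Real.exp_le_one_iff]
    exact le_of_forall_pos_le_add fun δ h => by
      rw [zero_add]; exact Real.exp_le_exp.1 (hδ δ h)
  have hz₀re : 0 < (G z₀).re := by
    have h1 := hGK z₀ (mem_insert _ _)
    have h2 := (abs_re_le_norm (G z₀ - F z₀)).trans (h1.trans (min_le_right _ _))
    rw [sub_re] at h2
    linarith [abs_le.1 h2, hm z₀ hz₀]
  refine ⟨G, T, c, Λ, s, hs1, hsR, hGd, fun z hz => ?_, fun z hz =>
    (hGK z (mem_insert_of_mem _ hz)).trans (min_le_left _ _), hTc,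
    fun k => (hΛd k).mono (annulus_subset hρs.le le_rfl), hΛ0,
    fun k w hw => hGφ k w ⟨hρs.trans hw.1, hw.2⟩⟩
  -- Otherwise |exp(−G)| attains its maximum 1 inside D and is constant, against Re G z₀ > 0.
  by_contra hneg
  have h1 := hE1 z hz
  have h2 : ‖exp (-G z)‖ = 1 := by
    refine le_antisymm h1 ?_
    rw [norm_exp, Real.one_le_exp_iff, neg_re]
    linarith
  have h3 := norm_eqOn_of_isPreconnected_of_isMaxOn hDc.isPreconnected hDo hEd hz
    (fun x hx => (hE1 x hx).trans h2.ge) hz₀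
  simp only [Function.comp_apply, Function.const_apply] at h3
  rw [h2, norm_exp, Real.exp_eq_one_iff, neg_re] at h3
  linarith

end CollarSystem

end ProperApprox

/-! ### Back to the disc: the Cayley transform -/

namespace ProperApprox

open Complex Metric Set Filter Topology

/-- The numerator of a finite combination of Herglotz kernels. -/
noncomputable def herglotzNum (T : Finset ℂ) (c : ℂ → ℝ) (w : ℂ) : ℂ :=
  ∑ η ∈ T, (c η : ℂ) * (η + w) * ∏ η' ∈ T.erase η, (η' - w)

theorem herglotzNum_of_notMem {T : Finset ℂ} (c : ℂ → ℝ) {w : ℂ} (hw : w ∉ T) :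
    herglotzNum T c w = (∏ η ∈ T, (η - w)) * herglotzSum T c w := by
  rw [herglotzNum, herglotzSum, Finset.mul_sum]
  refine Finset.sum_congr rfl fun η hη => ?_
  have h0 : η - w ≠ 0 := sub_ne_zero.2 fun h => hw (h ▸ hη)
  rw [← Finset.mul_prod_erase T _ hη]
  field_simp

theorem herglotzNum_ne_zero_of_mem {T : Finset ℂ} {c : ℂ → ℝ} {w : ℂ} (hw : w ∈ T) (hw0 : w ≠ 0)
    (hc : c w ≠ 0) : herglotzNum T c w ≠ 0 := by
  rw [herglotzNum, Finset.sum_eq_single w]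
  · refine mul_ne_zero (mul_ne_zero (ofReal_ne_zero.2 hc) ?_) (Finset.prod_ne_zero_iff.2 ?_)
    · rw [← two_mul]; exact mul_ne_zero two_ne_zero hw0
    · intro η hη
      exact sub_ne_zero.2 (Finset.ne_of_mem_erase hη)
  · intro η _ hne
    rw [Finset.prod_eq_zero (f := fun η' => η' - w) (Finset.mem_erase.2 ⟨hne.symm, hw⟩) (sub_self w), mul_zero]
  · exact fun h => absurd hw h

theorem differentiable_herglotzNum (T : Finset ℂ) (c : ℂ → ℝ) :
    Differentiable ℂ (herglotzNum T c) := by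
  have : herglotzNum T c = fun w => ∑ η ∈ T, (c η : ℂ) * (η + w) * ∏ η' ∈ T.erase η, (η' - w) := rfl
  rw [this]
  fun_prop

theorem norm_sub_one_sq (G : ℂ) : ‖G - 1‖ ^ 2 = ‖G + 1‖ ^ 2 - 4 * G.re := by
  rw [Complex.sq_norm, Complex.sq_norm, normSq_apply, normSq_apply]
  simp
  ring

theorem norm_sub_one_lt {G : ℂ} (h : 0 < G.re) : ‖G - 1‖ < ‖G + 1‖ := by
  refine lt_of_pow_lt_pow_left₀ 2 (norm_nonneg _) ?_
  linarith [norm_sub_one_sq G]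

theorem norm_sub_one_eq {G : ℂ} (h : G.re = 0) : ‖G - 1‖ = ‖G + 1‖ := by
  have := norm_sub_one_sq G
  rw [h, mul_zero, sub_zero] at this
  exact (sq_eq_sq₀ (norm_nonneg _) (norm_nonneg _)).1 this

theorem one_le_norm_add_one {G : ℂ} (h : 0 ≤ G.re) : 1 ≤ ‖G + 1‖ := by
  have := (le_abs_self _).trans (abs_re_le_norm (G + 1))
  rw [add_re, one_re] at this
  linarith

theorem add_one_ne_zero_of_re_nonneg {G : ℂ} (h : 0 ≤ G.re) : G + 1 ≠ 0 :=
  norm_pos_iff.1 (one_pos.trans_le (one_le_norm_add_one h))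

theorem norm_cayley_sub_le {G F : ℂ} (hG : 0 ≤ G.re) (hF : 0 ≤ F.re) :
    ‖(G - 1) / (G + 1) - (F - 1) / (F + 1)‖ ≤ 2 * ‖G - F‖ := by
  have h1 := add_one_ne_zero_of_re_nonneg hG
  have h2 := add_one_ne_zero_of_re_nonneg hF
  have e : (G - 1) / (G + 1) - (F - 1) / (F + 1) = 2 * (G - F) / ((G + 1) * (F + 1)) := by
    field_simp; ring
  rw [e, norm_div, norm_mul, norm_mul, Complex.norm_ofNat]
  exact div_le_self (by positivity)
    (one_le_mul_of_one_le_of_one_le (one_le_norm_add_one hG) (one_le_norm_add_one hF))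

namespace CollarSystem

variable {D : Set ℂ} {ι : Type} {R : ℝ} (S : CollarSystem D ι R)

/-- A disc inside the inner half collar, tangent to the unit circle at w, is carried by φ k into D.
The boundary point lemma applies to g on it. -/
theorem deriv_ne_zero_on_frontier {g : ℂ → ℂ} (hgD : DifferentiableOn ℂ g D)
    (hDo : IsOpen D) (hg : ∀ z ∈ D, ‖g z‖ < 1) {k : ι} {w : ℂ} (hw : ‖w‖ = 1)
    (hga : DifferentiableAt ℂ g (S.φ k w)) (hg1 : ‖g (S.φ k w)‖ = 1) : deriv g (S.φ k w) ≠ 0 := by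
  intro h0
  -- The disc of radius r tangent at w reaches down to |·| = 1 − 2r = R⁻¹.
  set r := (1 - R⁻¹) / 2 with hr
  have hr0 : 0 < r := by have := S.inv_lt_one; linarith
  have hr1 : 0 < 1 - r := by have := S.inv_pos; linarith
  set p : ℂ → ℂ := fun ξ => w * ((1 - r : ℝ) + r * ξ) with hp
  have hpA : ∀ ξ ∈ ball (0 : ℂ) 1, p ξ ∈ annulus R⁻¹ 1 := by
    intro ξ hξ
    rw [mem_ball_zero_iff] at hξ
    have e1 : ‖(r : ℂ) * ξ‖ = r * ‖ξ‖ := by rw [norm_mul, norm_real, Real.norm_of_nonneg hr0.le]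
    have e2 : ‖((1 - r : ℝ) : ℂ)‖ = 1 - r := by rw [norm_real, Real.norm_of_nonneg hr1.le]
    have h1 := norm_add_le ((1 - r : ℝ) : ℂ) (r * ξ)
    have h2 := norm_sub_le_norm_add ((1 - r : ℝ) : ℂ) (r * ξ)
    rw [mem_annulus, hp, norm_mul, hw, one_mul]
    constructor <;> nlinarith
  have hsub : annulus R⁻¹ 1 ⊆ annulus R⁻¹ R := annulus_subset le_rfl S.one_lt.le
  have hφD : ∀ ξ ∈ ball (0 : ℂ) 1, S.φ k (p ξ) ∈ D := fun ξ hξ =>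
    (S.mem_iff k _ (hsub (hpA ξ hξ))).2 (hpA ξ hξ).2
  have hp1 : p 1 = w := by simp [hp]
  have hpd : ∀ ξ, DifferentiableAt ℂ p ξ := fun ξ => by fun_prop
  have hφd : ∀ w ∈ annulus R⁻¹ R, DifferentiableAt ℂ (S.φ k) w := fun w hw =>
    (S.diff k).differentiableAt ((isOpen_annulus _ _).mem_nhds hw)
  have hcomp : ∀ ξ, p ξ ∈ annulus R⁻¹ R → DifferentiableAt ℂ (fun ξ => S.φ k (p ξ)) ξ :=
    fun ξ hξ => (hφd _ hξ).comp ξ (hpd ξ)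
  refine not_hasDerivAt_zero_of_mapsTo_ball (h := fun ξ => g (S.φ k (p ξ))) (fun ξ hξ => ?_)
    (fun ξ hξ => mem_ball_zero_iff.2 (hg _ (hφD ξ hξ))) (by rw [hp1]; exact hg1) ?_
  · exact ((hgD.differentiableAt (hDo.mem_nhds (hφD ξ hξ))).comp ξ
      (hcomp ξ (hsub (hpA ξ hξ)))).differentiableWithinAt
  · have h1 := (hcomp 1 (by rw [hp1]; exact S.sphere_subset (mem_sphere_zero_iff_norm.2 hw))).hasDerivAt
    have h2 : HasDerivAt g 0 (S.φ k (p 1)) := by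
      rw [hp1, ← h0]; exact hga.hasDerivAt
    have h3 := h2.comp (1 : ℂ) h1
    rwa [zero_mul] at h3

/-- In a collar G = N/E, where E vanishes exactly at the poles, so (G − 1)/(G + 1) = (N − E)/(N +
E). On the unit circle N + E has no zero: off the poles N/E is imaginary, and at a pole E = 0 while
N ≠ 0. In both cases the quotient is unimodular. -/
theorem exists_proper_of_positive [Finite ι] (hDo : IsOpen D) {G : ℂ → ℂ} {T : ι → Finset ℂ}
    {c : ι → ℂ → ℝ} {Λ : ι → ℂ → ℂ} {s : ℝ} (hs : 1 < s) (hsR : s < R)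
    (hG : DifferentiableOn ℂ G D) (hGre : ∀ z ∈ D, 0 < (G z).re)
    (hT : ∀ k, ∀ η ∈ T k, ‖η‖ = 1 ∧ 0 < c k η)
    (hΛ : ∀ k, DifferentiableOn ℂ (Λ k) (annulus s⁻¹ s)) (hΛ0 : ∀ k w, ‖w‖ = 1 → (Λ k w).re = 0)
    (hGφ : ∀ k, ∀ w ∈ annulus s⁻¹ 1, G (S.φ k w) = herglotzSum (T k) (c k) w + Λ k w) :
    ∃ g : ℂ → ℂ, AnalyticOnNhd ℂ g (closure D) ∧ (∀ z ∈ D, ‖g z‖ < 1) ∧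
      (∀ z ∈ frontier D, ‖g z‖ = 1) ∧ (∀ z ∈ frontier D, deriv g z ≠ 0) ∧
      ∀ z ∈ D, g z = (G z - 1) / (G z + 1) := by
  have hs0 : 0 < s := one_pos.trans hs
  have hsi : s⁻¹ < 1 := inv_lt_one_of_one_lt₀ hs
  have hRs : R⁻¹ < s⁻¹ := inv_strictAnti₀ hs0 hsR
  set E : ι → ℂ → ℂ := fun k w => ∏ η ∈ T k, (η - w) with hE
  set N : ι → ℂ → ℂ := fun k w => E k w * Λ k w + herglotzNum (T k) (c k) w with hN
  have hEd : ∀ k, Differentiable ℂ (E k) := fun k => by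
    simp only [hE]; fun_prop
  have hNd : ∀ k, DifferentiableOn ℂ (N k) (annulus s⁻¹ s) := fun k =>
    ((hEd k).differentiableOn.mul (hΛ k)).add (differentiable_herglotzNum _ _).differentiableOn
  have hE0 : ∀ k w, w ∉ T k → E k w ≠ 0 := fun k w hw =>
    Finset.prod_ne_zero_iff.2 fun η hη => sub_ne_zero.2 fun h => hw (h ▸ hη)
  have hNE : ∀ k w, w ∉ T k → N k w = E k w * (herglotzSum (T k) (c k) w + Λ k w) := by
    intro k w hw
    simp only [hN]
    rw [herglotzNum_of_notMem _ hw]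
    ring
  have hET : ∀ k w, w ∈ T k → E k w = 0 := fun k w hw => Finset.prod_eq_zero hw (sub_self w)
  have hNT : ∀ k w, w ∈ T k → N k w ≠ 0 := by
    intro k w hw
    simp only [hN]
    rw [hET k w hw, zero_mul, zero_add]
    exact herglotzNum_ne_zero_of_mem hw (norm_pos_iff.1 ((hT k w hw).1 ▸ one_pos)) (hT k w hw).2.ne'
  have hre1 : ∀ k w, ‖w‖ = 1 → (herglotzSum (T k) (c k) w + Λ k w).re = 0 := fun k w hw => by
    rw [add_re, re_herglotzSum_eq_zero (hT k) hw, hΛ0 k w hw, add_zero]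
  have hcirc : ∀ k w, ‖w‖ = 1 → N k w + E k w ≠ 0 ∧ ‖N k w - E k w‖ = ‖N k w + E k w‖ := by
    intro k w hw
    by_cases hwT : w ∈ T k
    · rw [hET k w hwT, add_zero, sub_zero]
      exact ⟨hNT k w hwT, rfl⟩
    · have e1 : N k w + E k w = E k w * (herglotzSum (T k) (c k) w + Λ k w + 1) := by
        rw [hNE k w hwT]; ring
      have e2 : N k w - E k w = E k w * (herglotzSum (T k) (c k) w + Λ k w - 1) := by
        rw [hNE k w hwT]; ring
      rw [e1, e2, norm_mul, norm_mul, norm_sub_one_eq (hre1 k w hw)]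
      exact ⟨mul_ne_zero (hE0 k w hwT) (add_one_ne_zero_of_re_nonneg (hre1 k w hw).ge), rfl⟩
  have hV : ∀ k, ∀ᶠ R' in 𝓝[>] (1 : ℝ),
      annulus R'⁻¹ R' ⊆ annulus s⁻¹ s ∩ (fun w => N k w + E k w) ⁻¹' {0}ᶜ := fun k =>
    eventually_annulus_subset
      (((hNd k).add (hEd k).differentiableOn).continuousOn.isOpen_inter_preimage
        (isOpen_annulus _ _) isOpen_compl_singleton)
      fun w hw => ⟨sphere_subset_annulus hsi hs hw, (hcirc k w (mem_sphere_zero_iff_norm.1 hw)).1⟩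
  obtain ⟨b, hbV, hb1, hbs⟩ := ((eventually_all.2 hV).and (Ioo_mem_nhdsGT hs)).exists
  have hb0 : 0 < b := one_pos.trans hb1
  have hbi : b⁻¹ < 1 := inv_lt_one_of_one_lt₀ hb1
  have hsb : s⁻¹ < b⁻¹ := inv_strictAnti₀ hb0 hbs
  have hsubb : annulus b⁻¹ b ⊆ annulus s⁻¹ s := annulus_subset hsb.le hbs.le
  have hsubR : annulus s⁻¹ 1 ⊆ annulus R⁻¹ R := annulus_subset hRs.le S.one_lt.le
  have hG1 : ∀ z ∈ D, G z + 1 ≠ 0 := fun z hz => add_one_ne_zero_of_re_nonneg (hGre z hz).le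
  obtain ⟨g, hgD, hgφ, hgd, hga⟩ := S.exists_glue (hRs.trans hsb) hbi hb1.le (hbs.trans hsR).le
    hDo Subset.rfl (fun z hz h => absurd hz h) (fun k w h1 h2 => absurd h1 (not_le.2 h2))
    (g₀ := fun z => (G z - 1) / (G z + 1)) ((hG.sub_const 1).div (hG.add_const 1) hG1)
    (h := fun k w => (N k w - E k w) / (N k w + E k w))
    (fun k => (((hNd k).sub (hEd k).differentiableOn).mono hsubb).div
      (((hNd k).add (hEd k).differentiableOn).mono hsubb) fun w hw => (hbV k hw).2)
    (fun k w h1 h2 => by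
      have hw : w ∈ annulus s⁻¹ 1 := ⟨hsb.trans h1, h2⟩
      have hwT : w ∉ T k := fun h => h2.ne (hT k w h).1
      have e := hG1 _ ((S.mem_iff k w (hsubR hw)).2 h2)
      rw [hNE k w hwT, ← hGφ k w hw]
      have := hE0 k w hwT
      have e2 : E k w * G (S.φ k w) + E k w ≠ 0 := by
        rw [← mul_add_one]; exact mul_ne_zero this e
      field_simp)
  have hfr : ∀ z ∈ frontier D, ∃ k w, ‖w‖ = 1 ∧ w ∈ annulus b⁻¹ b ∧ S.φ k w = z := by
    intro z hz
    rw [S.frontier_eq] at hz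
    obtain ⟨k, w, hw, rfl⟩ := mem_iUnion.1 hz
    exact ⟨k, w, mem_sphere_zero_iff_norm.1 hw, sphere_subset_annulus hbi hb1 hw, rfl⟩
  have hlt : ∀ z ∈ D, ‖g z‖ < 1 := by
    intro z hz
    rw [hgD hz, norm_div, div_lt_one (norm_pos_iff.2 (hG1 z hz))]
    exact norm_sub_one_lt (hGre z hz)
  have heq : ∀ k, ∀ w ∈ annulus b⁻¹ b, ‖w‖ = 1 → ‖g (S.φ k w)‖ = 1 := by
    intro k w hw hw1
    obtain ⟨h1, h2⟩ := hcirc k w hw1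
    rw [hgφ k w hw, norm_div, h2, div_self (norm_ne_zero_iff.2 h1)]
  refine ⟨g, fun z hz => ?_, hlt, fun z hz => ?_, fun z hz => ?_, hgD⟩
  · by_cases hzD : z ∈ D
    · exact hgd.analyticAt (hDo.mem_nhds hzD)
    · obtain ⟨k, w, -, hw, rfl⟩ := hfr z ⟨hz, by rwa [hDo.interior_eq]⟩
      exact hga k w hw
  · obtain ⟨k, w, hw1, hw, rfl⟩ := hfr z hz
    exact heq k w hw hw1
  · obtain ⟨k, w, hw1, hw, rfl⟩ := hfr z hz
    exact S.deriv_ne_zero_on_frontier hgd hDo hlt hw1 (hga k w hw).differentiableAt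
      (heq k w hw hw1)

end CollarSystem

/-- Approximation by a proper map that extends analytically across the boundary. -/
theorem exists_proper_approx {D : Set ℂ} (hD : IsAnalyticDomain D) {K : Set ℂ} (hKD : K ⊆ D)
    (hK : IsCompact K) {f : ℂ → ℂ} (hf : DifferentiableOn ℂ f D) (hfD : MapsTo f D (ball 0 1))
    {ε : ℝ} (hε : 0 < ε) :
    ∃ g : ℂ → ℂ, AnalyticOnNhd ℂ g (closure D) ∧ (∀ z ∈ D, ‖g z‖ < 1) ∧
      (∀ z ∈ frontier D, ‖g z‖ = 1) ∧ (∀ z ∈ frontier D, deriv g z ≠ 0) ∧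
      ∀ z ∈ K, ‖g z - f z‖ ≤ ε := by
  obtain ⟨ι, hι, R, ⟨S⟩⟩ := hD.exists_collarSystem
  -- Shrinking f moves it by at most ε/2 and keeps Re F ≥ (1 − τ²)/4. The other ε/2 comes from
  -- approximating F within ε/4, since the inverse Cayley transform is 2-Lipschitz on the closed
  -- right half-plane.
  set τ : ℝ := 1 - min (1 / 2) (ε / 2) with hτ
  have hmin : 0 < min (1 / 2) (ε / 2) := by positivity
  have hτ1 : τ < 1 := by linarith
  have hτ0 : 0 < τ := by linarith [min_le_left (1 / 2) (ε / 2)]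
  have hu : ∀ z ∈ D, ‖(τ : ℂ) * f z‖ ≤ τ := by
    intro z hz
    rw [norm_mul, norm_real, Real.norm_of_nonneg hτ0.le]
    exact mul_le_of_le_one_right hτ0.le (mem_ball_zero_iff.1 (hfD hz)).le
  have h1u : ∀ z ∈ D, 1 - (τ : ℂ) * f z ≠ 0 := by
    intro z hz h
    have := hu z hz
    rw [← sub_eq_zero.1 h, norm_one] at this
    linarith
  set F : ℂ → ℂ := fun z => (1 + τ * f z) / (1 - τ * f z) with hF
  have hFd : DifferentiableOn ℂ F D :=
    ((hf.const_mul _).const_add 1).div ((hf.const_mul _).const_sub 1) h1u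
  have hm0 : 0 < (1 - τ ^ 2) / 4 := by nlinarith
  have hm : ∀ z ∈ D, (1 - τ ^ 2) / 4 ≤ (F z).re := by
    intro z hz
    have h1 := hu z hz
    have h2 : 0 < ‖1 - (τ : ℂ) * f z‖ := norm_pos_iff.2 (h1u z hz)
    have h3 : ‖1 - (τ : ℂ) * f z‖ ≤ 2 := by
      have := norm_sub_le (1 : ℂ) (τ * f z)
      rw [norm_one] at this
      linarith
    simp only [hF]
    -- F is the Herglotz kernel with η = 1, evaluated at τ f z.
    rw [re_herglotz norm_one]
    have h4 := norm_nonneg ((τ : ℂ) * f z)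
    have h5 : ‖1 - (τ : ℂ) * f z‖ ^ 2 ≤ 4 := by nlinarith
    have h6 : 1 - τ ^ 2 ≤ 1 - ‖(τ : ℂ) * f z‖ ^ 2 := by nlinarith
    have h7 : 0 ≤ 1 - τ ^ 2 := by nlinarith
    exact div_le_div₀ (h7.trans h6) h6 (by positivity) h5
  obtain ⟨G, T, c, Λ, s, hs1, hsR, hGd, hGre, hGK, hT, hΛ, hΛ0, hGφ⟩ :=
    S.exists_positive_approx hD.isOpen hD.isConnected hD.isBounded hFd hm0 hm hK hKD
      (ε := ε / 4) (by positivity)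
  obtain ⟨g, hga, hg1, hgf, hg', hgG⟩ :=
    S.exists_proper_of_positive hD.isOpen hs1 hsR hGd hGre hT hΛ hΛ0 hGφ
  refine ⟨g, hga, hg1, hgf, hg', fun z hz => ?_⟩
  have hzD := hKD hz
  have e : (τ : ℂ) * f z = (F z - 1) / (F z + 1) := by
    have h1 := h1u z hzD
    have h2 := add_one_ne_zero_of_re_nonneg (hm0.le.trans (hm z hzD))
    have h3 : F z * (1 - τ * f z) = 1 + τ * f z := div_mul_cancel₀ _ h1
    rw [eq_div_iff h2]
    linear_combination (-1 : ℂ) * h3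
  have h1 := norm_cayley_sub_le (hGre z hzD).le (hm0.le.trans (hm z hzD))
  rw [← hgG z hzD, ← e] at h1
  have h2 : ‖(τ : ℂ) * f z - f z‖ ≤ ε / 2 := by
    have e2 : (τ : ℂ) * f z - f z = ((τ - 1 : ℝ) : ℂ) * f z := by push_cast; ring
    have h3 : |τ - 1| ≤ ε / 2 := by
      rw [abs_sub_comm, abs_of_nonneg (by linarith), hτ]
      linarith [min_le_right (1 / 2) (ε / 2)]
    rw [e2, norm_mul, norm_real, Real.norm_eq_abs]
    exact (mul_le_of_le_one_right (abs_nonneg _) (mem_ball_zero_iff.1 (hfD hzD)).le).trans h3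
  have h3 := norm_sub_le_norm_sub_add_norm_sub (g z) ((τ : ℂ) * f z) (f z)
  have h4 := hGK z hz
  linarith

end ProperApprox

/-- `B n` (for `n ≥ 1`) is given as a function that is analytic in a neighbourhood of the closure
of `D`, so that `deriv (B n) z` is a genuine derivative at boundary points. -/
theorem theorem2 (ε : ℝ) (hε : 0 < ε) (D : Set ℂ) (hD : ProperApprox.IsAnalyticDomain D)
    (K : Set ℂ) (hKD : K ⊆ D) (hK : IsCompact K)
    (f : ℂ → ℂ) (hf : DifferentiableOn ℂ f D) (hfD : Set.MapsTo f D (Metric.ball 0 1)) :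
    ∃ (M : ℝ) (B : ℕ → ℂ → ℂ), 0 < M ∧
      (∀ n : ℕ, 1 ≤ n →
        AnalyticOnNhd ℂ (B n) (closure D) ∧ ProperApprox.IsProperToDisc D (B n)) ∧
      (⨆ (n : ℕ) (_ : 1 ≤ n), ProperApprox.supNorm K (fun z => B n z - f z)) < ENNReal.ofReal ε ∧
      (∀ n : ℕ, 1 ≤ n → ∀ z ∈ frontier D,
        (n : ℝ) / M ≤ ‖deriv (B n) z‖ ∧ ‖deriv (B n) z‖ ≤ (n : ℝ) * M) ∧
      -- each map is an explicit Blaschke product composed with one proper approximant of `f`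
      (∃ (g : ℂ → ℂ) (δ c : ℝ), DifferentiableOn ℂ g D ∧ ProperApprox.IsProperToDisc D g ∧
        ProperApprox.supNorm K (fun z => g z - f z) < ENNReal.ofReal ε ∧
        0 < δ ∧ δ < 1 ∧ 0 < c ∧ c < 1 ∧
        ∀ n : ℕ, 1 ≤ n → ∀ z ∈ D, B n z = ProperApprox.blaschke n δ c (g z)) := by
  obtain ⟨g, hg, hgD, hg1, hg', hgf⟩ :=
    ProperApprox.exists_proper_approx hD hKD hK hf hfD (ε := ε / 4) (by positivity)
  exact ProperApprox.exists_sequence_of_proper hD.isOpen hD.isBounded hKD hK hg hgD hg1 hg' hε hgf
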